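/- \textbf{Setting.} For $\theta\in\mathbb R$ let $Y(\theta)$ be the random output of one simulation run at $\theta$ (given by a jointly measurable function of $\theta$ and a random input; different runs use independent, identically distributed inputs). Put $\alpha(\theta)=\mathbb E[Y(\theta)]$, let $\sigma(\theta)$ be the standard deviation of $Y(\theta)$, fix $\theta_0\in\mathbb R$, and put $B=\alpha^{(3)}(\theta_0)/6$, $D=\alpha^{(5)}(\theta_0)/120$. A run pair at $h\ne0$ gives $\Delta(h)=\frac{Y(\theta_0+h)-Y(\theta_0-h)}{2h}$, the two runs being independent. \textbf{Estimator.} Let $K\ge2$, let $c_1,\dots,c_K$ be nonzero and pairwise distinct, with $|c_1|,\dots,|c_K|$ not all equal, and let $n_b,n$ be integers with $Kn_b\le n$. Put $h_k=c_kn_b^{-1/10}$ and let $\Delta_j(h_k)$, $1\le j\le n_b$, $1\le k\le K$, be computed from independent pilot pairs. Let $\mathbb E_*\widehat\Delta^b_{n_b,h_k}$ and $\mathrm{Var}_*[\widehat\Delta^b_{n_b,h_k}]$ be the bootstrap mean and the bootstrap variance of the average of $n_b$ independent uniform draws with replacement from $\Delta_1(h_k),\dots,\Delta_{n_b}(h_k)$.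 Let $X_e$ be the $K\times2$ matrix with rows $(1,h_k^2)$, $X_v\in\mathbb R^K$ the vector with entries $\frac{n_b-1}{2n_b^2h_k^2}$, and define the least-squares estimators $\widehat\beta_e=(X_e^\top X_e)^{-1}X_e^\top\big[\mathbb E_*\widehat\Delta^b_{n_b,h_k}\big]_k$ and $\widehat\beta_v=(X_v^\top X_v)^{-1}X_v^\top\big[\mathrm{Var}_*[\widehat\Delta^b_{n_b,h_k}]\big]_k$. Let $\widehat B$ be the second entry of $\widehat\beta_e$, and $$\widehat h_n=\Big(\frac{\widehat\beta_v}{4n\widehat B^2}\Big)^{1/6},\qquad \Delta^{cor}_j(h_k)=\frac{|h_k|}{|\widehat h_n|}\big(\Delta_j(h_k)-(1,h_k^2)\widehat\beta_e\big)+(1,\widehat h_n^2)\widehat\beta_e$$ (quotients with denominator $0$ are read as $0$). Given the pilot runs, generate $n_2=n-Kn_b$ further pairs at $\widehat h_n$ with fresh inputs. The correlation-induced central finite difference estimator is $$\widehat\Delta_{n,\widehat h_n}=\frac1n\Big(\sum_{i=1}^{n_2}\Delta_i(\widehat h_n)+\sum_{k=1}^K\sum_{j=1}^{n_b}\Delta_j^{cor}(h_k)\Big).$$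 \textbf{Constants.} Let $\boldsymbol c=(|c_1|,\dots,|c_K|)^\top$, $\boldsymbol c^4=(c_1^4,\dots,c_K^4)^\top$, $P=I-X_e(X_e^\top X_e)^{-1}X_e^\top$ (which does not depend on $n_b$), $\Lambda=\boldsymbol c^\top P\boldsymbol c^4$ and $q=\|\mathrm{Diag}(1/|c_1|,\dots,1/|c_K|)P\boldsymbol c\|_2^2$. \textbf{Theorem.} Suppose that (i) $\alpha$ is five times continuously differentiable in a neighbourhood of $\theta_0$, with $\alpha^{(3)}(\theta_0)\ne0$ and $\alpha^{(5)}(\theta_0)\neq0$; (ii) $\sigma$ is continuous at $\theta_0$ and $\sigma(\theta_0)>0$; (iii) $\mathbb E[(Y(\theta)-\alpha(\theta))^4]$ is bounded for $\theta\ne\theta_0$ near $\theta_0$. Let $n_b,n\to\infty$ along any sequence with $Kn_b\le n$ along which (iv) the squared normalized errors $n^{2/3}\big(\widehat\Delta_{n,\widehat h_n}-\alpha'(\theta_0)\big)^2$ are uniformly integrable. Then, with $x^{1/3}$ the real cube root, $$\mathbb E[\widehat\Delta_{n,\widehat h_n}]=\alpha'(\theta_0)+\Big(\frac{B\sigma^2(\theta_0)}{4n}\Big)^{1/3}+\Big(\frac{4B^2}{\sigma^2(\theta_0)}\Big)^{1/6}\sqrt{\frac{n_b}{n}}\,D\Lambda\,n^{-1/3}+o(n^{-1/3}),$$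 $$\mathrm{Var}[\widehat\Delta_{n,\widehat h_n}]=\Big(\frac{B^2\sigma^4(\theta_0)}{2n^2}\Big)^{1/3}+\Big(\frac{B^2\sigma^4(\theta_0)}{2}\Big)^{1/3}\frac{n_b}{n}(q-K)\,n^{-2/3}+o(n^{-2/3}),$$ and the mean squared error $\mathrm{MSE}[\widehat\Delta_{n,\widehat h_n}]=\mathbb E\big[(\widehat\Delta_{n,\widehat h_n}-\alpha'(\theta_0))^2\big]$ satisfies $$\mathrm{MSE}[\widehat\Delta_{n,\widehat h_n}]=3\Big(\frac{B^2\sigma^4(\theta_0)}{16n^2}\Big)^{1/3}+\Big\{\Big(\frac{4B^2}{\sigma^2(\theta_0)}\Big)^{1/3}\sqrt{\frac{n_b}{n}}\,D\Lambda\Big(\sqrt{\frac{n_b}{n}}\,D\Lambda+\mathrm{sign}(B)\,\sigma(\theta_0)\Big)+\Big(\frac{B^2\sigma^4(\theta_0)}{2}\Big)^{1/3}\frac{n_b}{n}(q-K)\Big\}n^{-2/3}+o(n^{-2/3}).$$ -/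

import Mathlib

open MeasureTheory ProbabilityTheory Filter Topology Asymptotics Matrix
open scoped NNReal ENNReal

noncomputable section

namespace CorCFD

/-! Simulation model. One run of the simulation at parameter `θ` with random input `u` returns
`G θ u`; the random inputs of different runs are independent with common law `ν`, so that the
output `Y(θ)` has the law of `G θ` under `ν`. -/

/-- The performance measure `α(θ) = E[Y(θ)]`. -/
def perf {S : Type*} [MeasurableSpace S] (G : ℝ → S → ℝ) (ν : Measure S) (θ : ℝ) : ℝ :=
  ∫ u, G θ u ∂ν

/-- The standard deviation `σ(θ)` of `Y(θ)`. -/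
def stdDev {S : Type*} [MeasurableSpace S] (G : ℝ → S → ℝ) (ν : Measure S) (θ : ℝ) : ℝ :=
  √(variance (G θ) ν)

/-- `B = α'''(θ₀) / 6`. -/
def coeffB {S : Type*} [MeasurableSpace S] (G : ℝ → S → ℝ) (ν : Measure S) (θ₀ : ℝ) : ℝ :=
  iteratedDeriv 3 (perf G ν) θ₀ / 6

/-- `D = α⁽⁵⁾(θ₀) / 120`. -/
def coeffD {S : Type*} [MeasurableSpace S] (G : ℝ → S → ℝ) (ν : Measure S) (θ₀ : ℝ) : ℝ :=
  iteratedDeriv 5 (perf G ν) θ₀ / 120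

/-- The real cube root, defined for negative numbers as well. -/
def cbrt (x : ℝ) : ℝ := Real.sign x * |x| ^ (1 / 3 : ℝ)

/-! Bootstrap. -/

/-- The expectation under the bootstrap law given the sample `x`, of a function `g` of the
resample: `N` draws from `x 0, …, x (N - 1)`, independent, uniform, with replacement. All
`N ^ N` choices of indices have the same probability. -/
def bootExp {N : ℕ} (x : Fin N → ℝ) (g : (Fin N → ℝ) → ℝ) : ℝ :=
  (∑ s : Fin N → Fin N, g (fun i => x (s i))) / (N : ℝ) ^ N

/-- The average of a sample. -/
def sampleAvg {N : ℕ} (x : Fin N → ℝ) : ℝ := (∑ i, x i) / N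

/-- The bootstrap mean of the average of the resample. -/
def bootMean {N : ℕ} (x : Fin N → ℝ) : ℝ := bootExp x sampleAvg

/-- The bootstrap variance of the average of the resample. -/
def bootVar {N : ℕ} (x : Fin N → ℝ) : ℝ :=
  bootExp x (fun y => (sampleAvg y - bootMean x) ^ 2)

/-! Regression. -/

/-- The design matrix `X_e` with rows `(1, h_k ^ 2)`. -/
def designE {K : ℕ} (h : Fin K → ℝ) : Matrix (Fin K) (Fin 2) ℝ :=
  Matrix.of fun k => ![1, h k ^ 2]

/-- The one-column design matrix `X_v` with entries `(n_b - 1) / (2 n_b ^ 2 h_k ^ 2)`. -/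
def designV {K : ℕ} (nb : ℕ) (h : Fin K → ℝ) : Matrix (Fin K) (Fin 1) ℝ :=
  Matrix.of fun k _ => ((nb : ℝ) - 1) / (2 * (nb : ℝ) ^ 2 * h k ^ 2)

/-- The least-squares solution `(Xᵀ X)⁻¹ Xᵀ Y`. -/
def leastSquares {K p : ℕ} (X : Matrix (Fin K) (Fin p) ℝ) (Y : Fin K → ℝ) : Fin p → ℝ :=
  ((Xᵀ * X)⁻¹ * Xᵀ) *ᵥ Y

/-- The residual projection `P = I - X_e (X_eᵀ X_e)⁻¹ X_eᵀ`. -/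
def residualProj {K : ℕ} (h : Fin K → ℝ) : Matrix (Fin K) (Fin K) ℝ :=
  1 - designE h * ((designE h)ᵀ * designE h)⁻¹ * (designE h)ᵀ

/-- `P` is the same for `h_k = c_k t` as for `c_k`. -/
theorem residualProj_scale {K : ℕ} (c : Fin K → ℝ) {t : ℝ} (ht : t ≠ 0) :
    residualProj (fun k => c k * t) = residualProj c := by
  have hX : designE (fun k => c k * t) = designE c * Matrix.diagonal ![1, t ^ 2] := by
    ext k i
    rw [Matrix.mul_diagonal]
    fin_cases i <;> simp [designE, mul_pow]
  have hu : IsUnit (Matrix.diagonal ![(1 : ℝ), t ^ 2]).det := by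
    simp [Matrix.det_diagonal, Fin.prod_univ_two, ht]
  unfold residualProj
  rw [hX]
  simp only [Matrix.transpose_mul, Matrix.diagonal_transpose]
  have h1 : (Matrix.diagonal ![1, t ^ 2] * (designE c)ᵀ * (designE c *
      Matrix.diagonal ![1, t ^ 2]))⁻¹ = (Matrix.diagonal ![1, t ^ 2])⁻¹ *
      ((designE c)ᵀ * designE c)⁻¹ * (Matrix.diagonal ![1, t ^ 2])⁻¹ := by
    rw [show Matrix.diagonal ![1, t ^ 2] * (designE c)ᵀ * (designE c *
      Matrix.diagonal ![1, t ^ 2]) = Matrix.diagonal ![1, t ^ 2] *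
      ((designE c)ᵀ * designE c) * Matrix.diagonal ![1, t ^ 2] by simp only [Matrix.mul_assoc]]
    rw [Matrix.mul_inv_rev, Matrix.mul_inv_rev, Matrix.mul_assoc]
  rw [h1]
  congr 1
  calc _ = designE c * (Matrix.diagonal ![1, t ^ 2] * (Matrix.diagonal ![1, t ^ 2])⁻¹) *
        ((designE c)ᵀ * designE c)⁻¹ *
        ((Matrix.diagonal ![1, t ^ 2])⁻¹ * Matrix.diagonal ![1, t ^ 2]) * (designE c)ᵀ := by
        simp only [Matrix.mul_assoc]
    _ = _ := by
        rw [Matrix.mul_nonsing_inv _ hu, Matrix.nonsing_inv_mul _ hu, Matrix.mul_one,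
          Matrix.mul_one]

/-- `Λ = cᵀ P c⁴` with `c = (|c_1|, …, |c_K|)` and `c⁴ = (c_1 ^ 4, …, c_K ^ 4)`. -/
def Lam {K : ℕ} (c : Fin K → ℝ) : ℝ :=
  (fun k => |c k|) ⬝ᵥ (residualProj c *ᵥ (fun k => c k ^ 4))

/-- `q = ‖Diag(c⁻¹) P c‖₂ ^ 2` with `c = (|c_1|, …, |c_K|)`. -/
def qConst {K : ℕ} (c : Fin K → ℝ) : ℝ :=
  ∑ k, ((Matrix.diagonal (fun k => 1 / |c k|) * residualProj c) *ᵥ (fun k => |c k|)) k ^ 2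

/-! The estimator as a function of the data. The array `x` holds the pilot differences
`x k j = Δ_j(h_k)`, and `z` holds the differences at the estimated perturbation. -/

/-- The regression estimator of `(α'(θ₀), B)`. -/
def betaE {K nb : ℕ} (h : Fin K → ℝ) (x : Fin K → Fin nb → ℝ) : Fin 2 → ℝ :=
  leastSquares (designE h) (fun k => bootMean (x k))

/-- The regression estimator of `σ²(θ₀)`. -/
def betaV {K nb : ℕ} (h : Fin K → ℝ) (x : Fin K → Fin nb → ℝ) : ℝ :=
  leastSquares (designV nb h) (fun k => bootVar (x k)) 0

/-- The estimated optimal perturbation. -/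
def hHat {K nb : ℕ} (n : ℕ) (h : Fin K → ℝ) (x : Fin K → Fin nb → ℝ) : ℝ :=
  (betaV h x / (4 * (n : ℝ) * betaE h x 1 ^ 2)) ^ (1 / 6 : ℝ)

/-- The regression line `(1, t ^ 2) β`. -/
def fitted (β : Fin 2 → ℝ) (t : ℝ) : ℝ := β 0 + t ^ 2 * β 1

/-- The transformed pilot difference `Δ_j^cor(h_k)`. -/
def deltaCor {K nb : ℕ} (n : ℕ) (h : Fin K → ℝ) (x : Fin K → Fin nb → ℝ)
    (k : Fin K) (j : Fin nb) : ℝ :=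
  |h k| / |hHat n h x| * (x k j - fitted (betaE h x) (h k)) + fitted (betaE h x) (hHat n h x)

/-- The correlation-induced central finite difference estimator. -/
def corCFD {K nb : ℕ} (n : ℕ) (h : Fin K → ℝ) (x : Fin K → Fin nb → ℝ)
    (z : Fin (n - K * nb) → ℝ) : ℝ :=
  (∑ i, z i + ∑ k, ∑ j, deltaCor n h x k j) / n

/-! The estimator as a random variable. -/

/-- Labels of the simulation runs: `Sum.inl (k, j, s)` is the run for the `j`-th pilot pair at
`h_k`, and `Sum.inr (i, s)` is the run for the `i`-th pair at the estimated perturbation; `s` is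
`true` for the run at `θ₀ + h` and `false` for the run at `θ₀ - h`. -/
abbrev Run (K : ℕ) : Type := (Fin K × ℕ × Bool) ⊕ (ℕ × Bool)

/-- The pilot perturbations `h_k = c_k n_b ^ (-1/10)`. -/
def pilotStep {K : ℕ} (c : Fin K → ℝ) (nb : ℕ) (k : Fin K) : ℝ :=
  c k * (nb : ℝ) ^ (-(1 / 10) : ℝ)

/-- The difference quotient `Δ(h)` computed with inputs `u` at `θ₀ + h` and `v` at `θ₀ - h`. -/
def diffQuot {S : Type*} (G : ℝ → S → ℝ) (θ₀ h : ℝ) (u v : S) : ℝ :=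
  (G (θ₀ + h) u - G (θ₀ - h) v) / (2 * h)

/-- The pilot differences `Δ_j(h_k)`. -/
def pilot {S Ω : Type*} {K : ℕ} (G : ℝ → S → ℝ) (θ₀ : ℝ) (c : Fin K → ℝ) (U : Run K → Ω → S)
    (nb : ℕ) (ω : Ω) (k : Fin K) (j : Fin nb) : ℝ :=
  diffQuot G θ₀ (pilotStep c nb k) (U (Sum.inl (k, (j : ℕ), true)) ω)
    (U (Sum.inl (k, (j : ℕ), false)) ω)

/-- The estimated perturbation computed from the pilot runs. -/
def randomStep {S Ω : Type*} {K : ℕ} (G : ℝ → S → ℝ) (θ₀ : ℝ) (c : Fin K → ℝ)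
    (U : Run K → Ω → S) (nb n : ℕ) (ω : Ω) : ℝ :=
  hHat n (pilotStep c nb) (pilot G θ₀ c U nb ω)

/-- The estimator with `n_b` pilot pairs at each of the `K` pilot perturbations and
`n - K n_b` further pairs, generated with fresh inputs at the estimated perturbation. -/
def estimator {S Ω : Type*} {K : ℕ} (G : ℝ → S → ℝ) (θ₀ : ℝ) (c : Fin K → ℝ)
    (U : Run K → Ω → S) (nb n : ℕ) (ω : Ω) : ℝ :=
  corCFD n (pilotStep c nb) (pilot G θ₀ c U nb ω) fun i =>
    diffQuot G θ₀ (randomStep G θ₀ c U nb n ω) (U (Sum.inr ((i : ℕ), true)) ω)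
      (U (Sum.inr ((i : ℕ), false)) ω)

end CorCFD

end

/-! Write N for n_b, ρ = N/n, t = N^(-1/10), p = n^(1/6). At h_k = c_k t a pilot average has quartic
bias about D h_k⁴ and noise of size N^(-1/2)/t = t⁴, so it equals α' + B h_k² + t⁴ ζ_k, where ζ_k is
D c_k⁴ + o(1) plus noise bounded in L². The regression therefore returns α' up to order t⁴, B up to
order t², and residuals t⁴ Pζ (`betaE_pilot`). The variance regression is consistent by a weak law
(`tendsto_betaV`). Hence p ĥ → a in probability, where 4B²a⁶ = σ².

The normalized error is an exact sum (`normalized_error_eq`) of the second stage noise, the second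
stage bias with weight 1 - Kρ, the fitted quadratic bias with weight Kρ, the residual term √ρ/(pĥ) Σ
w_k ζ_k with w = P|c|, and an intercept error that vanishes. Both biases tend to Ba², so the two
weights add up to one; the bias part of ζ contributes √ρ DΛ/a. The pilot noise has variance about ρ
q σ²/(2a²), the second stage noise about (1 - Kρ) σ²/(2a²).

The difficulty is to pass from limits in probability to moments while the step is random. The error
is compared with `pilotTerm` + `stageTerm`, where the step is replaced by its limit except in the
second stage noise; there it stays, with a weight cut off when the step has the wrong size. Given
the pilot inputs that noise is a sum of centred independent terms at a fixed step, so its moments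
follow by conditioning (`random_step_moments`) and it is orthogonal to the pilot term. The
comparison term is bounded in L⁴ and the error is uniformly square integrable, so Vitali's theorem
turns convergence in probability into convergence in L² (`tendsto_eLpNorm_sub_of_probFilter`), and
the first two moments carry over (`Setting.tendsto_moments`).

The ratio ρ need not converge. Only its boundedness is used, and the results are differences tending
to zero. The relation 4B²a⁶ = σ² finally converts the constants. -/

noncomputable section

namespace CorCFD

/-! ### Convergence in probability as convergence along a filter. -/

section ProbFilter

variable {Ω : Type*} [MeasurableSpace Ω] {μ : Measure Ω}

/-- The filter on `ℕ × Ω` of the events whose `m`-th section has probability tending to one. A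
sequence of random variables converges in probability when it converges along this filter. -/
def probFilter (μ : Measure Ω) : Filter (ℕ × Ω) where
  sets := {s | Tendsto (fun m => μ {ω | (m, ω) ∉ s}) atTop (𝓝 0)}
  univ_sets := by simp
  sets_of_superset := fun {s t} hs hst =>
    tendsto_of_tendsto_of_tendsto_of_le_of_le tendsto_const_nhds hs (fun _ => zero_le)
      fun m => measure_mono fun ω hω h => hω (hst h)
  inter_sets := fun {s t} hs ht => by
    have h := Tendsto.add (Set.mem_ofPred.1 hs) (Set.mem_ofPred.1 ht)
    rw [add_zero] at h
    refine tendsto_of_tendsto_of_tendsto_of_le_of_le tendsto_const_nhds h (fun _ => zero_le)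
      fun m => (measure_mono fun ω hω => ?_).trans (measure_union_le _ _)
    by_cases h1 : (m, ω) ∈ s
    · exact Or.inr fun h2 => hω ⟨h1, h2⟩
    · exact Or.inl h1

theorem mem_probFilter {s : Set (ℕ × Ω)} :
    s ∈ probFilter μ ↔ Tendsto (fun m => μ {ω | (m, ω) ∉ s}) atTop (𝓝 0) := Iff.rfl

theorem eventually_probFilter {P : ℕ × Ω → Prop} :
    (∀ᶠ p in probFilter μ, P p) ↔ Tendsto (fun m => μ {ω | ¬ P (m, ω)}) atTop (𝓝 0) := Iff.rfl

theorem tendsto_probFilter_iff {X : ℕ × Ω → ℝ} {a : ℝ} :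
    Tendsto X (probFilter μ) (𝓝 a) ↔
      ∀ ε > 0, Tendsto (fun m => μ {ω | ε ≤ |X (m, ω) - a|}) atTop (𝓝 0) := by
  rw [Metric.tendsto_nhds]
  refine forall₂_congr fun ε _ => ?_
  rw [eventually_probFilter]
  simp only [Real.dist_eq, not_lt]

/-- Deterministic limits, and properties of the sample sizes that hold eventually, enter arguments
in probability through this projection; sums, products and continuous images are then ordinary
filter limits. -/
theorem tendsto_fst_probFilter : Tendsto Prod.fst (probFilter μ) atTop := by
  intro s hs
  rw [mem_map, mem_probFilter]
  refine tendsto_const_nhds.congr' ?_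
  filter_upwards [hs] with m hm
  simp [hm]

theorem tendsto_probFilter_of_atTop {f : ℕ → ℝ} {l : Filter ℝ} (hf : Tendsto f atTop l) :
    Tendsto (fun p : ℕ × Ω => f p.1) (probFilter μ) l := hf.comp tendsto_fst_probFilter

theorem tendstoInMeasure_of_probFilter {X : ℕ → Ω → ℝ} {g : Ω → ℝ}
    (h : Tendsto (fun p : ℕ × Ω => X p.1 p.2 - g p.2) (probFilter μ) (𝓝 0)) :
    TendstoInMeasure μ X atTop g := by
  rw [tendstoInMeasure_iff_norm]
  intro ε hε
  simpa using tendsto_probFilter_iff.1 h ε hε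

/-- Chebyshev's inequality with second moments. -/
theorem tendsto_probFilter_of_integral_sq [IsProbabilityMeasure μ] {X : ℕ → Ω → ℝ}
    (hint : ∀ᶠ m in atTop, Integrable (fun ω => X m ω ^ 2) μ)
    (h : Tendsto (fun m => ∫ ω, X m ω ^ 2 ∂μ) atTop (𝓝 0)) :
    Tendsto (fun p : ℕ × Ω => X p.1 p.2) (probFilter μ) (𝓝 0) := by
  rw [tendsto_probFilter_iff]
  intro ε hε
  have h' : Tendsto (fun m => ENNReal.ofReal ((∫ ω, X m ω ^ 2 ∂μ) / ε ^ 2)) atTop (𝓝 0) := by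
    have := ENNReal.tendsto_ofReal (h.div_const (ε ^ 2))
    simpa using this
  refine tendsto_of_tendsto_of_tendsto_of_le_of_le' tendsto_const_nhds h'
    (Eventually.of_forall fun _ => zero_le) ?_
  filter_upwards [hint] with m hm
  have h1 := mul_meas_ge_le_integral_of_nonneg (Eventually.of_forall fun ω => sq_nonneg (X m ω)) hm
    (ε ^ 2)
  have h2 : {ω | ε ≤ |X m ω - 0|} = {ω | ε ^ 2 ≤ X m ω ^ 2} := by
    ext ω
    simp only [sub_zero, Set.mem_ofPred_eq]
    rw [← sq_abs (X m ω)]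
    exact (pow_le_pow_iff_left₀ hε.le (abs_nonneg _) two_ne_zero).symm
  rw [h2, ← ofReal_measureReal]
  apply ENNReal.ofReal_le_ofReal
  rw [le_div_iff₀ (by positivity), mul_comm]
  exact h1

/-- A product of a sequence tending to zero in probability with a sequence bounded in `L²` tends
to zero in probability. -/
theorem tendsto_probFilter_mul_of_integral_sq_le [IsProbabilityMeasure μ] {X : ℕ × Ω → ℝ}
    {Y : ℕ → Ω → ℝ} (hX : Tendsto X (probFilter μ) (𝓝 0)) {C : ℝ}
    (hint : ∀ᶠ m in atTop, Integrable (fun ω => Y m ω ^ 2) μ)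
    (h : ∀ᶠ m in atTop, ∫ ω, Y m ω ^ 2 ∂μ ≤ C) :
    Tendsto (fun p : ℕ × Ω => X p * Y p.1 p.2) (probFilter μ) (𝓝 0) := by
  rw [tendsto_probFilter_iff]
  intro ε hε
  rw [ENNReal.tendsto_nhds_zero]
  intro δ hδ
  obtain ⟨δ', hδ'0, hδ'⟩ : ∃ δ' : ℝ≥0, 0 < δ' ∧ (δ' : ℝ≥0∞) < δ := by
    obtain ⟨d, h1, h2⟩ := ENNReal.lt_iff_exists_nnreal_btwn.1 hδ
    exact ⟨d, by exact_mod_cast h1, h2⟩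
  -- Chebyshev gives |Y| ≥ M with probability at most C / M², made at most δ'/2 here. Where |Y| < M,
  -- a product of size ε forces |X| ≥ ε / M.
  obtain ⟨M, hM0, hM⟩ : ∃ M : ℝ, 0 < M ∧ C / M ^ 2 ≤ δ' / 2 := by
    have ht : Tendsto (fun M : ℝ => C / M ^ 2) atTop (𝓝 0) :=
      tendsto_const_nhds.div_atTop (tendsto_pow_atTop two_ne_zero)
    have h3 := (ht.eventually_lt_const (show (0 : ℝ) < δ' / 2 by positivity)).and
      (eventually_gt_atTop 0)
    obtain ⟨M, h1, h2⟩ := h3.exists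
    exact ⟨M, h2, h1.le⟩
  have hX' := (ENNReal.tendsto_nhds_zero.1 (tendsto_probFilter_iff.1 hX (ε / M) (by positivity)))
    (ENNReal.ofReal (δ' / 2)) (by simpa using hδ'0)
  filter_upwards [hint, h, hX'] with m h1 h2 h3
  have h4 := mul_meas_ge_le_integral_of_nonneg (Eventually.of_forall fun ω => sq_nonneg (Y m ω)) h1
    (M ^ 2)
  have h5 : μ {ω | M ^ 2 ≤ Y m ω ^ 2} ≤ ENNReal.ofReal (δ' / 2) := by
    rw [← ofReal_measureReal]
    apply ENNReal.ofReal_le_ofReal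
    refine le_trans ?_ hM
    rw [le_div_iff₀ (by positivity), mul_comm]
    exact h4.trans h2
  have h6 : {ω | ε ≤ |X (m, ω) * Y m ω - 0|} ⊆
      {ω | ε / M ≤ |X (m, ω) - 0|} ∪ {ω | M ^ 2 ≤ Y m ω ^ 2} := by
    intro ω hω
    simp only [sub_zero, Set.mem_ofPred_eq, Set.mem_union] at hω ⊢
    by_contra! hcon
    obtain ⟨g1, g2⟩ := hcon
    have g3 : |Y m ω| < M := by
      rw [← sq_abs] at g2
      exact lt_of_pow_lt_pow_left₀ 2 hM0.le g2
    rw [abs_mul] at hω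
    have : |X (m, ω)| * |Y m ω| ≤ |X (m, ω)| * M := by gcongr
    have h7 : |X (m, ω)| * M < ε := by rwa [lt_div_iff₀ hM0] at g1
    linarith
  calc _ ≤ _ := (measure_mono h6).trans (measure_union_le _ _)
    _ ≤ ENNReal.ofReal (δ' / 2) + ENNReal.ofReal (δ' / 2) := add_le_add h3 h5
    _ = δ' := by
      rw [← ENNReal.ofReal_add (by positivity) (by positivity), add_halves]
      simp
    _ ≤ δ := hδ'.le

/-- Bounded convergence in probability. -/
theorem tendsto_integral_of_probFilter [IsProbabilityMeasure μ] {X : ℕ → Ω → ℝ} {a C : ℝ}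
    (hm : ∀ m, AEStronglyMeasurable (X m) μ) (hb : ∀ m ω, |X m ω| ≤ C)
    (hX : Tendsto (fun p : ℕ × Ω => X p.1 p.2) (probFilter μ) (𝓝 a)) :
    Tendsto (fun m => ∫ ω, X m ω ∂μ) atTop (𝓝 a) := by
  have hint : ∀ m, Integrable (X m) μ := fun m =>
    Integrable.of_bound (hm m) C (Eventually.of_forall fun ω => by simpa using hb m ω)
  have hC : 0 ≤ C := by
    have : Nonempty Ω := by
      by_contra hne
      rw [not_nonempty_iff] at hne
      have := measure_univ (μ := μ)
      rw [Set.univ_eq_empty_iff.2 hne, measure_empty] at this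
      exact zero_ne_one this
    exact (abs_nonneg _).trans (hb 0 (Classical.arbitrary Ω))
  rw [Metric.tendsto_atTop']
  intro ε hε
  have hX' := tendsto_probFilter_iff.1 hX (ε / 2) (by positivity)
  have hX2 : Tendsto (fun m => μ.real {ω | ε / 2 ≤ |X m ω - a|}) atTop (𝓝 0) := by
    have := (ENNReal.tendsto_toReal ENNReal.zero_ne_top).comp hX'
    rwa [ENNReal.toReal_zero] at this
  have hX3 : Tendsto (fun m => ε / 2 + (C + |a|) * μ.real {ω | ε / 2 ≤ |X m ω - a|}) atTop
      (𝓝 (ε / 2)) := by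
    simpa using (hX2.const_mul (C + |a|)).const_add (ε / 2)
  obtain ⟨N, hN⟩ := eventually_atTop.1 (hX3.eventually_lt_const (half_lt_self hε))
  refine ⟨N, fun m hmN => lt_of_le_of_lt ?_ (hN m hmN.le)⟩
  have hmeas : NullMeasurableSet {ω | ε / 2 ≤ |X m ω - a|} μ :=
    nullMeasurableSet_le aemeasurable_const
      (((hm m).aemeasurable.sub_const a).norm)
  rw [Real.dist_eq]
  have e1 : (∫ ω, X m ω ∂μ) - a = ∫ ω, (X m ω - a) ∂μ := by
    rw [integral_sub (hint m) (integrable_const _)]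
    simp
  rw [e1]
  have hind : Integrable ({ω | ε / 2 ≤ |X m ω - a|}.indicator fun _ => C + |a|) μ :=
    (integrable_const _).indicator₀ hmeas
  -- The integrand is below ε/2 off the exceptional event and at most C + |a| on it.
  calc |∫ ω, (X m ω - a) ∂μ| ≤ ∫ ω, |X m ω - a| ∂μ := abs_integral_le_integral_abs
    _ ≤ ∫ ω, (ε / 2 + ({ω | ε / 2 ≤ |X m ω - a|}.indicator (fun _ => C + |a|)) ω) ∂μ := by
      refine integral_mono ((hint m).sub (integrable_const _)).abs
        ((integrable_const _).add hind) fun ω => ?_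
      by_cases hω : ω ∈ {ω | ε / 2 ≤ |X m ω - a|}
      · simp only [Set.indicator_of_mem hω]
        have := abs_sub (X m ω) a
        have := hb m ω
        linarith
      · simp only [Set.indicator_of_notMem hω]
        simp only [Set.mem_ofPred_eq, not_le] at hω
        linarith
    _ = _ := by
      rw [integral_add (integrable_const _) hind, integral_indicator₀ hmeas]
      simp [mul_comm]

/-- If `Z` is uniformly integrable in `L²`, `W` is bounded in `L⁴` and `Z - W` tends to zero in
probability, then `Z - W` tends to zero in `L²`. -/
theorem tendsto_eLpNorm_sub_of_probFilter [IsProbabilityMeasure μ] {Z W : ℕ → Ω → ℝ}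
    (hZ : UniformIntegrable Z 2 μ) (hWm : ∀ m, AEStronglyMeasurable (W m) μ) {C : ℝ≥0}
    (hW : ∀ᶠ m in atTop, eLpNorm (W m) 4 μ ≤ C)
    (h : Tendsto (fun p : ℕ × Ω => Z p.1 p.2 - W p.1 p.2) (probFilter μ) (𝓝 0)) :
    Tendsto (fun m => eLpNorm (Z m - W m) 2 μ) atTop (𝓝 0) := by
  obtain ⟨N, hN⟩ := eventually_atTop.1 hW
  -- The bound on `W` holds only eventually, whereas uniform integrability concerns every index, so
  -- the early terms are replaced by zero.
  set V : ℕ → Ω → ℝ := fun m => if N ≤ m then W m else 0 with hV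
  have hVm : ∀ m, AEStronglyMeasurable (V m) μ := fun m => by
    simp only [hV]
    split_ifs
    · exact hWm m
    · exact aestronglyMeasurable_zero
  have hVC : ∀ m, eLpNorm (V m) 4 μ ≤ C := fun m => by
    simp only [hV]
    split_ifs with hm
    · exact hN m hm
    · simp
  have hVui : UnifIntegrable V 2 μ := by
    intro ε hε
    -- By Hölder the L² norm over a set s is at most C μ(s)^(1/4); adding 1 to C avoids dividing by
    -- zero.
    refine ⟨(ε / (C + 1)) ^ 4, by positivity, fun m s hs hμs => ?_⟩
    rw [eLpNorm_indicator_eq_eLpNorm_restrict hs]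
    refine (eLpNorm_le_eLpNorm_mul_rpow_measure_univ (q := 4)
      (by norm_num) (hVm m).restrict).trans ?_
    rw [Measure.restrict_apply_univ]
    have h1 : (1 / (2 : ℝ≥0∞).toReal - 1 / (4 : ℝ≥0∞).toReal) = 1 / 4 := by norm_num
    rw [h1]
    calc _ ≤ (C : ℝ≥0∞) * (ENNReal.ofReal ((ε / (C + 1)) ^ 4)) ^ (1 / 4 : ℝ) := by
          gcongr
          exact (eLpNorm_restrict_le _ _ _ _).trans (hVC m)
      _ = ENNReal.ofReal (C * (ε / (C + 1))) := by
          rw [ENNReal.ofReal_rpow_of_nonneg (by positivity) (by norm_num),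
            ENNReal.ofReal_mul (by positivity), ← Real.rpow_natCast,
            ← Real.rpow_mul (by positivity)]
          norm_num
      _ ≤ ENNReal.ofReal ε := by
          apply ENNReal.ofReal_le_ofReal
          rw [mul_div_assoc', div_le_iff₀ (by positivity)]
          nlinarith [C.coe_nonneg]
  -- Vitali's theorem, applied to the uniformly integrable difference.
  have hlim : Tendsto (fun m => eLpNorm ((Z - V) m - (0 : Ω → ℝ)) 2 μ) atTop (𝓝 0) := by
    refine tendsto_Lp_finite_of_tendstoInMeasure (by norm_num) (by norm_num)
      (fun m => (hZ.1 m).sub (hVm m)) MemLp.zero (hZ.2.1.sub hVui (by norm_num) hZ.1 hVm) ?_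
    apply tendstoInMeasure_of_probFilter
    refine h.congr' ?_
    filter_upwards [tendsto_fst_probFilter.eventually (eventually_ge_atTop N)] with p hp
    simp [hV, hp]
  refine hlim.congr' ?_
  filter_upwards [eventually_ge_atTop N] with m hm
  simp [hV, hm]

end ProbFilter

/-! ### Second and fourth moments of sums of independent centred variables. -/

section Moments

variable {Ω : Type*} [MeasurableSpace Ω] {μ : Measure Ω}

theorem integrable_pow_of_memLp [IsFiniteMeasure μ] {X : Ω → ℝ} {p : ℕ} (hX : MemLp X p μ) :
    Integrable (fun ω => X ω ^ p) μ := by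
  refine (hX.integrable_norm_pow').mono (hX.1.pow p) (Eventually.of_forall fun ω => ?_)
  simp

theorem integrable_pow_of_memLp_four [IsFiniteMeasure μ] {X : Ω → ℝ} (hX : MemLp X 4 μ) {p : ℕ}
    (hp : p ≤ 4) : Integrable (fun ω => X ω ^ p) μ :=
  integrable_pow_of_memLp (hX.mono_exponent (by exact_mod_cast hp))

theorem memLp_four_of_integrable {X : Ω → ℝ} (hm : AEStronglyMeasurable X μ)
    (h : Integrable (fun ω => X ω ^ 4) μ) : MemLp X 4 μ := by
  rw [← integrable_norm_rpow_iff hm (by norm_num) (by norm_num)]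
  refine h.congr (Eventually.of_forall fun ω => ?_)
  have : ((4 : ℝ≥0∞).toReal) = ((4 : ℕ) : ℝ) := by norm_num
  simp only [this, Real.rpow_natCast, Real.norm_eq_abs]
  exact ((by decide : Even 4).pow_abs _).symm

theorem eLpNorm_four_le [IsFiniteMeasure μ] {X : Ω → ℝ} {C : ℝ} (hX : MemLp X 4 μ)
    (h : ∫ ω, X ω ^ 4 ∂μ ≤ C) : eLpNorm X 4 μ ≤ (C ^ (1 / 4 : ℝ)).toNNReal := by
  rw [hX.eLpNorm_eq_integral_rpow_norm (by norm_num) (by norm_num)]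
  have h4 : ((4 : ℝ≥0∞).toReal) = ((4 : ℕ) : ℝ) := by norm_num
  simp only [h4, Real.rpow_natCast, Real.norm_eq_abs, (by decide : Even 4).pow_abs]
  rw [ENNReal.ofReal]
  norm_cast
  apply Real.toNNReal_le_toNNReal
  have h0 : 0 ≤ ∫ ω, X ω ^ 4 ∂μ := integral_nonneg fun ω => by positivity
  rw [one_div]
  gcongr

/-- Expand 0 ≤ E(X² - a)² with a = E X². -/
theorem sq_integral_sq_le [IsProbabilityMeasure μ] {X : Ω → ℝ} (hX : MemLp X 4 μ) :
    (∫ ω, X ω ^ 2 ∂μ) ^ 2 ≤ ∫ ω, X ω ^ 4 ∂μ := by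
  have h2 := integrable_pow_of_memLp_four hX (p := 2) (by norm_num)
  have h4 := integrable_pow_of_memLp_four hX (p := 4) le_rfl
  set a := ∫ ω, X ω ^ 2 ∂μ with ha
  have h : 0 ≤ ∫ ω, (X ω ^ 4 - 2 * a * X ω ^ 2 + a ^ 2) ∂μ :=
    integral_nonneg fun ω => by
      have := sq_nonneg (X ω ^ 2 - a)
      simp only [Pi.zero_apply]
      nlinarith
  have h42 : Integrable (fun ω => X ω ^ 4 - 2 * a * X ω ^ 2) μ := h4.sub (h2.const_mul _)
  rw [integral_add h42 (integrable_const _), integral_sub h4 (h2.const_mul _),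
    integral_const_mul] at h
  simp only [integral_const, probReal_univ, smul_eq_mul, one_mul, ← ha] at h
  nlinarith

theorem integral_sq_le_sqrt [IsProbabilityMeasure μ] {X : Ω → ℝ} (hX : MemLp X 4 μ) {M : ℝ}
    (h : ∫ ω, X ω ^ 4 ∂μ ≤ M) : ∫ ω, X ω ^ 2 ∂μ ≤ √M :=
  Real.le_sqrt_of_sq_le ((sq_integral_sq_le hX).trans h)

variable {ι : Type*} {Y : ι → Ω → ℝ}

theorem memLp_sum_four (hL : ∀ i, MemLp (Y i) 4 μ) (s : Finset ι) :
    MemLp (∑ i ∈ s, Y i) 4 μ := memLp_finsetSum' s fun i _ => hL i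

variable [IsProbabilityMeasure μ]

theorem integral_sum_eq_zero (hL : ∀ i, MemLp (Y i) 2 μ) (h0 : ∀ i, ∫ ω, Y i ω ∂μ = 0)
    (s : Finset ι) : ∫ ω, (∑ i ∈ s, Y i) ω ∂μ = 0 := by
  simp only [Finset.sum_apply]
  rw [integral_finsetSum s fun i _ => (hL i).integrable (by norm_num)]
  simp [h0]

theorem integral_sum_sq (hY : iIndepFun Y μ) (hL : ∀ i, MemLp (Y i) 2 μ)
    (h0 : ∀ i, ∫ ω, Y i ω ∂μ = 0) (s : Finset ι) :
    ∫ ω, (∑ i ∈ s, Y i) ω ^ 2 ∂μ = ∑ i ∈ s, ∫ ω, Y i ω ^ 2 ∂μ := by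
  have h := IndepFun.variance_sum (s := s) (fun i _ => hL i)
    (fun i _ j _ hij => hY.indepFun hij)
  rw [variance_of_integral_eq_zero (memLp_finsetSum' s fun i _ => hL i).1.aemeasurable
    (integral_sum_eq_zero hL h0 s)] at h
  rw [h]
  exact Finset.sum_congr rfl fun i _ =>
    variance_of_integral_eq_zero (hL i).1.aemeasurable (h0 i)

/-- Induction on the index set. Independence and centring kill the odd cross terms, so adding a term
to s of them raises the fourth moment by at most M + 6·√M·s√M = (6s + 1)M, which is below 3((s + 1)²
- s²)M. -/
theorem integral_sum_pow_four_le (hY : iIndepFun Y μ) (hm : ∀ i, Measurable (Y i))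
    (hL : ∀ i, MemLp (Y i) 4 μ) (h0 : ∀ i, ∫ ω, Y i ω ∂μ = 0) {M : ℝ}
    (hM : ∀ i, ∫ ω, Y i ω ^ 4 ∂μ ≤ M) (s : Finset ι) :
    ∫ ω, (∑ i ∈ s, Y i) ω ^ 4 ∂μ ≤ 3 * (s.card : ℝ) ^ 2 * M := by
  classical
  induction s using Finset.induction_on with
  | empty => simp
  | insert a s ha ih =>
    rw [Finset.sum_insert ha]
    set T := ∑ i ∈ s, Y i with hT
    have hTL : MemLp T 4 μ := memLp_sum_four hL s
    have hTm : Measurable T := by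
      rw [hT, Finset.sum_fn]
      exact Finset.measurable_sum s fun i _ => hm i
    have hind : IndepFun (Y a) T μ := (hY.indepFun_finsetSum_of_notMem hm ha).symm
    have hind' : ∀ p q : ℕ, IndepFun (fun ω => Y a ω ^ p) (fun ω => T ω ^ q) μ := fun p q =>
      hind.comp (measurable_id.pow_const p) (measurable_id.pow_const q)
    have hprod : ∀ p q : ℕ, ∫ ω, Y a ω ^ p * T ω ^ q ∂μ =
        (∫ ω, Y a ω ^ p ∂μ) * ∫ ω, T ω ^ q ∂μ := fun p q =>
      (hind' p q).integral_fun_mul_eq_mul_integral ((hm a).pow_const p).aestronglyMeasurable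
        (hTm.pow_const q).aestronglyMeasurable
    have hint : ∀ p q : ℕ, p ≤ 4 → q ≤ 4 → Integrable (fun ω => Y a ω ^ p * T ω ^ q) μ :=
      fun p q hp hq => (hind' p q).integrable_mul (integrable_pow_of_memLp_four (hL a) hp)
        (integrable_pow_of_memLp_four hTL hq)
    -- Zeroth powers are kept so that all five terms have the shape covered by `hprod` and `hint`.
    have hexp : ∀ ω, (Y a + T) ω ^ 4 = Y a ω ^ 4 * T ω ^ 0 + 4 * (Y a ω ^ 3 * T ω ^ 1) +
        6 * (Y a ω ^ 2 * T ω ^ 2) + 4 * (Y a ω ^ 1 * T ω ^ 3) + Y a ω ^ 0 * T ω ^ 4 := by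
      intro ω
      simp only [Pi.add_apply]
      ring
    have i1 := hint 4 0 (by norm_num) (by norm_num)
    have i2 := (hint 3 1 (by norm_num) (by norm_num)).const_mul 4
    have i3 := (hint 2 2 (by norm_num) (by norm_num)).const_mul 6
    have i4 := (hint 1 3 (by norm_num) (by norm_num)).const_mul 4
    have i5 := hint 0 4 (by norm_num) (by norm_num)
    have hL2 : ∀ i, MemLp (Y i) 2 μ := fun i => (hL i).mono_exponent (by norm_num)
    have hT0 : ∫ ω, T ω ∂μ = 0 := integral_sum_eq_zero hL2 h0 s
    have key : ∫ ω, (Y a + T) ω ^ 4 ∂μ = (∫ ω, Y a ω ^ 4 ∂μ) +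
        6 * ((∫ ω, Y a ω ^ 2 ∂μ) * ∫ ω, T ω ^ 2 ∂μ) + ∫ ω, T ω ^ 4 ∂μ := by
      have j2 : Integrable (fun ω => Y a ω ^ 4 * T ω ^ 0 + 4 * (Y a ω ^ 3 * T ω ^ 1)) μ :=
        i1.add i2
      have j3 : Integrable (fun ω => Y a ω ^ 4 * T ω ^ 0 + 4 * (Y a ω ^ 3 * T ω ^ 1) +
        6 * (Y a ω ^ 2 * T ω ^ 2)) μ := j2.add i3
      have j4 : Integrable (fun ω => Y a ω ^ 4 * T ω ^ 0 + 4 * (Y a ω ^ 3 * T ω ^ 1) +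
        6 * (Y a ω ^ 2 * T ω ^ 2) + 4 * (Y a ω ^ 1 * T ω ^ 3)) μ := j3.add i4
      rw [integral_congr_ae (Eventually.of_forall hexp), integral_add j4 i5, integral_add j3 i4,
        integral_add j2 i3, integral_add i1 i2, integral_const_mul, integral_const_mul,
        integral_const_mul, hprod, hprod, hprod, hprod, hprod]
      simp [hT0, h0]
    rw [key, integral_sum_sq hY hL2 h0 s, Finset.card_insert_of_notMem ha]
    have hM0 : 0 ≤ M := (integral_nonneg fun ω => by positivity).trans (hM a)
    have hsq : ∀ i, ∫ ω, Y i ω ^ 2 ∂μ ≤ √M := fun i => integral_sq_le_sqrt (hL i) (hM i)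
    have hsum : ∑ i ∈ s, ∫ ω, Y i ω ^ 2 ∂μ ≤ s.card * √M := by
      simpa using Finset.sum_le_sum (fun i (_ : i ∈ s) => hsq i)
    have hpr : (∫ ω, Y a ω ^ 2 ∂μ) * ∑ i ∈ s, ∫ ω, Y i ω ^ 2 ∂μ ≤ s.card * M := by
      calc _ ≤ √M * (s.card * √M) := mul_le_mul (hsq a) hsum
            (Finset.sum_nonneg fun i _ => integral_nonneg fun ω => by positivity) (by positivity)
        _ = s.card * (√M * √M) := by ring
        _ = s.card * M := by rw [Real.mul_self_sqrt hM0]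
    push_cast
    nlinarith [hM a]

end Moments

/-! ### Independent pairs of runs, and conditioning on the pilot inputs. -/

section Independence

variable {Ω S : Type*} [MeasurableSpace Ω] [MeasurableSpace S] {μ : Measure Ω}

/-- The joint law of the runs is a product measure over ι × Bool. Currying turns it into a product
over ι of products over Bool, which is independence of the pairs. -/
theorem iIndepFun_pairs {ι : Type*} {V : ι × Bool → Ω → S} (hV : iIndepFun V μ)
    (hm : ∀ p, Measurable (V p)) :
    iIndepFun (fun i ω => (V (i, true) ω, V (i, false) ω)) μ := by
  have := hV.isProbabilityMeasure
  have : ∀ p, IsProbabilityMeasure (μ.map (V p)) := fun p =>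
    Measure.isProbabilityMeasure_map (hm p).aemeasurable
  have h1 : iIndepFun (fun (i : ι) ω (b : Bool) => V (i, b) ω) μ := by
    rw [iIndepFun_iff_map_fun_eq_infinitePi_map (by fun_prop)]
    have e1 : ∀ i : ι, μ.map (fun ω (b : Bool) => V (i, b) ω) =
        Measure.infinitePi fun b => μ.map (V (i, b)) := fun i =>
      (hV.precomp (g := fun b => (i, b)) (Prod.mk_right_injective i)).map_fun_eq_infinitePi_map
        (by fun_prop)
    have e2 := (hV.precomp (g := Equiv.sigmaEquivProd ι Bool)
      (Equiv.injective _)).map_fun_eq_infinitePi_map (by fun_prop)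
    have e3 := congrArg (Measure.map (MeasurableEquiv.piCurry fun (_ : ι) (_ : Bool) => S)) e2
    rw [Measure.map_map (by fun_prop) (by fun_prop)] at e3
    have e4 := Measure.infinitePi_map_piCurry
      (fun (i : ι) (b : Bool) => μ.map (V (i, b)))
    simp only [e1]
    rw [← e4]
    exact e3
  exact h1.comp (fun _ f => (f true, f false)) fun _ => by fun_prop

theorem comap_pi_eq_iSup {ι Ω : Type*} (V : ι → Ω → S) :
    MeasurableSpace.comap (fun ω i => V i ω) MeasurableSpace.pi =
      ⨆ i, MeasurableSpace.comap (V i) inferInstance := by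
  rw [MeasurableSpace.pi, MeasurableSpace.comap_iSup]
  simp only [MeasurableSpace.comap_comp]
  rfl

/-- Disjoint sets of labels generate independent σ-algebras. This separates the pilot runs from the
second stage. -/
theorem indepFun_inl_inr {ι κ : Type*} {V : ι ⊕ κ → Ω → S} (hV : iIndepFun V μ)
    (hm : ∀ p, Measurable (V p)) :
    IndepFun (fun ω i => V (Sum.inl i) ω) (fun ω i => V (Sum.inr i) ω) μ := by
  rw [IndepFun_iff_Indep, comap_pi_eq_iSup, comap_pi_eq_iSup]
  have h := indep_iSup_of_disjoint (S := Set.range Sum.inl) (T := Set.range Sum.inr)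
    (fun i => (hm i).comap_le) ((iIndepFun_iff_iIndep _ _ _).1 hV)
    Set.isCompl_range_inl_range_inr.disjoint
  rwa [iSup_range, iSup_range] at h

variable {E F : Type*} [MeasurableSpace E] [MeasurableSpace F] [IsProbabilityMeasure μ]
  {X : Ω → E} {V : Ω → F}

/-- Tonelli on the product law: a bound on the absolute moment with `X` frozen, uniform in the
frozen value, suffices. -/
theorem integrable_of_indepFun (hXV : IndepFun X V μ) (hX : Measurable X) (hV : Measurable V)
    {f : E × F → ℝ} (hf : Measurable f) (h1 : ∀ ω, Integrable (fun ω' => f (X ω, V ω')) μ)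
    {C : ℝ} (h2 : ∀ ω, ∫ ω', |f (X ω, V ω')| ∂μ ≤ C) :
    Integrable (fun ω => f (X ω, V ω)) μ := by
  have hlaw := (indepFun_iff_map_prod_eq_prod_map_map hX.aemeasurable hV.aemeasurable).1 hXV
  refine ⟨(hf.comp (hX.prodMk hV)).aestronglyMeasurable, ?_⟩
  rw [hasFiniteIntegral_iff_enorm]
  have e : ∫⁻ ω, ‖f (X ω, V ω)‖ₑ ∂μ = ∫⁻ p, ‖f p‖ₑ ∂(μ.map fun ω => (X ω, V ω)) :=
    (lintegral_map hf.enorm (hX.prodMk hV)).symm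
  have := Measure.isProbabilityMeasure_map (μ := μ) hX.aemeasurable
  have := Measure.isProbabilityMeasure_map (μ := μ) hV.aemeasurable
  rw [e, hlaw, lintegral_prod _ hf.enorm.aemeasurable, lintegral_map
    hf.enorm.lintegral_prod_right' hX]
  calc _ ≤ ∫⁻ _, ENNReal.ofReal C ∂μ := by
        refine lintegral_mono fun ω => ?_
        rw [lintegral_map (f := fun y => ‖f (X ω, y)‖ₑ)
          (hf.comp measurable_prodMk_left).enorm hV,
          ← ofReal_integral_norm_eq_lintegral_enorm (h1 ω)]
        exact ENNReal.ofReal_le_ofReal (h2 ω)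
    _ < ∞ := by simp

/-- Conditioning on `X`, realized as Fubini for the product law. -/
theorem integral_of_indepFun (hXV : IndepFun X V μ) (hX : Measurable X) (hV : Measurable V)
    {f : E × F → ℝ} (hf : Measurable f) (hint : Integrable (fun ω => f (X ω, V ω)) μ) :
    ∫ ω, f (X ω, V ω) ∂μ = ∫ ω, ∫ ω', f (X ω, V ω') ∂μ ∂μ := by
  have hlaw := (indepFun_iff_map_prod_eq_prod_map_map hX.aemeasurable hV.aemeasurable).1 hXV
  have := Measure.isProbabilityMeasure_map (μ := μ) hX.aemeasurable
  have := Measure.isProbabilityMeasure_map (μ := μ) hV.aemeasurable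
  have hint' : Integrable f ((μ.map X).prod (μ.map V)) := by
    rw [← hlaw, integrable_map_measure hf.aestronglyMeasurable (hX.prodMk hV).aemeasurable]
    exact hint
  rw [← integral_map (hX.prodMk hV).aemeasurable hf.aestronglyMeasurable (f := f), hlaw,
    integral_prod _ hint', integral_map hX.aemeasurable
    hf.stronglyMeasurable.integral_prod_right'.aestronglyMeasurable]
  refine integral_congr_ae (Eventually.of_forall fun ω => ?_)
  exact integral_map hV.aemeasurable (hf.comp measurable_prodMk_left).aestronglyMeasurable

end Independence

/-! ### Bias of the central difference quotient. -/

section Taylor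

/-- The central difference quotient of a function. -/
def centralDiff (f : ℝ → ℝ) (x h : ℝ) : ℝ := (f (x + h) - f (x - h)) / (2 * h)

/-- Peano form of the remainder. On an open ball the derivatives within the ball are the global
ones, which permits a pointwise hypothesis. -/
theorem ContDiffAt.tendsto_taylor_remainder {f : ℝ → ℝ} {x : ℝ} {n : ℕ} (hf : ContDiffAt ℝ n f x) :
    Tendsto (fun y => (f y - ∑ k ∈ Finset.range (n + 1),
      (y - x) ^ k / k.factorial * iteratedDeriv k f x) / (y - x) ^ n) (𝓝 x) (𝓝 0) := by
  obtain ⟨r, hr, hball⟩ := Metric.eventually_nhds_iff_ball.1 (hf.eventually (by simp))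
  have hs : ContDiffOn ℝ n f (Metric.ball x r) := fun y hy => (hball y hy).contDiffWithinAt
  have hx : x ∈ Metric.ball x r := Metric.mem_ball_self hr
  have h := Real.taylor_tendsto (convex_ball x r) hx hs
  rw [Metric.isOpen_ball.nhdsWithin_eq hx] at h
  refine h.congr fun y => ?_
  rw [taylor_within_apply]
  congr 2
  refine Finset.sum_congr rfl fun k _ => ?_
  rw [iteratedDerivWithin_of_isOpen Metric.isOpen_ball hx, smul_eq_mul]
  ring

/-- The expression is the average of the order-five remainders at x + h and x - h, plus the limit
itself: dividing the second by (-h)⁵ reverses its sign, so the even Taylor terms cancel. -/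
theorem tendsto_centralDiff_remainder {f : ℝ → ℝ} {x : ℝ} (hf : ContDiffAt ℝ 5 f x) :
    Tendsto (fun h => (centralDiff f x h - deriv f x - iteratedDeriv 3 f x / 6 * h ^ 2) / h ^ 4)
      (𝓝[≠] 0) (𝓝 (iteratedDeriv 5 f x / 120)) := by
  have h0 := ContDiffAt.tendsto_taylor_remainder (n := 5) hf
  have hp : Tendsto (fun h : ℝ => x + h) (𝓝[≠] 0) (𝓝 x) := by
    have : Tendsto (fun h : ℝ => x + h) (𝓝 0) (𝓝 (x + 0)) := tendsto_const_nhds.add tendsto_id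
    rw [add_zero] at this
    exact this.mono_left nhdsWithin_le_nhds
  have hn : Tendsto (fun h : ℝ => x - h) (𝓝[≠] 0) (𝓝 x) := by
    have : Tendsto (fun h : ℝ => x - h) (𝓝 0) (𝓝 (x - 0)) := tendsto_const_nhds.sub tendsto_id
    rw [sub_zero] at this
    exact this.mono_left nhdsWithin_le_nhds
  have h1 := (((h0.comp hp).add (h0.comp hn)).div_const 2).add_const (iteratedDeriv 5 f x / 120)
  simp only [add_zero, zero_div, zero_add] at h1
  refine h1.congr' ?_
  filter_upwards [self_mem_nhdsWithin] with h hh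
  have hh : h ≠ 0 := hh
  simp only [Function.comp_apply, Finset.sum_range_succ, Finset.range_zero, Finset.sum_empty,
    centralDiff, iteratedDeriv_one, iteratedDeriv_zero]
  have e2 : x - h - x = -h := by ring
  rw [add_sub_cancel_left, e2]
  simp only [Nat.factorial]
  push_cast
  field_simp
  ring

theorem tendsto_centralDiff_sub_div {f : ℝ → ℝ} {x : ℝ} (hf : ContDiffAt ℝ 5 f x) :
    Tendsto (fun h => (centralDiff f x h - deriv f x) / h ^ 2)
      (𝓝[≠] 0) (𝓝 (iteratedDeriv 3 f x / 6)) := by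
  have h1 := tendsto_centralDiff_remainder hf
  have h2 : Tendsto (fun h : ℝ => h ^ 2) (𝓝[≠] 0) (𝓝 0) := by
    have : Tendsto (fun h : ℝ => h ^ 2) (𝓝 0) (𝓝 (0 ^ 2)) := tendsto_id.pow 2
    rw [zero_pow two_ne_zero] at this
    exact this.mono_left nhdsWithin_le_nhds
  have h3 := (h1.mul h2).add_const (iteratedDeriv 3 f x / 6)
  rw [mul_zero, zero_add] at h3
  refine h3.congr' ?_
  filter_upwards [self_mem_nhdsWithin] with h hh
  have hh : h ≠ 0 := hh
  field_simp
  ring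

end Taylor

/-! ### Closed forms of the bootstrap mean and variance. -/

section Bootstrap

/-- Distributivity of a product over draws of sums over indices, with factor x at draw i and 1 at
each other draw; every other draw then contributes a factor N. -/
theorem sum_resample_apply {N : ℕ} (x : Fin N → ℝ) (i : Fin N) :
    ∑ s : Fin N → Fin N, x (s i) = (N : ℝ) ^ (N - 1) * ∑ j, x j := by
  have h := Finset.prod_univ_sum (fun _ : Fin N => (Finset.univ : Finset (Fin N)))
    (fun a b => if a = i then x b else (1 : ℝ))
  rw [Fintype.piFinset_univ] at h
  have e1 : ∀ s : Fin N → Fin N, ∏ a, (if a = i then x (s a) else (1 : ℝ)) = x (s i) := fun s => by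
    rw [Finset.prod_ite_eq' Finset.univ i (fun a => x (s a))]
    simp
  simp only [e1] at h
  rw [← h, ← Finset.mul_prod_erase _ _ (Finset.mem_univ i)]
  have e2 : ∀ a ∈ Finset.univ.erase i, ∑ b : Fin N, (if a = i then x b else (1 : ℝ)) = N := by
    intro a ha
    simp [Finset.ne_of_mem_erase ha]
  rw [Finset.prod_congr rfl e2]
  simp [mul_comm]

/-- The same expansion: the factor belonging to draw i is the sum of x, which is zero. -/
theorem sum_resample_mul_eq_zero {N : ℕ} (x : Fin N → ℝ) (hx : ∑ j, x j = 0) {i k : Fin N}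
    (hik : i ≠ k) : ∑ s : Fin N → Fin N, x (s i) * x (s k) = 0 := by
  have h := Finset.prod_univ_sum (fun _ : Fin N => (Finset.univ : Finset (Fin N)))
    (fun a b => (if a = i then x b else (1 : ℝ)) * (if a = k then x b else (1 : ℝ)))
  rw [Fintype.piFinset_univ] at h
  have e1 : ∀ s : Fin N → Fin N, ∏ a, ((if a = i then x (s a) else (1 : ℝ)) *
      (if a = k then x (s a) else (1 : ℝ))) = x (s i) * x (s k) := fun s => by
    rw [Finset.prod_mul_distrib, Finset.prod_ite_eq' Finset.univ i (fun a => x (s a)),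
      Finset.prod_ite_eq' Finset.univ k (fun a => x (s a))]
    simp
  simp only [e1] at h
  rw [← h]
  refine Finset.prod_eq_zero (Finset.mem_univ i) ?_
  simp [hik, hx]

theorem bootMean_eq {N : ℕ} (x : Fin N → ℝ) : bootMean x = sampleAvg x := by
  rcases Nat.eq_zero_or_pos N with rfl | hN
  · simp [bootMean, bootExp, sampleAvg]
  have hN' : (N : ℝ) ≠ 0 := by positivity
  unfold bootMean bootExp sampleAvg
  rw [← Finset.sum_div, Finset.sum_comm]
  simp only [sum_resample_apply]
  rw [Finset.sum_const, Finset.card_univ, Fintype.card_fin, nsmul_eq_mul]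
  obtain ⟨M, rfl⟩ : ∃ M, N = M + 1 := ⟨N - 1, by omega⟩
  simp only [Nat.add_sub_cancel]
  field_simp
  ring

/-- After centring the sample, products of distinct draws average to zero and only the N diagonal
terms remain. -/
theorem bootVar_eq {N : ℕ} (x : Fin N → ℝ) :
    bootVar x = (∑ i, (x i - sampleAvg x) ^ 2) / (N : ℝ) ^ 2 := by
  rcases Nat.eq_zero_or_pos N with rfl | hN
  · simp [bootVar, bootExp, bootMean_eq, sampleAvg]
  have hN' : (N : ℝ) ≠ 0 := by positivity
  unfold bootVar bootExp
  rw [bootMean_eq]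
  set y : Fin N → ℝ := fun i => x i - sampleAvg x with hy
  have hy0 : ∑ i, y i = 0 := by
    simp only [hy, Finset.sum_sub_distrib, sampleAvg]
    simp
    field_simp
    simp
  have e1 : ∀ s : Fin N → Fin N, (sampleAvg (fun i => x (s i)) - sampleAvg x) ^ 2 =
      (∑ i, ∑ k, y (s i) * y (s k)) / (N : ℝ) ^ 2 := fun s => by
    rw [← Finset.sum_mul_sum, ← sq, ← div_pow]
    congr 1
    simp only [hy, Finset.sum_sub_distrib]
    rw [sampleAvg.eq_1 fun i => x (s i)]
    simp only [Finset.sum_const, Finset.card_univ, Fintype.card_fin, nsmul_eq_mul]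
    field_simp
  simp only [e1]
  rw [← Finset.sum_div, Finset.sum_comm]
  have e2 : ∀ i : Fin N, ∑ s : Fin N → Fin N, ∑ k, y (s i) * y (s k) =
      (N : ℝ) ^ (N - 1) * ∑ j, y j ^ 2 := fun i => by
    rw [Finset.sum_comm, Finset.sum_eq_single i]
    · simp only [← sq]
      exact sum_resample_apply (fun j => y j ^ 2) i
    · intro k _ hk
      exact sum_resample_mul_eq_zero y hy0 hk.symm
    · simp
  simp only [e2]
  rw [Finset.sum_const, Finset.card_univ, Fintype.card_fin, nsmul_eq_mul]
  obtain ⟨M, rfl⟩ : ∃ M, N = M + 1 := ⟨N - 1, by omega⟩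
  simp only [Nat.add_sub_cancel, hy]
  field_simp
  ring

end Bootstrap

/-! ### Algebra of the two least-squares fits. -/

section Regression

variable {K : ℕ}

theorem designE_mulVec (h : Fin K → ℝ) (v : Fin 2 → ℝ) (k : Fin K) :
    (designE h *ᵥ v) k = v 0 + h k ^ 2 * v 1 := by
  simp [designE, Matrix.mulVec, dotProduct, Fin.sum_univ_two]

/-- A kernel vector of XᵀX is one of X, and two rows with different c² force both coordinates to
vanish. -/
theorem isUnit_det_designE {c : Fin K → ℝ} (hc : ∃ j k, |c j| ≠ |c k|) :
    IsUnit ((designE c)ᵀ * designE c).det := by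
  rw [isUnit_iff_ne_zero]
  intro hdet
  obtain ⟨v, hv0, hv⟩ := Matrix.exists_mulVec_eq_zero_iff.2 hdet
  have hX : designE c *ᵥ v = 0 := by
    rw [← dotProduct_self_eq_zero, Matrix.dotProduct_mulVec, ← Matrix.mulVec_transpose,
      Matrix.mulVec_mulVec, hv, zero_dotProduct]
  obtain ⟨j, k, hjk⟩ := hc
  have hj := congrFun hX j
  have hk := congrFun hX k
  rw [designE_mulVec, Pi.zero_apply] at hj hk
  have hsq : c j ^ 2 - c k ^ 2 ≠ 0 := fun h =>
    hjk ((sq_eq_sq_iff_abs_eq_abs _ _).1 (sub_eq_zero.1 h))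
  have h1 : v 1 = 0 := by
    have : (c j ^ 2 - c k ^ 2) * v 1 = 0 := by linarith
    exact (mul_eq_zero.1 this).resolve_left hsq
  have h2 : v 0 = 0 := by simpa [h1] using hj
  apply hv0
  ext i
  fin_cases i
  · exact h2
  · exact h1

theorem leastSquares_add {p : ℕ} (X : Matrix (Fin K) (Fin p) ℝ) (y z : Fin K → ℝ) :
    leastSquares X (y + z) = leastSquares X y + leastSquares X z := Matrix.mulVec_add _ _ _

theorem leastSquares_smul {p : ℕ} (X : Matrix (Fin K) (Fin p) ℝ) (a : ℝ) (y : Fin K → ℝ) :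
    leastSquares X (a • y) = a • leastSquares X y := Matrix.mulVec_smul _ _ _

theorem leastSquares_mulVec {p : ℕ} {X : Matrix (Fin K) (Fin p) ℝ} (hX : IsUnit (Xᵀ * X).det)
    (v : Fin p → ℝ) : leastSquares X (X *ᵥ v) = v := by
  rw [leastSquares, Matrix.mulVec_mulVec, Matrix.mul_assoc, Matrix.nonsing_inv_mul _ hX,
    Matrix.one_mulVec]

theorem residualProj_mulVec (c y : Fin K → ℝ) :
    residualProj c *ᵥ y = y - designE c *ᵥ leastSquares (designE c) y := by
  rw [residualProj, leastSquares, Matrix.sub_mulVec, Matrix.one_mulVec, Matrix.mulVec_mulVec,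
    Matrix.mul_assoc]

/-- Rescaling the c_k by t multiplies the second column by t², hence divides the second coefficient
by t². -/
theorem leastSquares_scale (c : Fin K → ℝ) {t : ℝ} (ht : t ≠ 0) (y : Fin K → ℝ) :
    leastSquares (designE fun k => c k * t) y =
      ![leastSquares (designE c) y 0, leastSquares (designE c) y 1 / t ^ 2] := by
  have hX : designE (fun k => c k * t) = designE c * Matrix.diagonal ![1, t ^ 2] := by
    ext k i
    rw [Matrix.mul_diagonal]
    fin_cases i <;> simp [designE, mul_pow]
  have hu : IsUnit (Matrix.diagonal ![(1 : ℝ), t ^ 2]).det := by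
    simp [Matrix.det_diagonal, Fin.prod_univ_two, ht]
  have hinv : (Matrix.diagonal ![(1 : ℝ), t ^ 2])⁻¹ = Matrix.diagonal ![1, (t ^ 2)⁻¹] := by
    apply Matrix.inv_eq_right_inv
    rw [Matrix.diagonal_mul_diagonal, ← Matrix.diagonal_one]
    congr 1
    ext i
    fin_cases i <;> simp [ht]
  have e : leastSquares (designE fun k => c k * t) y =
      Matrix.diagonal ![1, (t ^ 2)⁻¹] *ᵥ leastSquares (designE c) y := by
    rw [leastSquares, leastSquares, hX, Matrix.mulVec_mulVec]
    congr 1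
    simp only [Matrix.transpose_mul, Matrix.diagonal_transpose]
    rw [show Matrix.diagonal ![1, t ^ 2] * (designE c)ᵀ * (designE c *
      Matrix.diagonal ![1, t ^ 2]) = Matrix.diagonal ![1, t ^ 2] *
      ((designE c)ᵀ * designE c) * Matrix.diagonal ![1, t ^ 2] by simp only [Matrix.mul_assoc],
      Matrix.mul_inv_rev, Matrix.mul_inv_rev, ← hinv, Matrix.mul_assoc, Matrix.mul_assoc,
      ← Matrix.mul_assoc _ _ (designE c)ᵀ, Matrix.nonsing_inv_mul _ hu, Matrix.one_mul]
  rw [e]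
  ext i
  rw [Matrix.mulVec_diagonal]
  fin_cases i <;> simp [div_eq_inv_mul]

/-- The regression on `(1, h_k²)` of data that lie on a line up to a perturbation. -/
theorem leastSquares_line_add {c : Fin K → ℝ} (hc : ∃ j k, |c j| ≠ |c k|) {t : ℝ} (ht : t ≠ 0)
    {y ζ : Fin K → ℝ} {a b s : ℝ} (hy : ∀ k, y k = a + b * (c k * t) ^ 2 + s * ζ k) :
    leastSquares (designE fun k => c k * t) y 0 = a + s * leastSquares (designE c) ζ 0 ∧
    leastSquares (designE fun k => c k * t) y 1 = b + s / t ^ 2 * leastSquares (designE c) ζ 1 ∧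
    ∀ k, y k - fitted (leastSquares (designE fun k => c k * t) y) (c k * t) =
      s * (residualProj c *ᵥ ζ) k := by
  have hu := isUnit_det_designE hc
  -- In terms of the unscaled design the line has coefficients a and b t².
  have hy' : y = designE c *ᵥ ![a, b * t ^ 2] + s • ζ := by
    ext k
    rw [hy, Pi.add_apply, designE_mulVec]
    simp
    ring
  have hL : leastSquares (designE c) y = ![a, b * t ^ 2] + s • leastSquares (designE c) ζ := by
    rw [hy', leastSquares_add, leastSquares_smul, leastSquares_mulVec hu]
  rw [leastSquares_scale c ht, hL]
  refine ⟨by simp, ?_, fun k => ?_⟩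
  · simp
    field_simp
  · rw [residualProj_mulVec, Pi.sub_apply, designE_mulVec, fitted, hy]
    simp
    field_simp
    ring

theorem residualProj_transpose (c : Fin K → ℝ) : (residualProj c)ᵀ = residualProj c := by
  simp only [residualProj, Matrix.transpose_sub, Matrix.transpose_one, Matrix.transpose_mul,
    Matrix.transpose_nonsing_inv, Matrix.transpose_transpose, Matrix.mul_assoc]

/-- Symmetry of P. It moves the projection from the random errors to the constants |c_k|, leaving a
sum of errors with fixed weights. -/
theorem sum_mul_residualProj (c y z : Fin K → ℝ) :
    ∑ k, y k * (residualProj c *ᵥ z) k = ∑ k, (residualProj c *ᵥ y) k * z k := by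
  change y ⬝ᵥ (residualProj c *ᵥ z) = (residualProj c *ᵥ y) ⬝ᵥ z
  rw [Matrix.dotProduct_mulVec, ← Matrix.mulVec_transpose, residualProj_transpose]

/-- The weights with which the pilot noise enters the estimator. -/
def noiseWeight (c : Fin K → ℝ) : Fin K → ℝ := residualProj c *ᵥ fun k => |c k|

theorem Lam_eq (c : Fin K → ℝ) : Lam c = ∑ k, noiseWeight c k * c k ^ 4 :=
  sum_mul_residualProj c (fun k => |c k|) fun k => c k ^ 4

theorem qConst_eq (c : Fin K → ℝ) : qConst c = ∑ k, noiseWeight c k ^ 2 / c k ^ 2 := by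
  refine Finset.sum_congr rfl fun k _ => ?_
  rw [← Matrix.mulVec_mulVec, Matrix.mulVec_diagonal, mul_pow, div_pow, sq_abs]
  simp [noiseWeight, div_eq_inv_mul]

theorem leastSquares_designV (nb : ℕ) (h y : Fin K → ℝ) :
    leastSquares (designV nb h) y 0 =
      (∑ k, designV nb h k 0 * y k) / ∑ k, designV nb h k 0 ^ 2 := by
  rw [leastSquares, ← Matrix.mulVec_mulVec, Matrix.inv_subsingleton, Matrix.mulVec_diagonal]
  simp [Matrix.mulVec, dotProduct, Matrix.mul_apply, div_eq_inv_mul, sq]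

/-- The regression estimator of the variance is an average of the normalized sample variances. -/
theorem betaV_eq {nb : ℕ} (hnb : 2 ≤ nb) {c : Fin K → ℝ} (hc : ∀ k, c k ≠ 0) {t : ℝ} (ht : t ≠ 0)
    (x : Fin K → Fin nb → ℝ) :
    betaV (fun k => c k * t) x = (∑ k, (c k ^ 4)⁻¹ * (2 * (c k * t) ^ 2 *
      ((∑ j, (x k j - sampleAvg (x k)) ^ 2) / nb) * (nb / ((nb : ℝ) - 1)))) /
        ∑ k, (c k ^ 4)⁻¹ := by
  have h1 : (nb : ℝ) - 1 ≠ 0 := by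
    have : (2 : ℝ) ≤ nb := by exact_mod_cast hnb
    linarith
  have h2 : (nb : ℝ) ≠ 0 := by positivity
  rw [betaV, leastSquares_designV]
  -- The design entries are a / c_k², so a² factors out of numerator and denominator.
  set a : ℝ := ((nb : ℝ) - 1) / (2 * (nb : ℝ) ^ 2 * t ^ 2) with ha
  have ha0 : a ≠ 0 := by positivity
  have e1 : ∀ k, designV nb (fun k => c k * t) k 0 ^ 2 = a ^ 2 * (c k ^ 4)⁻¹ := fun k => by
    have := hc k
    simp only [designV, Matrix.of_apply, ha]
    field_simp
  have e2 : ∀ k, designV nb (fun k => c k * t) k 0 * bootVar (x k) = a ^ 2 * ((c k ^ 4)⁻¹ *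
      (2 * (c k * t) ^ 2 * ((∑ j, (x k j - sampleAvg (x k)) ^ 2) / nb) *
        (nb / ((nb : ℝ) - 1)))) := fun k => by
    have := hc k
    simp only [designV, Matrix.of_apply, ha, bootVar_eq]
    field_simp
  simp only [e1, e2]
  rw [← Finset.mul_sum, ← Finset.mul_sum, mul_div_mul_left _ _ (pow_ne_zero 2 ha0)]

end Regression

/-! ### The centred noise of one pair of runs. -/

section Noise

variable {S : Type*} [MeasurableSpace S] {G : ℝ → S → ℝ} {ν : Measure S} {θ₀ : ℝ}

/-- The centred difference of two runs, at `θ₀ + h` and at `θ₀ - h`. -/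
def noise (G : ℝ → S → ℝ) (ν : Measure S) (θ₀ h : ℝ) (u v : S) : ℝ :=
  (G (θ₀ + h) u - perf G ν (θ₀ + h)) - (G (θ₀ - h) v - perf G ν (θ₀ - h))

/-- The variance of the difference of two independent runs at `θ₀ + h` and at `θ₀ - h`. -/
def noiseVar (G : ℝ → S → ℝ) (ν : Measure S) (θ₀ h : ℝ) : ℝ :=
  variance (G (θ₀ + h)) ν + variance (G (θ₀ - h)) ν

/-- Fourth central moments are bounded by `M` at distance less than `r` from `θ₀`. -/
def FourthMomentBound (G : ℝ → S → ℝ) (ν : Measure S) (θ₀ r M : ℝ) : Prop :=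
  ∀ h, h ≠ 0 → |h| < r → MemLp (G (θ₀ + h)) 4 ν ∧
    ∫ u, (G (θ₀ + h) u - perf G ν (θ₀ + h)) ^ 4 ∂ν ≤ M

theorem diffQuot_eq (h : ℝ) (u v : S) :
    diffQuot G θ₀ h u v = centralDiff (perf G ν) θ₀ h + noise G ν θ₀ h u v / (2 * h) := by
  rw [diffQuot, centralDiff, noise, ← add_div]
  congr 1
  ring

/-- The bound on the lower Lebesgue integral provides finiteness, hence membership in L⁴; a bound on
a Bochner integral alone would not, since it is 0 for a nonintegrable function. -/
theorem exists_fourthMomentBound [IsProbabilityMeasure ν] (hG : Measurable (Function.uncurry G))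
    (hfour : ∃ M : ℝ≥0, ∀ᶠ θ in 𝓝[≠] θ₀, ∫⁻ u, ‖G θ u - perf G ν θ‖ₑ ^ 4 ∂ν ≤ M) :
    ∃ r > 0, ∃ M, 0 ≤ M ∧ FourthMomentBound G ν θ₀ r M := by
  obtain ⟨M, hM⟩ := hfour
  obtain ⟨r, hr, hball⟩ := Metric.eventually_nhds_iff.1 (eventually_nhdsWithin_iff.1 hM)
  refine ⟨r, hr, M, M.2, fun h h0 hhr => ?_⟩
  have hb := hball (y := θ₀ + h) (by simpa using hhr) (by simpa using h0)
  set X : S → ℝ := fun u => G (θ₀ + h) u - perf G ν (θ₀ + h) with hX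
  have hGm : Measurable (G (θ₀ + h)) := hG.comp measurable_prodMk_left
  have hXm : Measurable X := hGm.sub_const _
  have e : ∀ u, ‖X u‖ₑ ^ 4 = ENNReal.ofReal (X u ^ 4) := fun u => by
    rw [Real.enorm_eq_ofReal_abs, ← ENNReal.ofReal_pow (abs_nonneg _), (by decide : Even 4).pow_abs]
  have hfin : ∫⁻ u, ENNReal.ofReal (X u ^ 4) ∂ν ≤ M := by simpa only [← e] using hb
  have hint : Integrable (fun u => X u ^ 4) ν := by
    refine ⟨(hXm.pow_const 4).aestronglyMeasurable, ?_⟩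
    rw [hasFiniteIntegral_iff_ofReal (Eventually.of_forall fun u => by positivity)]
    exact hfin.trans_lt ENNReal.coe_lt_top
  constructor
  · have h1 : MemLp X 4 ν := memLp_four_of_integrable hXm.aestronglyMeasurable hint
    have h2 := h1.add (memLp_const (perf G ν (θ₀ + h)))
    refine (memLp_congr_ae (Eventually.of_forall fun u => ?_)).1 h2
    simp [hX]
  · rw [integral_eq_lintegral_of_nonneg_ae (Eventually.of_forall fun u => by positivity)
      (hXm.pow_const 4).aestronglyMeasurable]
    exact ENNReal.toReal_le_of_le_ofReal M.2 (by simpa using hfin)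

theorem measurable_perf [SFinite ν] (hG : Measurable (Function.uncurry G)) :
    Measurable (perf G ν) :=
  (hG.stronglyMeasurable.integral_prod_right').measurable

theorem measurable_variance [SFinite ν] (hG : Measurable (Function.uncurry G)) :
    Measurable fun θ => variance (G θ) ν := by
  have h : Measurable fun p : ℝ × S => ‖Function.uncurry G p - perf G ν p.1‖ₑ ^ 2 :=
    (hG.sub ((measurable_perf hG).comp measurable_fst)).enorm.pow_const 2
  exact (h.lintegral_prod_right').ennreal_toReal

theorem measurable_noiseVar [SFinite ν] (hG : Measurable (Function.uncurry G)) :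
    Measurable (noiseVar G ν θ₀) :=
  ((measurable_variance hG).comp (measurable_const.add measurable_id)).add
    ((measurable_variance hG).comp (measurable_const.sub measurable_id))

/-- Measurability jointly in the step and the inputs is needed because the step will be random. -/
theorem measurable_noise [SFinite ν] (hG : Measurable (Function.uncurry G)) :
    Measurable fun p : ℝ × S × S => noise G ν θ₀ p.1 p.2.1 p.2.2 := by
  have h1 : Measurable fun p : ℝ × S × S => G (θ₀ + p.1) p.2.1 :=
    hG.comp ((measurable_const.add measurable_fst).prodMk (by fun_prop))
  have h2 : Measurable fun p : ℝ × S × S => G (θ₀ - p.1) p.2.2 :=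
    hG.comp ((measurable_const.sub measurable_fst).prodMk (by fun_prop))
  have h3 : Measurable fun p : ℝ × S × S => perf G ν (θ₀ + p.1) :=
    (measurable_perf hG).comp (measurable_const.add measurable_fst)
  have h4 : Measurable fun p : ℝ × S × S => perf G ν (θ₀ - p.1) :=
    (measurable_perf hG).comp (measurable_const.sub measurable_fst)
  exact (h1.sub h3).sub (h2.sub h4)

theorem tendsto_noiseVar [IsProbabilityMeasure ν] (hσ : ContinuousAt (stdDev G ν) θ₀) :
    Tendsto (noiseVar G ν θ₀) (𝓝 0) (𝓝 (2 * stdDev G ν θ₀ ^ 2)) := by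
  have hv : ∀ θ, variance (G θ) ν = stdDev G ν θ ^ 2 := fun θ =>
    (Real.sq_sqrt (variance_nonneg _ _)).symm
  have hp : Tendsto (fun h : ℝ => θ₀ + h) (𝓝 0) (𝓝 θ₀) := by
    have : Tendsto (fun h : ℝ => θ₀ + h) (𝓝 0) (𝓝 (θ₀ + 0)) := tendsto_const_nhds.add tendsto_id
    rwa [add_zero] at this
  have hn : Tendsto (fun h : ℝ => θ₀ - h) (𝓝 0) (𝓝 θ₀) := by
    have : Tendsto (fun h : ℝ => θ₀ - h) (𝓝 0) (𝓝 (θ₀ - 0)) := tendsto_const_nhds.sub tendsto_id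
    rwa [sub_zero] at this
  have h1 := ((hσ.tendsto.comp hp).pow 2).add ((hσ.tendsto.comp hn).pow 2)
  rw [← two_mul] at h1
  refine h1.congr fun h => ?_
  simp only [noiseVar, hv, Function.comp_apply]

theorem noiseVar_nonneg (h : ℝ) : 0 ≤ noiseVar G ν θ₀ h :=
  add_nonneg (variance_nonneg _ _) (variance_nonneg _ _)

theorem noiseVar_le [IsProbabilityMeasure ν] (hG : Measurable (Function.uncurry G)) {r M : ℝ}
    (hM : FourthMomentBound G ν θ₀ r M) {h : ℝ} (h0 : h ≠ 0) (hr : |h| < r) :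
    noiseVar G ν θ₀ h ≤ 2 * √M := by
  have key : ∀ h, h ≠ 0 → |h| < r → variance (G (θ₀ + h)) ν ≤ √M := fun h h0 hr => by
    obtain ⟨h1, h2⟩ := hM h h0 hr
    have hGm : Measurable (G (θ₀ + h)) := hG.comp measurable_prodMk_left
    rw [variance_eq_integral hGm.aemeasurable]
    exact integral_sq_le_sqrt (h1.sub (memLp_const _)) h2
  have h1 := key h h0 hr
  have h2 := key (-h) (neg_ne_zero.2 h0) (by rwa [abs_neg])
  rw [← sub_eq_add_neg] at h2
  rw [noiseVar]
  linarith

theorem integral_comp_law {Ω : Type*} [MeasurableSpace Ω] {μ : Measure Ω} {X : Ω → S}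
    (hX : Measurable X) (hlaw : μ.map X = ν) {f : S → ℝ} (hf : Measurable f) :
    ∫ ω, f (X ω) ∂μ = ∫ u, f u ∂ν := by
  rw [← hlaw, integral_map hX.aemeasurable hf.aestronglyMeasurable]

end Noise

/-! ### Moments of noise sums at deterministic steps. -/

section Runs

variable {S Ω : Type*} [MeasurableSpace S] [MeasurableSpace Ω] {G : ℝ → S → ℝ} {ν : Measure S}
  [IsProbabilityMeasure ν] {μ : Measure Ω} [IsProbabilityMeasure μ] {θ₀ r M : ℝ}

theorem noise_moments (hG : Measurable (Function.uncurry G))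
    (hM : FourthMomentBound G ν θ₀ r M) {h : ℝ} (h0 : h ≠ 0) (hr : |h| < r) {u v : Ω → S}
    (hu : Measurable u) (hv : Measurable v) (hul : μ.map u = ν) (hvl : μ.map v = ν)
    (huv : IndepFun u v μ) :
    MemLp (fun ω => noise G ν θ₀ h (u ω) (v ω)) 4 μ ∧
    ∫ ω, noise G ν θ₀ h (u ω) (v ω) ∂μ = 0 ∧
    ∫ ω, noise G ν θ₀ h (u ω) (v ω) ^ 2 ∂μ = noiseVar G ν θ₀ h ∧
    ∫ ω, noise G ν θ₀ h (u ω) (v ω) ^ 4 ∂μ ≤ 16 * M := by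
  have key : ∀ (h : ℝ) (u : Ω → S), h ≠ 0 → |h| < r → Measurable u → μ.map u = ν →
      MemLp (fun ω => G (θ₀ + h) (u ω) - perf G ν (θ₀ + h)) 4 μ ∧
      ∫ ω, (G (θ₀ + h) (u ω) - perf G ν (θ₀ + h)) ∂μ = 0 ∧
      ∫ ω, (G (θ₀ + h) (u ω) - perf G ν (θ₀ + h)) ^ 2 ∂μ = variance (G (θ₀ + h)) ν ∧
      ∫ ω, (G (θ₀ + h) (u ω) - perf G ν (θ₀ + h)) ^ 4 ∂μ ≤ M := by
    intro h u h0 hr hu hul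
    obtain ⟨h1, h2⟩ := hM h h0 hr
    have hGm : Measurable (G (θ₀ + h)) := hG.comp measurable_prodMk_left
    have hXm : Measurable fun x => G (θ₀ + h) x - perf G ν (θ₀ + h) := hGm.sub_const _
    refine ⟨?_, ?_, ?_, ?_⟩
    · have h3 : MemLp (fun x => G (θ₀ + h) x - perf G ν (θ₀ + h)) 4 (μ.map u) := by
        rw [hul]
        exact h1.sub (memLp_const _)
      exact h3.comp_of_map hu.aemeasurable
    · rw [integral_comp_law hu hul hXm, integral_sub (h1.integrable (by norm_num))
        (integrable_const _)]
      simp [perf]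
    · rw [integral_comp_law hu hul (hXm.pow_const 2), variance_eq_integral hGm.aemeasurable]
      rfl
    · rw [integral_comp_law hu hul (hXm.pow_const 4)]
      exact h2
  obtain ⟨a1, a2, a3, a4⟩ := key h u h0 hr hu hul
  obtain ⟨b1, b2, b3, b4⟩ := key (-h) v (neg_ne_zero.2 h0) (by rwa [abs_neg]) hv hvl
  rw [← sub_eq_add_neg] at b1 b2 b3 b4
  set X : Ω → ℝ := fun ω => G (θ₀ + h) (u ω) - perf G ν (θ₀ + h) with hX
  set Y : Ω → ℝ := fun ω => G (θ₀ - h) (v ω) - perf G ν (θ₀ - h) with hY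
  have hXY : (fun ω => noise G ν θ₀ h (u ω) (v ω)) = fun ω => X ω - Y ω := rfl
  have hXY' : ∀ ω, noise G ν θ₀ h (u ω) (v ω) = X ω - Y ω := fun ω => rfl
  simp only [hXY']
  have hL : MemLp (fun ω => X ω - Y ω) 4 μ := a1.sub b1
  have hindXY : IndepFun X Y μ := huv.comp
    (φ := fun x => G (θ₀ + h) x - perf G ν (θ₀ + h))
    (ψ := fun x => G (θ₀ - h) x - perf G ν (θ₀ - h))
    ((hG.comp measurable_prodMk_left).sub_const _) ((hG.comp measurable_prodMk_left).sub_const _)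
  have iX := a1.integrable (by norm_num : (1 : ℝ≥0∞) ≤ 4)
  have iY := b1.integrable (by norm_num : (1 : ℝ≥0∞) ≤ 4)
  refine ⟨hL, ?_, ?_, ?_⟩
  · rw [integral_sub iX iY, a2, b2, sub_zero]
  · have i1 := integrable_pow_of_memLp_four a1 (p := 2) (by norm_num)
    have i2 := integrable_pow_of_memLp_four b1 (p := 2) (by norm_num)
    have i3 : Integrable (fun ω => X ω * Y ω) μ := hindXY.integrable_mul iX iY
    have e : ∀ ω, (X ω - Y ω) ^ 2 = X ω ^ 2 + Y ω ^ 2 - 2 * (X ω * Y ω) := fun ω => by ring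
    have i4 : Integrable (fun ω => X ω ^ 2 + Y ω ^ 2) μ := i1.add i2
    simp only [e]
    rw [integral_sub i4 (i3.const_mul 2), integral_add i1 i2, integral_const_mul,
      hindXY.integral_fun_mul_eq_mul_integral a1.1 b1.1, a2, b2, a3, b3]
    simp [noiseVar]
  · have i1 := integrable_pow_of_memLp_four a1 (p := 4) le_rfl
    have i2 := integrable_pow_of_memLp_four b1 (p := 4) le_rfl
    have i3 : Integrable (fun ω => 8 * X ω ^ 4 + 8 * Y ω ^ 4) μ :=
      (i1.const_mul 8).add (i2.const_mul 8)
    -- Convexity: (X - Y)⁴ ≤ 8(X⁴ + Y⁴), each fourth moment being at most M.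
    calc _ ≤ ∫ ω, (8 * X ω ^ 4 + 8 * Y ω ^ 4) ∂μ := by
          refine integral_mono (integrable_pow_of_memLp_four hL le_rfl) i3 fun ω => ?_
          have h1 : (X ω - Y ω) ^ 2 ≤ 2 * (X ω ^ 2 + Y ω ^ 2) := by
            nlinarith [sq_nonneg (X ω + Y ω)]
          have h2 : (X ω ^ 2 + Y ω ^ 2) ^ 2 ≤ 2 * (X ω ^ 4 + Y ω ^ 4) := by
            nlinarith [sq_nonneg (X ω ^ 2 - Y ω ^ 2)]
          have h3 : (X ω - Y ω) ^ 4 ≤ (2 * (X ω ^ 2 + Y ω ^ 2)) ^ 2 := by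
            rw [show (X ω - Y ω) ^ 4 = ((X ω - Y ω) ^ 2) ^ 2 by ring]
            exact pow_le_pow_left₀ (sq_nonneg _) h1 2
          simp only
          nlinarith
      _ ≤ 16 * M := by
          rw [integral_add (i1.const_mul 8) (i2.const_mul 8), integral_const_mul,
            integral_const_mul]
          linarith

/-- Moments of a weighted sum of noise terms of independent pairs of runs. -/
theorem sum_noise_moments {ι : Type*} (hG : Measurable (Function.uncurry G))
    (hM : FourthMomentBound G ν θ₀ r M) {V : ι × Bool → Ω → S} (hV : iIndepFun V μ)
    (hVm : ∀ p, Measurable (V p)) (hVl : ∀ p, μ.map (V p) = ν) {h : ι → ℝ} (h0 : ∀ i, h i ≠ 0)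
    (hr : ∀ i, |h i| < r) (a : ι → ℝ) {A : ℝ} (hA : ∀ i, |a i| ≤ A) (s : Finset ι) :
    MemLp (fun ω => ∑ i ∈ s, a i * noise G ν θ₀ (h i) (V (i, true) ω) (V (i, false) ω)) 4 μ ∧
    ∫ ω, ∑ i ∈ s, a i * noise G ν θ₀ (h i) (V (i, true) ω) (V (i, false) ω) ∂μ = 0 ∧
    ∫ ω, (∑ i ∈ s, a i * noise G ν θ₀ (h i) (V (i, true) ω) (V (i, false) ω)) ^ 2 ∂μ =
      ∑ i ∈ s, a i ^ 2 * noiseVar G ν θ₀ (h i) ∧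
    ∫ ω, (∑ i ∈ s, a i * noise G ν θ₀ (h i) (V (i, true) ω) (V (i, false) ω)) ^ 4 ∂μ ≤
      48 * M * A ^ 4 * (s.card : ℝ) ^ 2 := by
  set Y : ι → Ω → ℝ := fun i ω => a i * noise G ν θ₀ (h i) (V (i, true) ω) (V (i, false) ω) with hY
  have hnm : ∀ i, Measurable fun p : S × S => a i * noise G ν θ₀ (h i) p.1 p.2 := fun i =>
    ((measurable_noise hG).comp (measurable_prodMk_left (x := h i))).const_mul _
  have hind : iIndepFun Y μ := (iIndepFun_pairs hV hVm).comp _ hnm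
  have hYm : ∀ i, Measurable (Y i) := fun i => (hnm i).comp ((hVm _).prodMk (hVm _))
  have hmom := fun i => noise_moments hG hM (h0 i) (hr i) (hVm (i, true)) (hVm (i, false))
    (hVl _) (hVl _) (hV.indepFun (i := (i, true)) (j := (i, false)) (by simp))
  have hL : ∀ i, MemLp (Y i) 4 μ := fun i => (hmom i).1.const_mul (a i)
  have hL2 : ∀ i, MemLp (Y i) 2 μ := fun i => (hL i).mono_exponent (by norm_num)
  have hz : ∀ i, ∫ ω, Y i ω ∂μ = 0 := fun i => by
    simp only [hY]
    rw [integral_const_mul, (hmom i).2.1, mul_zero]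
  have h2 : ∀ i, ∫ ω, Y i ω ^ 2 ∂μ = a i ^ 2 * noiseVar G ν θ₀ (h i) := fun i => by
    simp only [hY, mul_pow]
    rw [integral_const_mul, (hmom i).2.2.1]
  have h4 : ∀ i, ∫ ω, Y i ω ^ 4 ∂μ ≤ A ^ 4 * (16 * M) := fun i => by
    simp only [hY, mul_pow]
    rw [integral_const_mul]
    have e : a i ^ 4 ≤ A ^ 4 := by
      rw [← (by decide : Even 4).pow_abs (a i)]
      exact pow_le_pow_left₀ (abs_nonneg _) (hA i) 4
    exact mul_le_mul e (hmom i).2.2.2 (integral_nonneg fun ω => by positivity)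
      (by positivity)
  have hfun : (fun ω => ∑ i ∈ s, Y i ω) = ∑ i ∈ s, Y i := by
    ext ω
    simp
  have hfun' : ∀ ω, ∑ i ∈ s, Y i ω = (∑ i ∈ s, Y i) ω := fun ω => by simp
  refine ⟨?_, ?_, ?_, ?_⟩
  · change MemLp (fun ω => ∑ i ∈ s, Y i ω) 4 μ
    rw [hfun]
    exact memLp_sum_four hL s
  · change ∫ ω, ∑ i ∈ s, Y i ω ∂μ = 0
    simp only [hfun']
    exact integral_sum_eq_zero hL2 hz s
  · change ∫ ω, (∑ i ∈ s, Y i ω) ^ 2 ∂μ = _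
    simp only [hfun']
    rw [integral_sum_sq hind hL2 hz s]
    exact Finset.sum_congr rfl fun i _ => h2 i
  · change ∫ ω, (∑ i ∈ s, Y i ω) ^ 4 ∂μ ≤ _
    simp only [hfun']
    -- The constant is 48 = 3·16: 3 from the bound for sums, 16 from one pair.
    refine (integral_sum_pow_four_le hind hYm hL hz h4 s).trans (le_of_eq ?_)
    ring

/-- The mean square of the centred squared noise terms, averaged over independent pairs. -/
theorem integral_sq_sum_noise_sq_le {ι : Type*} (hG : Measurable (Function.uncurry G))
    (hM : FourthMomentBound G ν θ₀ r M) {V : ι × Bool → Ω → S} (hV : iIndepFun V μ)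
    (hVm : ∀ p, Measurable (V p)) (hVl : ∀ p, μ.map (V p) = ν) {h : ℝ} (h0 : h ≠ 0)
    (hr : |h| < r) (s : Finset ι) :
    Integrable (fun ω => (∑ i ∈ s, (noise G ν θ₀ h (V (i, true) ω) (V (i, false) ω) ^ 2 -
      noiseVar G ν θ₀ h)) ^ 2) μ ∧
    ∫ ω, (∑ i ∈ s, (noise G ν θ₀ h (V (i, true) ω) (V (i, false) ω) ^ 2 -
      noiseVar G ν θ₀ h)) ^ 2 ∂μ ≤ s.card * (16 * M) := by
  set Y : ι → Ω → ℝ := fun i ω => noise G ν θ₀ h (V (i, true) ω) (V (i, false) ω) ^ 2 -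
      noiseVar G ν θ₀ h with hY
  have hnm : Measurable fun p : S × S => noise G ν θ₀ h p.1 p.2 ^ 2 - noiseVar G ν θ₀ h :=
    (((measurable_noise hG).comp (measurable_prodMk_left (x := h))).pow_const 2).sub_const _
  have hind : iIndepFun Y μ := (iIndepFun_pairs hV hVm).comp _ fun _ => hnm
  have hYm : ∀ i, Measurable (Y i) := fun i => hnm.comp ((hVm _).prodMk (hVm _))
  have hmom := fun i => noise_moments hG hM h0 hr (hVm (i, true)) (hVm (i, false))
    (hVl _) (hVl _) (hV.indepFun (i := (i, true)) (j := (i, false)) (by simp))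
  have i2 := fun i => integrable_pow_of_memLp_four (hmom i).1 (p := 2) (by norm_num)
  have i4 := fun i => integrable_pow_of_memLp_four (hmom i).1 (p := 4) le_rfl
  have e : ∀ i ω, Y i ω ^ 2 = noise G ν θ₀ h (V (i, true) ω) (V (i, false) ω) ^ 4 -
      2 * noiseVar G ν θ₀ h * noise G ν θ₀ h (V (i, true) ω) (V (i, false) ω) ^ 2 +
      noiseVar G ν θ₀ h ^ 2 := fun i ω => by
    simp only [hY]
    ring
  have i5 : ∀ i, Integrable (fun ω => noise G ν θ₀ h (V (i, true) ω) (V (i, false) ω) ^ 4 -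
      2 * noiseVar G ν θ₀ h * noise G ν θ₀ h (V (i, true) ω) (V (i, false) ω) ^ 2) μ :=
    fun i => (i4 i).sub ((i2 i).const_mul (2 * noiseVar G ν θ₀ h))
  have hYi : ∀ i, Integrable (fun ω => Y i ω ^ 2) μ := fun i => by
    simp only [e]
    exact (i5 i).add (integrable_const _)
  have hL2 : ∀ i, MemLp (Y i) 2 μ := fun i =>
    (memLp_two_iff_integrable_sq (hYm i).aestronglyMeasurable).2 (hYi i)
  have hz : ∀ i, ∫ ω, Y i ω ∂μ = 0 := fun i => by
    simp only [hY]
    rw [integral_sub (i2 i) (integrable_const _), (hmom i).2.2.1]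
    simp
  -- The variance of the squared noise is at most its fourth moment.
  have h2 : ∀ i, ∫ ω, Y i ω ^ 2 ∂μ ≤ 16 * M := fun i => by
    simp only [e]
    rw [integral_add (i5 i) (integrable_const _), integral_sub (i4 i) ((i2 i).const_mul _),
      integral_const_mul, (hmom i).2.2.1]
    simp only [integral_const, probReal_univ, one_smul]
    have := (hmom i).2.2.2
    nlinarith [sq_nonneg (noiseVar G ν θ₀ h)]
  have hfun : (fun ω => ∑ i ∈ s, Y i ω) = ∑ i ∈ s, Y i := by
    ext ω
    simp
  have hfun' : ∀ ω, ∑ i ∈ s, Y i ω = (∑ i ∈ s, Y i) ω := fun ω => by simp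
  constructor
  · have : MemLp (∑ i ∈ s, Y i) 2 μ := memLp_finsetSum' s fun i _ => hL2 i
    rw [← hfun] at this
    exact this.integrable_sq
  · change ∫ ω, (∑ i ∈ s, Y i ω) ^ 2 ∂μ ≤ _
    simp only [hfun']
    rw [integral_sum_sq hind hL2 hz s]
    simpa using Finset.sum_le_sum fun i (_ : i ∈ s) => h2 i

end Runs

/-! ### Noise sums at a random step independent of the inputs. -/

section SecondStage

variable {S Ω E : Type*} [MeasurableSpace S] [MeasurableSpace Ω] [MeasurableSpace E]
  {G : ℝ → S → ℝ} {ν : Measure S}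
  [IsProbabilityMeasure ν] {μ : Measure Ω} [IsProbabilityMeasure μ] {θ₀ r M : ℝ}

/-- Moments of a weighted sum of `N` noise terms at a random perturbation `H X`, where the data `X`
are independent of the runs `V`, and the weight `φ` vanishes unless the perturbation is small. -/
theorem random_step_moments (hG : Measurable (Function.uncurry G)) (hM0 : 0 ≤ M)
    (hM : FourthMomentBound G ν θ₀ r M) {X : Ω → E} (hX : Measurable X) {V : ℕ × Bool → Ω → S}
    (hV : iIndepFun V μ) (hVm : ∀ p, Measurable (V p)) (hVl : ∀ p, μ.map (V p) = ν)
    (hXV : IndepFun X (fun ω p => V p ω) μ) {H : E → ℝ} (hH : Measurable H) {φ : ℝ → ℝ}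
    (hφ : Measurable φ) (hφr : ∀ h, φ h ≠ 0 → h ≠ 0 ∧ |h| < r) {N : ℕ} {C : ℝ}
    (hφC : ∀ h, φ h ^ 2 * N ≤ C) :
    MemLp (fun ω => φ (H (X ω)) * ∑ i ∈ Finset.range N,
      noise G ν θ₀ (H (X ω)) (V (i, true) ω) (V (i, false) ω)) 4 μ ∧
    ∫ ω, (φ (H (X ω)) * ∑ i ∈ Finset.range N,
      noise G ν θ₀ (H (X ω)) (V (i, true) ω) (V (i, false) ω)) ^ 4 ∂μ ≤ 48 * M * C ^ 2 ∧
    ∫ ω, (φ (H (X ω)) * ∑ i ∈ Finset.range N,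
      noise G ν θ₀ (H (X ω)) (V (i, true) ω) (V (i, false) ω)) ^ 2 ∂μ =
      ∫ ω, φ (H (X ω)) ^ 2 * N * noiseVar G ν θ₀ (H (X ω)) ∂μ ∧
    ∀ g : E → ℝ, Measurable g → MemLp (fun ω => g (X ω)) 4 μ →
      ∫ ω, g (X ω) * (φ (H (X ω)) * ∑ i ∈ Finset.range N,
        noise G ν θ₀ (H (X ω)) (V (i, true) ω) (V (i, false) ω)) ∂μ = 0 := by
  set F : E × (ℕ × Bool → S) → ℝ := fun p => φ (H p.1) * ∑ i ∈ Finset.range N,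
      noise G ν θ₀ (H p.1) (p.2 (i, true)) (p.2 (i, false)) with hF
  have hFm : Measurable F := by
    refine (hφ.comp (hH.comp measurable_fst)).mul (Finset.measurable_sum _ fun i _ => ?_)
    have h1 : Measurable fun p : E × (ℕ × Bool → S) => (H p.1, p.2 (i, true), p.2 (i, false)) :=
      (hH.comp measurable_fst).prodMk (by fun_prop)
    exact (measurable_noise hG).comp h1
  have hC0 : 0 ≤ C := (by positivity : (0 : ℝ) ≤ φ 0 ^ 2 * N).trans (hφC 0)
  have hVm' : Measurable fun ω p => V p ω := measurable_pi_lambda _ hVm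
  have hfix : ∀ x, MemLp (fun ω => F (x, fun p => V p ω)) 4 μ ∧
      ∫ ω, F (x, fun p => V p ω) ∂μ = 0 ∧
      ∫ ω, F (x, fun p => V p ω) ^ 2 ∂μ = φ (H x) ^ 2 * N * noiseVar G ν θ₀ (H x) ∧
      ∫ ω, F (x, fun p => V p ω) ^ 4 ∂μ ≤ 48 * M * C ^ 2 := by
    -- With the data frozen the step is a constant. Either the weight vanishes, and everything is
    -- zero, or the step lies within the radius r where the moment bounds hold.
    intro x
    by_cases hx : φ (H x) = 0
    · have e : ∀ ω, F (x, fun p => V p ω) = 0 := fun ω => by simp [hF, hx]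
      simp only [e, hx]
      refine ⟨MemLp.zero', by simp, by simp, ?_⟩
      simp only [ne_eq, OfNat.ofNat_ne_zero, not_false_eq_true, zero_pow, integral_zero]
      positivity
    · obtain ⟨h0, hr⟩ := hφr _ hx
      have h := sum_noise_moments hG hM hV hVm hVl (h := fun _ => H x) (fun _ => h0) (fun _ => hr)
        (fun _ => φ (H x)) (fun _ => le_rfl) (Finset.range N)
      have e : ∀ ω, F (x, fun p => V p ω) = ∑ i ∈ Finset.range N,
          φ (H x) * noise G ν θ₀ (H x) (V (i, true) ω) (V (i, false) ω) := fun ω => by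
        simp only [hF, Finset.mul_sum]
      simp only [e]
      refine ⟨h.1, h.2.1, ?_, h.2.2.2.trans ?_⟩
      · rw [h.2.2.1]
        simp
        ring
      · rw [(by decide : Even 4).pow_abs, Finset.card_range]
        have h3 : (φ (H x) ^ 2 * N) ^ 2 ≤ C ^ 2 :=
          pow_le_pow_left₀ (by positivity) (hφC (H x)) 2
        calc _ = 48 * M * (φ (H x) ^ 2 * N) ^ 2 := by ring
          _ ≤ _ := by gcongr
  have i4 : Integrable (fun ω => F (X ω, fun p => V p ω) ^ 4) μ := by
    refine integrable_of_indepFun hXV hX hVm' (f := fun p => F p ^ 4) (hFm.pow_const 4)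
      (fun ω => integrable_pow_of_memLp_four (hfix (X ω)).1 le_rfl) (C := 48 * M * C ^ 2)
      fun ω => ?_
    simp only [abs_pow, (by decide : Even 4).pow_abs]
    exact (hfix (X ω)).2.2.2
  have hFc : Measurable fun ω => F (X ω, fun p => V p ω) := hFm.comp (hX.prodMk hVm')
  have hL : MemLp (fun ω => F (X ω, fun p => V p ω)) 4 μ :=
    memLp_four_of_integrable hFc.aestronglyMeasurable i4
  refine ⟨hL, ?_, ?_, fun g hg hgL => ?_⟩
  · calc _ = ∫ ω, ∫ ω', F (X ω, fun p => V p ω') ^ 4 ∂μ ∂μ :=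
          integral_of_indepFun hXV hX hVm' (f := fun p => F p ^ 4) (hFm.pow_const 4) i4
      _ ≤ ∫ _, 48 * M * C ^ 2 ∂μ := by
          refine integral_mono_of_nonneg (Eventually.of_forall fun ω => ?_) (integrable_const _)
            (Eventually.of_forall fun ω => (hfix (X ω)).2.2.2)
          exact integral_nonneg fun ω' => by positivity
      _ = _ := by simp
  · refine (integral_of_indepFun hXV hX hVm' (f := fun p => F p ^ 2) (hFm.pow_const 2)
      (integrable_pow_of_memLp_four hL (by norm_num))).trans ?_
    exact integral_congr_ae (Eventually.of_forall fun ω => (hfix (X ω)).2.2.1)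
  -- The noise sum has mean zero for each frozen value of the data, hence is orthogonal to every
  -- function of the data in L⁴.
  · have hgL2 : MemLp (fun ω => g (X ω)) 2 μ := hgL.mono_exponent (by norm_num)
    have hL2 : MemLp (fun ω => F (X ω, fun p => V p ω)) 2 μ := hL.mono_exponent (by norm_num)
    refine (integral_of_indepFun hXV hX hVm' (f := fun p => g p.1 * F p)
      ((hg.comp measurable_fst).mul hFm) (hgL2.integrable_mul hL2)).trans ?_
    have e : ∀ ω, ∫ ω', g (X ω) * F (X ω, fun p => V p ω') ∂μ = 0 := fun ω => by
      rw [integral_const_mul, (hfix (X ω)).2.1, mul_zero]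
    simp [e]

end SecondStage

/-! ### Transfer of moments under L² approximation. -/

section L2

variable {Ω : Type*} [MeasurableSpace Ω] {μ : Measure Ω}

theorem eLpNorm_two_eq {X : Ω → ℝ} (hX : MemLp X 2 μ) :
    eLpNorm X 2 μ = ENNReal.ofReal √(∫ ω, X ω ^ 2 ∂μ) := by
  rw [hX.eLpNorm_eq_integral_rpow_norm (by norm_num) (by norm_num), Real.sqrt_eq_rpow]
  norm_num

variable [IsProbabilityMeasure μ]

/-- If `Z - W` tends to zero in `L²` and `W` is bounded in `L²`, the first two moments of `Z` and
`W` are asymptotically the same. -/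
theorem tendsto_moments_sub {Z W : ℕ → Ω → ℝ} (hZ : ∀ m, MemLp (Z m) 2 μ)
    (hW : ∀ᶠ m in atTop, MemLp (W m) 2 μ) {C : ℝ} (hC : ∀ᶠ m in atTop, ∫ ω, W m ω ^ 2 ∂μ ≤ C)
    (h : Tendsto (fun m => eLpNorm (Z m - W m) 2 μ) atTop (𝓝 0)) :
    Tendsto (fun m => (∫ ω, Z m ω ∂μ) - ∫ ω, W m ω ∂μ) atTop (𝓝 0) ∧
    Tendsto (fun m => (∫ ω, Z m ω ^ 2 ∂μ) - ∫ ω, W m ω ^ 2 ∂μ) atTop (𝓝 0) := by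
  have hR : ∀ᶠ m in atTop, MemLp (Z m - W m) 2 μ := hW.mono fun m hm => (hZ m).sub hm
  have hlim : Tendsto (fun m => ∫ ω, (Z m - W m) ω ^ 2 ∂μ) atTop (𝓝 0) := by
    have h1 := (ENNReal.tendsto_toReal ENNReal.zero_ne_top).comp h
    have h2 := h1.pow 2
    rw [ENNReal.toReal_zero, zero_pow two_ne_zero] at h2
    refine h2.congr' ?_
    filter_upwards [hR] with m hRm
    simp only [Function.comp_apply]
    rw [eLpNorm_two_eq hRm, ENNReal.toReal_ofReal (Real.sqrt_nonneg _),
      Real.sq_sqrt (integral_nonneg fun ω => by positivity)]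
  have hsq : Tendsto (fun m => √(∫ ω, (Z m - W m) ω ^ 2 ∂μ)) atTop (𝓝 0) := by
    have := hlim.sqrt
    rwa [Real.sqrt_zero] at this
  have cs : ∀ (X Y : Ω → ℝ), MemLp X 2 μ → MemLp Y 2 μ →
      |∫ ω, X ω * Y ω ∂μ| ≤ √(∫ ω, X ω ^ 2 ∂μ) * √(∫ ω, Y ω ^ 2 ∂μ) := by
    intro X Y hX hY
    have h1 := integral_mul_norm_le_Lp_mul_Lq (μ := μ) (f := X) (g := Y)
      Real.HolderConjugate.two_two
      (by simpa using hX) (by simpa using hY)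
    have h2 : |∫ ω, X ω * Y ω ∂μ| ≤ ∫ ω, ‖X ω‖ * ‖Y ω‖ ∂μ := by
      refine (abs_integral_le_integral_abs).trans (le_of_eq ?_)
      simp [abs_mul]
    refine h2.trans (h1.trans (le_of_eq ?_))
    simp [Real.sqrt_eq_rpow]
  constructor
  · refine squeeze_zero_norm' ?_ hsq
    filter_upwards [hR, hW] with m hRm hWm
    have iZ := (hZ m).integrable (by norm_num : (1 : ℝ≥0∞) ≤ 2)
    have iW := hWm.integrable (by norm_num : (1 : ℝ≥0∞) ≤ 2)
    have h1 := cs (Z m - W m) (fun _ => 1) hRm (memLp_const 1)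
    simp only [mul_one, one_pow, integral_const, probReal_univ, smul_eq_mul, Real.sqrt_one] at h1
    rw [Real.norm_eq_abs, ← integral_sub iZ iW]
    exact h1
  · have hb : Tendsto (fun m => (∫ ω, (Z m - W m) ω ^ 2 ∂μ) +
        2 * (√(∫ ω, (Z m - W m) ω ^ 2 ∂μ) * √C)) atTop (𝓝 0) := by
      simpa using hlim.add ((hsq.mul_const √C).const_mul 2)
    refine squeeze_zero_norm' ?_ hb
    filter_upwards [hC, hR, hW] with m hm hRm hWm
    have iR2 := hRm.integrable_sq
    have iRW : Integrable (fun ω => (Z m - W m) ω * W m ω) μ := hRm.integrable_mul hWm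
    -- Z² - W² = (Z - W)² + 2(Z - W)W; Cauchy–Schwarz handles the last product.
    have e : (∫ ω, Z m ω ^ 2 ∂μ) - ∫ ω, W m ω ^ 2 ∂μ =
        (∫ ω, (Z m - W m) ω ^ 2 ∂μ) + 2 * ∫ ω, (Z m - W m) ω * W m ω ∂μ := by
      rw [← integral_sub (hZ m).integrable_sq hWm.integrable_sq, ← integral_const_mul,
        ← integral_add iR2 (iRW.const_mul 2)]
      refine integral_congr_ae (Eventually.of_forall fun ω => ?_)
      simp only [Pi.sub_apply]
      ring
    have h1 := cs (Z m - W m) (W m) hRm hWm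
    have h0 : 0 ≤ ∫ ω, (Z m - W m) ω ^ 2 ∂μ := integral_nonneg fun ω => by positivity
    rw [e, Real.norm_eq_abs]
    refine (abs_add_le _ _).trans ?_
    rw [abs_of_nonneg h0, abs_mul, abs_two]
    gcongr
    exact h1.trans (mul_le_mul_of_nonneg_left (Real.sqrt_le_sqrt hm) (Real.sqrt_nonneg _))

end L2

/-! ### Powers of the two sample sizes. -/

section Scales

/-- The scale `n_b ^ (-1/10)` of the pilot perturbations. -/
def pilotScale (N : ℕ) : ℝ := (N : ℝ) ^ (-(1 / 10) : ℝ)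

theorem pilotScale_pos {N : ℕ} (hN : 0 < N) : 0 < pilotScale N := by
  unfold pilotScale
  positivity

theorem pilotScale_pow {N : ℕ} (hN : 0 < N) : (N : ℝ) * pilotScale N ^ 10 = 1 := by
  have : (0 : ℝ) < N := by exact_mod_cast hN
  have h : pilotScale N ^ 10 = (N : ℝ)⁻¹ := by
    rw [pilotScale, ← Real.rpow_natCast, ← Real.rpow_mul this.le, ← Real.rpow_neg_one]
    norm_num
  rw [h, mul_inv_cancel₀ this.ne']

theorem sqrt_mul_pilotScale {N : ℕ} (hN : 0 < N) : √(N : ℝ) * pilotScale N ^ 5 = 1 := by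
  have h1 := pilotScale_pos hN
  have h2 : (√(N : ℝ) * pilotScale N ^ 5) ^ 2 = 1 := by
    rw [mul_pow, Real.sq_sqrt (by positivity), ← pow_mul, pilotScale_pow hN]
  have h3 : 0 ≤ √(N : ℝ) * pilotScale N ^ 5 := by positivity
  nlinarith

theorem tendsto_pilotScale : Tendsto pilotScale atTop (𝓝 0) :=
  (tendsto_rpow_neg_atTop (by norm_num)).comp tendsto_natCast_atTop_atTop

theorem pilotStep_eq {K : ℕ} (c : Fin K → ℝ) (N : ℕ) :
    pilotStep c N = fun k => c k * pilotScale N := rfl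

/-- The sixth root of the sample size. -/
def sixthRoot (n : ℕ) : ℝ := (n : ℝ) ^ (1 / 6 : ℝ)

theorem sixthRoot_pos {n : ℕ} (hn : 0 < n) : 0 < sixthRoot n := by
  unfold sixthRoot
  positivity

theorem sixthRoot_pow (n : ℕ) : sixthRoot n ^ 6 = n := by
  rw [sixthRoot, ← Real.rpow_natCast, ← Real.rpow_mul (by positivity)]
  norm_num

theorem sixthRoot_sq (n : ℕ) : (n : ℝ) ^ (1 / 3 : ℝ) = sixthRoot n ^ 2 := by
  rw [sixthRoot, ← Real.rpow_natCast, ← Real.rpow_mul (by positivity)]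
  norm_num

theorem tendsto_sixthRoot : Tendsto sixthRoot atTop atTop :=
  (tendsto_rpow_atTop (by norm_num)).comp tendsto_natCast_atTop_atTop

theorem sqrt_ratio {N n : ℕ} (hN : 0 < N) (hn : 0 < n) :
    √((N : ℝ) / n) = 1 / (pilotScale N ^ 5 * sixthRoot n ^ 3) := by
  have h1 := pilotScale_pos hN
  have h2 := sixthRoot_pos hn
  rw [Real.sqrt_eq_iff_eq_sq (by positivity) (by positivity), div_pow, mul_pow, ← pow_mul,
    ← pow_mul, sixthRoot_pow, one_pow]
  have := pilotScale_pow hN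
  have h3 : (0 : ℝ) < n := by exact_mod_cast hn
  field_simp
  exact this

/-- The quantity is N^(3/5) n^(-2/3), at most n^(-1/15) because N ≤ n. It is the order at which the
intercept error enters the normalized error. -/
theorem tendsto_ratio_mul_scale {nb n : ℕ → ℕ} (hn : Tendsto n atTop atTop)
    (hle : ∀ m, nb m ≤ n m) :
    Tendsto (fun m => (nb m : ℝ) / n m * sixthRoot (n m) ^ 2 * pilotScale (nb m) ^ 4) atTop
      (𝓝 0) := by
  have h1 : Tendsto (fun m => (n m : ℝ) ^ (-(1 / 15) : ℝ)) atTop (𝓝 0) :=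
    ((tendsto_rpow_neg_atTop (by norm_num)).comp tendsto_natCast_atTop_atTop).comp hn
  refine squeeze_zero' (Eventually.of_forall fun m => ?_) ?_ h1
  · have : 0 ≤ pilotScale (nb m) := Real.rpow_nonneg (by positivity) _
    have : 0 ≤ sixthRoot (n m) := Real.rpow_nonneg (by positivity) _
    positivity
  filter_upwards [hn.eventually_gt_atTop 0] with m hm
  have hn0 : (0 : ℝ) < n m := by exact_mod_cast hm
  rcases Nat.eq_zero_or_pos (nb m) with h0 | h0
  · rw [h0]
    simp only [Nat.cast_zero, zero_div, zero_mul]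
    positivity
  have hb0 : (0 : ℝ) < nb m := by exact_mod_cast h0
  have hbn : (nb m : ℝ) ≤ n m := by exact_mod_cast hle m
  have e1 : (nb m : ℝ) * pilotScale (nb m) ^ 4 = (nb m : ℝ) ^ (3 / 5 : ℝ) := by
    rw [pilotScale, ← Real.rpow_natCast, ← Real.rpow_mul hb0.le, ← Real.rpow_one_add' hb0.le] <;>
    norm_num
  have e2 : (n m : ℝ) ^ (-(1 / 15) : ℝ) = (n m : ℝ) ^ (3 / 5 : ℝ) * sixthRoot (n m) ^ 2 / n m := by
    rw [← sixthRoot_sq, ← Real.rpow_add hn0, eq_div_iff hn0.ne', ← Real.rpow_add_one hn0.ne']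
    norm_num
  calc _ = (nb m : ℝ) * pilotScale (nb m) ^ 4 * sixthRoot (n m) ^ 2 / n m := by ring
    _ ≤ (n m : ℝ) ^ (3 / 5 : ℝ) * sixthRoot (n m) ^ 2 / n m := by
      rw [e1]
      gcongr
    _ = _ := e2.symm

end Scales

/-! ### Exact decomposition of the normalized error. -/

section Decomposition

variable {S Ω : Type*} [MeasurableSpace S] {G : ℝ → S → ℝ} {ν : Measure S} {θ₀ : ℝ} {K : ℕ}
  {c : Fin K → ℝ} {U : Run K → Ω → S}

/-- The normalized noise of the pilot average at `h_k`. -/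
def pilotNoise (G : ℝ → S → ℝ) (ν : Measure S) (θ₀ : ℝ) (c : Fin K → ℝ) (U : Run K → Ω → S)
    (N : ℕ) (k : Fin K) (ω : Ω) : ℝ :=
  (∑ j ∈ Finset.range N, noise G ν θ₀ (c k * pilotScale N) (U (Sum.inl (k, j, true)) ω)
    (U (Sum.inl (k, j, false)) ω)) / (2 * c k * √(N : ℝ))

/-- The normalized bias of the pilot average at `h_k`, beyond the quadratic term. -/
def pilotBias (G : ℝ → S → ℝ) (ν : Measure S) (θ₀ : ℝ) (c : Fin K → ℝ) (N : ℕ) (k : Fin K) : ℝ :=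
  c k ^ 4 * ((centralDiff (perf G ν) θ₀ (c k * pilotScale N) - deriv (perf G ν) θ₀ -
    iteratedDeriv 3 (perf G ν) θ₀ / 6 * (c k * pilotScale N) ^ 2) / (c k * pilotScale N) ^ 4)

/-- The normalized deviation of the pilot averages from the regression line. -/
def pilotError (G : ℝ → S → ℝ) (ν : Measure S) (θ₀ : ℝ) (c : Fin K → ℝ) (U : Run K → Ω → S)
    (N : ℕ) (ω : Ω) (k : Fin K) : ℝ := pilotBias G ν θ₀ c N k + pilotNoise G ν θ₀ c U N k ω

/-- The sum of the noise terms of the second stage. -/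
def stageNoise (G : ℝ → S → ℝ) (ν : Measure S) (θ₀ : ℝ) (c : Fin K → ℝ) (U : Run K → Ω → S)
    (N n : ℕ) (ω : Ω) : ℝ :=
  ∑ i ∈ Finset.range (n - K * N), noise G ν θ₀ (randomStep G θ₀ c U N n ω)
    (U (Sum.inr (i, true)) ω) (U (Sum.inr (i, false)) ω)

theorem pilot_eq (N : ℕ) (ω : Ω) (k : Fin K) (j : Fin N) :
    pilot G θ₀ c U N ω k j = centralDiff (perf G ν) θ₀ (c k * pilotScale N) +
      noise G ν θ₀ (c k * pilotScale N) (U (Sum.inl (k, j, true)) ω)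
        (U (Sum.inl (k, j, false)) ω) / (2 * (c k * pilotScale N)) :=
  diffQuot_eq _ _ _

/-- The exponent -1/10 balances the pilot average: the noise N^(-1/2)/t and the quartic bias are
both of order t⁴, since √N t⁵ = 1. -/
theorem sampleAvg_pilot (hc : ∀ k, c k ≠ 0) {N : ℕ} (hN : 0 < N) (ω : Ω) (k : Fin K) :
    sampleAvg (pilot G θ₀ c U N ω k) = deriv (perf G ν) θ₀ + coeffB G ν θ₀ *
      (c k * pilotScale N) ^ 2 + pilotScale N ^ 4 * pilotError G ν θ₀ c U N ω k := by
  have hk := hc k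
  have ht := pilotScale_pos hN
  have hN' : (0 : ℝ) < N := by exact_mod_cast hN
  have h5 := sqrt_mul_pilotScale hN
  have h10 := pilotScale_pow hN
  have hs : √(N : ℝ) = 1 / pilotScale N ^ 5 := by rw [eq_div_iff (by positivity), h5]
  have hN1 : (N : ℝ) = 1 / pilotScale N ^ 10 := by rw [eq_div_iff (by positivity), h10]
  rw [sampleAvg]
  simp only [pilot_eq (ν := ν)]
  rw [Finset.sum_add_distrib, ← Finset.sum_div, Finset.sum_const, Finset.card_univ,
    Fintype.card_fin, nsmul_eq_mul, pilotError, pilotNoise, pilotBias, coeffB, hs,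
    Fin.sum_univ_eq_sum_range (fun j => noise G ν θ₀ (c k * pilotScale N)
      (U (Sum.inl (k, j, true)) ω) (U (Sum.inl (k, j, false)) ω)) N, add_div,
    mul_div_cancel_left₀ _ hN'.ne']
  rw [hN1]
  field_simp
  ring

/-- The transformation is affine in the pilot differences, so they enter only through their
averages. -/
theorem corCFD_eq {N n : ℕ} (hN : 0 < N) (h : Fin K → ℝ) (x : Fin K → Fin N → ℝ)
    (z : Fin (n - K * N) → ℝ) :
    corCFD n h x z = (∑ i, z i + N * ∑ k, (|h k| / |hHat n h x| *
      (sampleAvg (x k) - fitted (betaE h x) (h k)) + fitted (betaE h x) (hHat n h x))) / n := by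
  have hN' : (N : ℝ) ≠ 0 := by positivity
  rw [corCFD, Finset.mul_sum]
  congr 2
  refine Finset.sum_congr rfl fun k _ => ?_
  simp only [deltaCor]
  rw [Finset.sum_add_distrib, ← Finset.mul_sum, Finset.sum_sub_distrib]
  simp only [Finset.sum_const, Finset.card_univ, Fintype.card_fin, nsmul_eq_mul, sampleAvg]
  field_simp

theorem betaE_pilot (hc : ∀ k, c k ≠ 0) (hc2 : ∃ j k, |c j| ≠ |c k|) {N : ℕ} (hN : 0 < N)
    (ω : Ω) :
    betaE (pilotStep c N) (pilot G θ₀ c U N ω) 0 = deriv (perf G ν) θ₀ +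
      pilotScale N ^ 4 * leastSquares (designE c) (pilotError G ν θ₀ c U N ω) 0 ∧
    betaE (pilotStep c N) (pilot G θ₀ c U N ω) 1 = coeffB G ν θ₀ +
      pilotScale N ^ 2 * leastSquares (designE c) (pilotError G ν θ₀ c U N ω) 1 ∧
    ∀ k, sampleAvg (pilot G θ₀ c U N ω k) -
      fitted (betaE (pilotStep c N) (pilot G θ₀ c U N ω)) (pilotStep c N k) =
      pilotScale N ^ 4 * (residualProj c *ᵥ pilotError G ν θ₀ c U N ω) k := by
  have ht := pilotScale_pos hN
  have h := leastSquares_line_add hc2 ht.ne' (sampleAvg_pilot (ν := ν) (U := U) (G := G)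
    (θ₀ := θ₀) hc hN ω)
  have e : (fun k => bootMean (pilot G θ₀ c U N ω k)) =
      fun k => sampleAvg (pilot G θ₀ c U N ω k) := funext fun k => bootMean_eq _
  rw [betaE, e, pilotStep_eq]
  refine ⟨h.1, ?_, h.2.2⟩
  rw [h.2.1]
  field_simp

/-- The normalized error of the estimator, decomposed. -/
theorem normalized_error_eq (hc : ∀ k, c k ≠ 0) (hc2 : ∃ j k, |c j| ≠ |c k|) {N n : ℕ}
    (hN : 0 < N) (hn : 0 < n) (hle : K * N ≤ n) {ω : Ω}
    (hH : 0 < randomStep G θ₀ c U N n ω) :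
    (n : ℝ) ^ (1 / 3 : ℝ) * (estimator G θ₀ c U N n ω - deriv (perf G ν) θ₀) =
      sixthRoot n ^ 2 / (n * (2 * randomStep G θ₀ c U N n ω)) * stageNoise G ν θ₀ c U N n ω +
      (1 - K * ((N : ℝ) / n)) * ((centralDiff (perf G ν) θ₀ (randomStep G θ₀ c U N n ω) -
        deriv (perf G ν) θ₀) / randomStep G θ₀ c U N n ω ^ 2 *
          (sixthRoot n * randomStep G θ₀ c U N n ω) ^ 2) +
      √((N : ℝ) / n) / (sixthRoot n * randomStep G θ₀ c U N n ω) *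
        ∑ k, noiseWeight c k * pilotError G ν θ₀ c U N ω k +
      K * ((N : ℝ) / n * sixthRoot n ^ 2 * pilotScale N ^ 4 *
        leastSquares (designE c) (pilotError G ν θ₀ c U N ω) 0) +
      K * ((N : ℝ) / n) * ((sixthRoot n * randomStep G θ₀ c U N n ω) ^ 2 *
        betaE (pilotStep c N) (pilot G θ₀ c U N ω) 1) := by
  have hβ := betaE_pilot (ν := ν) (U := U) (G := G) (θ₀ := θ₀) hc hc2 hN ω
  have ht := pilotScale_pos hN
  have hp := sixthRoot_pos hn
  have hn' : (0 : ℝ) < n := by exact_mod_cast hn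
  rw [estimator, corCFD_eq hN]
  change _ * ((∑ i : Fin (n - K * N), diffQuot G θ₀ (randomStep G θ₀ c U N n ω)
    (U (Sum.inr ((i : ℕ), true)) ω) (U (Sum.inr ((i : ℕ), false)) ω) + _ * ∑ k, (|pilotStep c N k| /
      |randomStep G θ₀ c U N n ω| * _ + fitted _ (randomStep G θ₀ c U N n ω))) / _ - _) = _
  set H := randomStep G θ₀ c U N n ω with hHdef
  simp only [diffQuot_eq (ν := ν), hβ.2.2]
  have hstage : ∑ i : Fin (n - K * N), (centralDiff (perf G ν) θ₀ H +
      noise G ν θ₀ H (U (Sum.inr ((i : ℕ), true)) ω) (U (Sum.inr ((i : ℕ), false)) ω) / (2 * H)) =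
      (n - K * N) * centralDiff (perf G ν) θ₀ H + stageNoise G ν θ₀ c U N n ω / (2 * H) := by
    rw [Finset.sum_add_distrib, ← Finset.sum_div, Fin.sum_univ_eq_sum_range (fun i =>
      noise G ν θ₀ H (U (Sum.inr (i, true)) ω) (U (Sum.inr (i, false)) ω)) (n - K * N)]
    simp only [Finset.sum_const, Finset.card_univ, Fintype.card_fin, nsmul_eq_mul]
    rw [Nat.cast_sub hle]
    push_cast
    rfl
  have hpil : ∑ k, (|pilotStep c N k| / |H| * (pilotScale N ^ 4 *
      (residualProj c *ᵥ pilotError G ν θ₀ c U N ω) k) +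
      fitted (betaE (pilotStep c N) (pilot G θ₀ c U N ω)) H) =
      pilotScale N ^ 5 / H * (∑ k, noiseWeight c k * pilotError G ν θ₀ c U N ω k) +
      K * (deriv (perf G ν) θ₀ + pilotScale N ^ 4 *
        leastSquares (designE c) (pilotError G ν θ₀ c U N ω) 0 +
        H ^ 2 * betaE (pilotStep c N) (pilot G θ₀ c U N ω) 1) := by
    -- Symmetry of P turns the |c_k|-weighted residuals into the errors weighted by `noiseWeight`.
    rw [noiseWeight, ← sum_mul_residualProj, Finset.sum_add_distrib, Finset.mul_sum]
    congr 1
    · refine Finset.sum_congr rfl fun k _ => ?_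
      rw [pilotStep_eq, abs_mul, abs_of_pos ht, abs_of_pos hH]
      ring
    · simp only [Finset.sum_const, Finset.card_univ, Fintype.card_fin, nsmul_eq_mul, fitted]
      rw [hβ.1]
  rw [hstage, hpil, sixthRoot_sq, sqrt_ratio hN hn]
  -- Substituting N = t^(-10) and n = p⁶ makes the claim a rational identity in t and p.
  have hN1 : (N : ℝ) = 1 / pilotScale N ^ 10 := by
    rw [eq_div_iff (by positivity), pilotScale_pow hN]
  have hn1 := sixthRoot_pow n
  generalize sixthRoot n = p at *
  generalize (betaE (pilotStep c N) (pilot G θ₀ c U N ω)) 1 = b1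
  generalize leastSquares (designE c) (pilotError G ν θ₀ c U N ω) 0 = L0
  generalize ∑ k, noiseWeight c k * pilotError G ν θ₀ c U N ω k = Q
  generalize stageNoise G ν θ₀ c U N n ω = W
  generalize centralDiff (perf G ν) θ₀ H = b
  generalize deriv (perf G ν) θ₀ = a
  rw [hN1, ← hn1]
  field_simp
  ring

end Decomposition

/-- The model with measurable runs, and the sequence of sample sizes. -/
structure Setting {S Ω : Type*} [MeasurableSpace S] [MeasurableSpace Ω] (G : ℝ → S → ℝ)
    (ν : Measure S) (μ : Measure Ω) (θ₀ r M : ℝ) {K : ℕ} (c : Fin K → ℝ) (U : Run K → Ω → S)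
    (nb n : ℕ → ℕ) : Prop where
  measurable_model : Measurable (Function.uncurry G)
  radius_pos : 0 < r
  bound_nonneg : 0 ≤ M
  fourthMomentBound : FourthMomentBound G ν θ₀ r M
  measurable_run : ∀ p, Measurable (U p)
  map_run : ∀ p, μ.map (U p) = ν
  iIndepFun_run : iIndepFun U μ
  card_pos : 0 < K
  const_ne_zero : ∀ k, c k ≠ 0
  exists_abs_ne : ∃ j k, |c j| ≠ |c k|
  contDiffAt_perf : ContDiffAt ℝ 5 (perf G ν) θ₀
  coeffB_ne_zero : coeffB G ν θ₀ ≠ 0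
  continuousAt_stdDev : ContinuousAt (stdDev G ν) θ₀
  stdDev_pos : 0 < stdDev G ν θ₀
  tendsto_nb : Tendsto nb atTop atTop
  tendsto_n : Tendsto n atTop atTop
  mul_le : ∀ m, K * nb m ≤ n m

/-! ### Consistency of the pilot regressions and of the estimated step. -/

namespace Setting

variable {S Ω : Type*} [MeasurableSpace S] [MeasurableSpace Ω] {G : ℝ → S → ℝ} {ν : Measure S}
  {μ : Measure Ω} {θ₀ r M : ℝ} {K : ℕ} {c : Fin K → ℝ} {U : Run K → Ω → S} {nb n : ℕ → ℕ}

theorem nb_le (hS : Setting G ν μ θ₀ r M c U nb n) (m : ℕ) : nb m ≤ n m :=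
  (Nat.le_mul_of_pos_left _ hS.card_pos).trans (hS.mul_le m)

theorem eventually_nb_pos (hS : Setting G ν μ θ₀ r M c U nb n) : ∀ᶠ m in atTop, 0 < nb m :=
  hS.tendsto_nb.eventually_gt_atTop 0

theorem eventually_n_pos (hS : Setting G ν μ θ₀ r M c U nb n) : ∀ᶠ m in atTop, 0 < n m :=
  hS.tendsto_n.eventually_gt_atTop 0

theorem tendsto_pilotStep (hS : Setting G ν μ θ₀ r M c U nb n) (k : Fin K) :
    Tendsto (fun m => c k * pilotScale (nb m)) atTop (𝓝[≠] 0) := by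
  refine tendsto_nhdsWithin_iff.2 ⟨?_, ?_⟩
  · simpa using (tendsto_pilotScale.comp hS.tendsto_nb).const_mul (c k)
  · filter_upwards [hS.eventually_nb_pos] with m hm
    exact mul_ne_zero (hS.const_ne_zero k) (pilotScale_pos hm).ne'

theorem eventually_pilotStep_lt (hS : Setting G ν μ θ₀ r M c U nb n) :
    ∀ᶠ m in atTop, ∀ k, |c k * pilotScale (nb m)| < r := by
  rw [eventually_all]
  intro k
  have h := ((hS.tendsto_pilotStep k).mono_right nhdsWithin_le_nhds).abs
  rw [abs_zero] at h
  exact h.eventually_lt_const hS.radius_pos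

theorem tendsto_pilotBias (hS : Setting G ν μ θ₀ r M c U nb n) (k : Fin K) :
    Tendsto (fun m => pilotBias G ν θ₀ c (nb m) k) atTop (𝓝 (c k ^ 4 * coeffD G ν θ₀)) :=
  ((tendsto_centralDiff_remainder hS.contDiffAt_perf).comp (hS.tendsto_pilotStep k)).const_mul _

variable [IsProbabilityMeasure ν]

theorem tendsto_noiseVar_pilotStep (hS : Setting G ν μ θ₀ r M c U nb n) (k : Fin K) :
    Tendsto (fun m => noiseVar G ν θ₀ (c k * pilotScale (nb m))) atTop
      (𝓝 (2 * stdDev G ν θ₀ ^ 2)) :=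
  (tendsto_noiseVar hS.continuousAt_stdDev).comp
    ((hS.tendsto_pilotStep k).mono_right nhdsWithin_le_nhds)

variable [IsProbabilityMeasure μ]

/-- A single sum over the KN independent pairs (k, j), with weights w_k / (2 c_k √N). The
normalization by √N makes the fourth moment bounded independently of N. -/
theorem weighted_pilotNoise_moments (hS : Setting G ν μ θ₀ r M c U nb n) (w : Fin K → ℝ) {N : ℕ}
    (hN : 0 < N) (hr : ∀ k, |c k * pilotScale N| < r) :
    MemLp (fun ω => ∑ k, w k * pilotNoise G ν θ₀ c U N k ω) 4 μ ∧
    ∫ ω, ∑ k, w k * pilotNoise G ν θ₀ c U N k ω ∂μ = 0 ∧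
    ∫ ω, (∑ k, w k * pilotNoise G ν θ₀ c U N k ω) ^ 2 ∂μ =
      ∑ k, w k ^ 2 / c k ^ 2 * (noiseVar G ν θ₀ (c k * pilotScale N) / 4) ∧
    ∫ ω, (∑ k, w k * pilotNoise G ν θ₀ c U N k ω) ^ 4 ∂μ ≤
      48 * M * (∑ k, |w k / (2 * c k)|) ^ 4 * K ^ 2 := by
  have hN' : (0 : ℝ) < N := by exact_mod_cast hN
  have hsq : (0 : ℝ) < √(N : ℝ) := Real.sqrt_pos.2 hN'
  set V : (Fin K × ℕ) × Bool → Ω → S := fun p => U (Sum.inl (p.1.1, p.1.2, p.2)) with hV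
  have hVi : iIndepFun V μ := hS.iIndepFun_run.precomp
    (g := fun p : (Fin K × ℕ) × Bool => Sum.inl (p.1.1, p.1.2, p.2)) (by
      rintro ⟨⟨a, b⟩, d⟩ ⟨⟨a', b'⟩, d'⟩ h
      simpa [and_assoc] using h)
  have h := sum_noise_moments hS.measurable_model hS.fourthMomentBound hVi
    (fun p => hS.measurable_run _) (fun p => hS.map_run _)
    (h := fun p : Fin K × ℕ => c p.1 * pilotScale N)
    (fun p => mul_ne_zero (hS.const_ne_zero _) (pilotScale_pos hN).ne') (fun p => hr p.1)
    (fun p : Fin K × ℕ => w p.1 / (2 * c p.1) / √(N : ℝ))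
    (A := (∑ k, |w k / (2 * c k)|) / √(N : ℝ)) (fun p => by
      rw [abs_div, abs_of_pos hsq]
      gcongr
      exact Finset.single_le_sum (f := fun k => |w k / (2 * c k)|)
        (fun k _ => abs_nonneg _) (Finset.mem_univ p.1))
    (Finset.univ ×ˢ Finset.range N)
  have e : ∀ ω, ∑ p ∈ (Finset.univ : Finset (Fin K)) ×ˢ Finset.range N,
      w p.1 / (2 * c p.1) / √(N : ℝ) * noise G ν θ₀ (c p.1 * pilotScale N) (V (p, true) ω)
        (V (p, false) ω) = ∑ k, w k * pilotNoise G ν θ₀ c U N k ω := fun ω => by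
    rw [Finset.sum_product]
    refine Finset.sum_congr rfl fun k _ => ?_
    simp only [pilotNoise, hV]
    rw [← Finset.mul_sum]
    ring
  simp only [e] at h
  refine ⟨h.1, h.2.1, ?_, h.2.2.2.trans (le_of_eq ?_)⟩
  · rw [h.2.2.1, Finset.sum_product]
    refine Finset.sum_congr rfl fun k _ => ?_
    have hk := hS.const_ne_zero k
    simp only [Finset.sum_const, Finset.card_range, nsmul_eq_mul, div_pow,
      Real.sq_sqrt hN'.le]
    field_simp
    ring
  · rw [Finset.card_product, Finset.card_range, Finset.card_univ, Fintype.card_fin, div_pow,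
      show √(N : ℝ) ^ 4 = (√(N : ℝ) ^ 2) ^ 2 by ring, Real.sq_sqrt hN'.le]
    push_cast
    field_simp

theorem tendsto_integral_weighted_pilotNoise_sq (hS : Setting G ν μ θ₀ r M c U nb n)
    (w : Fin K → ℝ) :
    Tendsto (fun m => ∫ ω, (∑ k, w k * pilotNoise G ν θ₀ c U (nb m) k ω) ^ 2 ∂μ) atTop
      (𝓝 ((∑ k, w k ^ 2 / c k ^ 2) * (stdDev G ν θ₀ ^ 2 / 2))) := by
  have h : Tendsto (fun m => ∑ k, w k ^ 2 / c k ^ 2 *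
      (noiseVar G ν θ₀ (c k * pilotScale (nb m)) / 4)) atTop
      (𝓝 (∑ k, w k ^ 2 / c k ^ 2 * (2 * stdDev G ν θ₀ ^ 2 / 4))) :=
    tendsto_finsetSum _ fun k _ => ((hS.tendsto_noiseVar_pilotStep k).div_const 4).const_mul _
  have e : (∑ k, w k ^ 2 / c k ^ 2) * (stdDev G ν θ₀ ^ 2 / 2) =
      ∑ k, w k ^ 2 / c k ^ 2 * (2 * stdDev G ν θ₀ ^ 2 / 4) := by
    rw [Finset.sum_mul]
    refine Finset.sum_congr rfl fun k _ => ?_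
    ring
  rw [e]
  refine h.congr' ?_
  filter_upwards [hS.eventually_nb_pos, hS.eventually_pilotStep_lt] with m h1 h2
  exact (hS.weighted_pilotNoise_moments w h1 h2).2.2.1.symm

/-- The pilot noise is bounded in L², so any factor that vanishes in probability makes the product
vanish. -/
theorem tendsto_mul_weighted_pilotNoise (hS : Setting G ν μ θ₀ r M c U nb n) (w : Fin K → ℝ)
    {X : ℕ × Ω → ℝ} (hX : Tendsto X (probFilter μ) (𝓝 0)) :
    Tendsto (fun p : ℕ × Ω => X p * ∑ k, w k * pilotNoise G ν θ₀ c U (nb p.1) k p.2)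
      (probFilter μ) (𝓝 0) := by
  refine tendsto_probFilter_mul_of_integral_sq_le
    (Y := fun m ω => ∑ k, w k * pilotNoise G ν θ₀ c U (nb m) k ω) hX ?_
    ((hS.tendsto_integral_weighted_pilotNoise_sq w).eventually_le_const (lt_add_one _))
  filter_upwards [hS.eventually_nb_pos, hS.eventually_pilotStep_lt] with m h1 h2
  exact integrable_pow_of_memLp_four (hS.weighted_pilotNoise_moments w h1 h2).1 (by norm_num)

theorem tendsto_mul_weighted_pilotError (hS : Setting G ν μ θ₀ r M c U nb n) (w : Fin K → ℝ)
    {X : ℕ × Ω → ℝ} (hX : Tendsto X (probFilter μ) (𝓝 0)) :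
    Tendsto (fun p : ℕ × Ω => X p * ∑ k, w k * pilotError G ν θ₀ c U (nb p.1) p.2 k)
      (probFilter μ) (𝓝 0) := by
  have h1 : Tendsto (fun m => ∑ k, w k * pilotBias G ν θ₀ c (nb m) k) atTop
      (𝓝 (∑ k, w k * (c k ^ 4 * coeffD G ν θ₀))) :=
    tendsto_finsetSum _ fun k _ => (hS.tendsto_pilotBias k).const_mul _
  have h2 := (hX.mul (tendsto_probFilter_of_atTop h1)).add
    (hS.tendsto_mul_weighted_pilotNoise w hX)
  rw [zero_mul, add_zero] at h2
  refine h2.congr fun p => ?_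
  rw [← mul_add, ← Finset.sum_add_distrib]
  simp only [pilotError, mul_add]

/-- A regression coefficient is a sum of the errors weighted by a row of (XᵀX)⁻¹Xᵀ. -/
theorem tendsto_mul_leastSquares_pilotError (hS : Setting G ν μ θ₀ r M c U nb n) (i : Fin 2)
    {X : ℕ × Ω → ℝ} (hX : Tendsto X (probFilter μ) (𝓝 0)) :
    Tendsto (fun p : ℕ × Ω => X p *
      leastSquares (designE c) (pilotError G ν θ₀ c U (nb p.1) p.2) i) (probFilter μ) (𝓝 0) :=
  hS.tendsto_mul_weighted_pilotError
    ((((designE c)ᵀ * designE c)⁻¹ * (designE c)ᵀ) i) hX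

theorem tendsto_betaE (hS : Setting G ν μ θ₀ r M c U nb n) :
    Tendsto (fun p : ℕ × Ω => betaE (pilotStep c (nb p.1)) (pilot G θ₀ c U (nb p.1) p.2) 1)
      (probFilter μ) (𝓝 (coeffB G ν θ₀)) := by
  have h0 : Tendsto (fun m => pilotScale (nb m) ^ 2) atTop (𝓝 0) := by
    have := (tendsto_pilotScale.comp hS.tendsto_nb).pow 2
    rwa [zero_pow two_ne_zero] at this
  have h1 := (hS.tendsto_mul_leastSquares_pilotError 1
    (tendsto_probFilter_of_atTop (μ := μ) h0)).const_add (coeffB G ν θ₀)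
  rw [add_zero] at h1
  refine h1.congr' ?_
  filter_upwards [tendsto_fst_probFilter.eventually hS.eventually_nb_pos] with p hp
  exact (betaE_pilot hS.const_ne_zero hS.exists_abs_ne hp p.2).2.1.symm

/-- A weak law proved by second moments, because the step, and with it the law of the summands,
changes with m. -/
theorem tendsto_noise_sq_average (hS : Setting G ν μ θ₀ r M c U nb n) (k : Fin K) :
    Tendsto (fun p : ℕ × Ω => (∑ j ∈ Finset.range (nb p.1),
      noise G ν θ₀ (c k * pilotScale (nb p.1)) (U (Sum.inl (k, j, true)) p.2)
        (U (Sum.inl (k, j, false)) p.2) ^ 2) / nb p.1) (probFilter μ)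
      (𝓝 (2 * stdDev G ν θ₀ ^ 2)) := by
  set V : ℕ × Bool → Ω → S := fun p => U (Sum.inl (k, p.1, p.2)) with hV
  have hVi : iIndepFun V μ := hS.iIndepFun_run.precomp
    (g := fun p : ℕ × Bool => Sum.inl (k, p.1, p.2)) (by
      rintro ⟨a, b⟩ ⟨a', b'⟩ h
      simpa using h)
  have hmom := fun m (h1 : 0 < nb m) (h2 : ∀ k, |c k * pilotScale (nb m)| < r) =>
    integral_sq_sum_noise_sq_le hS.measurable_model hS.fourthMomentBound hVi
      (fun p => hS.measurable_run _) (fun p => hS.map_run _)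
      (mul_ne_zero (hS.const_ne_zero k) (pilotScale_pos h1).ne') (h2 k) (Finset.range (nb m))
  set X : ℕ → Ω → ℝ := fun m ω => (∑ j ∈ Finset.range (nb m),
    (noise G ν θ₀ (c k * pilotScale (nb m)) (V (j, true) ω) (V (j, false) ω) ^ 2 -
      noiseVar G ν θ₀ (c k * pilotScale (nb m)))) / nb m with hX
  have hlim : Tendsto (fun p : ℕ × Ω => X p.1 p.2) (probFilter μ) (𝓝 0) := by
    apply tendsto_probFilter_of_integral_sq
    · filter_upwards [hS.eventually_nb_pos, hS.eventually_pilotStep_lt] with m h1 h2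
      simp only [hX, div_pow]
      exact (hmom m h1 h2).1.div_const _
    · have hb : Tendsto (fun m => 16 * M / (nb m : ℝ)) atTop (𝓝 0) :=
        tendsto_const_nhds.div_atTop (tendsto_natCast_atTop_atTop.comp hS.tendsto_nb)
      refine squeeze_zero' (Eventually.of_forall fun m => integral_nonneg fun ω => by positivity)
        ?_ hb
      filter_upwards [hS.eventually_nb_pos, hS.eventually_pilotStep_lt] with m h1 h2
      have hm0 : (0 : ℝ) < nb m := by exact_mod_cast h1
      simp only [hX, div_pow]
      rw [integral_div, div_le_div_iff₀ (by positivity) hm0]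
      have h3 := (hmom m h1 h2).2
      rw [Finset.card_range] at h3
      nlinarith
  have h2 := hlim.add (tendsto_probFilter_of_atTop (μ := μ) (hS.tendsto_noiseVar_pilotStep k))
  rw [zero_add] at h2
  refine h2.congr' ?_
  filter_upwards [tendsto_fst_probFilter.eventually hS.eventually_nb_pos] with p hp
  have hp0 : (nb p.1 : ℝ) ≠ 0 := by positivity
  simp only [hX]
  rw [Finset.sum_sub_distrib]
  simp only [Finset.sum_const, Finset.card_range, nsmul_eq_mul]
  field_simp
  rw [sub_add_cancel]

/-- Mean of the squares minus square of the mean. The mean noise is 2c_k/√N times the normalized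
pilot noise, hence negligible. -/
theorem tendsto_sampleVar (hS : Setting G ν μ θ₀ r M c U nb n) (k : Fin K) :
    Tendsto (fun p : ℕ × Ω => 2 * (c k * pilotScale (nb p.1)) ^ 2 *
      ((∑ j, (pilot G θ₀ c U (nb p.1) p.2 k j - sampleAvg (pilot G θ₀ c U (nb p.1) p.2 k)) ^ 2) /
        nb p.1)) (probFilter μ) (𝓝 (stdDev G ν θ₀ ^ 2)) := by
  have h1 := hS.tendsto_noise_sq_average k
  have h0 : Tendsto (fun m => 2 * c k * (√(nb m : ℝ))⁻¹) atTop (𝓝 0) := by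
    have := (tendsto_inv_atTop_zero.comp (Real.tendsto_sqrt_atTop.comp
      (tendsto_natCast_atTop_atTop.comp hS.tendsto_nb))).const_mul (2 * c k)
    rwa [mul_zero] at this
  have h2 := (hS.tendsto_mul_weighted_pilotNoise (Pi.single k 1)
    (tendsto_probFilter_of_atTop (μ := μ) h0)).pow 2
  have h3 := (h1.sub h2).div_const 2
  have e : (2 * stdDev G ν θ₀ ^ 2 - 0 ^ 2) / 2 = stdDev G ν θ₀ ^ 2 := by ring
  rw [e] at h3
  refine h3.congr' ?_
  filter_upwards [tendsto_fst_probFilter.eventually hS.eventually_nb_pos] with p hp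
  obtain ⟨m, ω⟩ := p
  simp only at hp ⊢
  have hN : (0 : ℝ) < nb m := by exact_mod_cast hp
  have ht := pilotScale_pos hp
  have hk := hS.const_ne_zero k
  have hsum : ∑ i, (Pi.single k 1 : Fin K → ℝ) i * pilotNoise G ν θ₀ c U (nb m) i ω =
      pilotNoise G ν θ₀ c U (nb m) k ω := by
    simp [Pi.single_apply]
  rw [hsum, pilotNoise]
  set f : ℕ → ℝ := fun j => noise G ν θ₀ (c k * pilotScale (nb m)) (U (Sum.inl (k, j, true)) ω)
        (U (Sum.inl (k, j, false)) ω) with hf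
  have hs : √(nb m : ℝ) ^ 2 = nb m := Real.sq_sqrt hN.le
  have hs0 : 0 < √(nb m : ℝ) := Real.sqrt_pos.2 hN
  have hdev : ∀ j : Fin (nb m), pilot G θ₀ c U (nb m) ω k j -
      sampleAvg (pilot G θ₀ c U (nb m) ω k) =
      (f j - (∑ i ∈ Finset.range (nb m), f i) / nb m) / (2 * (c k * pilotScale (nb m))) := by
    intro j
    rw [sampleAvg]
    simp only [pilot_eq (ν := ν)]
    rw [Finset.sum_add_distrib, ← Finset.sum_div, Fin.sum_univ_eq_sum_range f (nb m)]
    simp only [Finset.sum_const, Finset.card_univ, Fintype.card_fin, nsmul_eq_mul]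
    change _ + f j / _ - _ = _
    field_simp
    ring
  simp only [hdev, div_pow]
  rw [Fin.sum_univ_eq_sum_range (fun j => (f j - (∑ i ∈ Finset.range (nb m), f i) / nb m) ^ 2 /
    (2 * (c k * pilotScale (nb m))) ^ 2) (nb m), ← Finset.sum_div]
  have hexp : ∑ j ∈ Finset.range (nb m), (f j - (∑ i ∈ Finset.range (nb m), f i) / nb m) ^ 2 =
      ∑ j ∈ Finset.range (nb m), f j ^ 2 - (∑ i ∈ Finset.range (nb m), f i) ^ 2 / nb m := by
    simp only [sub_sq]
    rw [Finset.sum_add_distrib, Finset.sum_sub_distrib, ← Finset.sum_mul, ← Finset.mul_sum]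
    simp only [Finset.sum_const, Finset.card_range, nsmul_eq_mul]
    field_simp
    ring
  rw [hexp]
  generalize ∑ j ∈ Finset.range (nb m), f j ^ 2 = A
  generalize ∑ j ∈ Finset.range (nb m), f j = B
  have e2 : (2 * c k * (√(nb m : ℝ))⁻¹ * (B / (2 * c k * √(nb m : ℝ)))) ^ 2 =
      B ^ 2 / (nb m : ℝ) ^ 2 := by
    calc _ = B ^ 2 / (√(nb m : ℝ) ^ 2) ^ 2 := by field_simp
      _ = _ := by rw [hs]
  rw [e2]
  field_simp

/-- By `betaV_eq` this is an average with weights 1/c_k⁴ of quantities that all tend to σ². -/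
theorem tendsto_betaV (hS : Setting G ν μ θ₀ r M c U nb n) :
    Tendsto (fun p : ℕ × Ω => betaV (pilotStep c (nb p.1)) (pilot G θ₀ c U (nb p.1) p.2))
      (probFilter μ) (𝓝 (stdDev G ν θ₀ ^ 2)) := by
  have hN : Tendsto (fun m => (nb m : ℝ) / ((nb m : ℝ) - 1)) atTop (𝓝 1) := by
    have h1 : Tendsto (fun m => ((nb m : ℝ) - 1)) atTop atTop :=
      tendsto_atTop_add_const_right _ _ (tendsto_natCast_atTop_atTop.comp hS.tendsto_nb)
    have h2 := (tendsto_inv_atTop_zero.comp h1).const_add 1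
    rw [add_zero] at h2
    refine h2.congr' ?_
    filter_upwards [h1.eventually_gt_atTop 0] with m hm
    simp only [Function.comp_apply]
    field_simp
    ring
  have hsum : 0 < ∑ k, (c k ^ 4)⁻¹ := by
    have : Nonempty (Fin K) := ⟨⟨0, hS.card_pos⟩⟩
    refine Finset.sum_pos (fun k _ => ?_) Finset.univ_nonempty
    have := hS.const_ne_zero k
    positivity
  have h := (tendsto_finsetSum Finset.univ fun k (_ : k ∈ Finset.univ) =>
    (((hS.tendsto_sampleVar k).mul (tendsto_probFilter_of_atTop (μ := μ) hN)).const_mul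
      (c k ^ 4)⁻¹)).div_const (∑ k, (c k ^ 4)⁻¹)
  rw [← Finset.sum_mul, mul_one, mul_div_cancel_left₀ _ hsum.ne'] at h
  refine h.congr' ?_
  filter_upwards [tendsto_fst_probFilter.eventually (hS.tendsto_nb.eventually_ge_atTop 2)] with p hp
  have ht := pilotScale_pos (show 0 < nb p.1 by omega)
  exact (betaV_eq hp hS.const_ne_zero ht.ne' _).symm

/-- The limit of the normalized estimated perturbation. -/
theorem tendsto_sixthRoot_mul_randomStep (hS : Setting G ν μ θ₀ r M c U nb n) :
    Tendsto (fun p : ℕ × Ω => sixthRoot (n p.1) * randomStep G θ₀ c U (nb p.1) (n p.1) p.2)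
      (probFilter μ) (𝓝 ((stdDev G ν θ₀ ^ 2 / (4 * coeffB G ν θ₀ ^ 2)) ^ (1 / 6 : ℝ))) := by
  have hB := hS.coeffB_ne_zero
  have hσ := hS.stdDev_pos
  have h1 := hS.tendsto_betaV.div ((hS.tendsto_betaE.pow 2).const_mul 4) (by positivity)
  have h2 := h1.rpow_const (p := 1 / 6) (Or.inr (by norm_num))
  refine h2.congr' ?_
  -- Splitting the sixth root of a product needs a nonnegative base, available where the variance
  -- estimate is positive; this has probability tending to one.
  filter_upwards [tendsto_fst_probFilter.eventually hS.eventually_n_pos,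
    hS.tendsto_betaV.eventually_const_lt (show 0 < stdDev G ν θ₀ ^ 2 by positivity)] with p hp hv
  have hn : (0 : ℝ) < n p.1 := by exact_mod_cast hp
  simp only [Pi.div_apply]
  rw [randomStep, hHat, sixthRoot, ← Real.mul_rpow (by positivity) (by positivity)]
  congr 1
  field_simp

end Setting

/-! ### The leading term and the cut-off weight. -/

section Definitions

variable {S Ω : Type*} [MeasurableSpace S] {K : ℕ}

/-- The limit of the estimated perturbation multiplied by `n ^ (1/6)`. -/
def stepLimit (G : ℝ → S → ℝ) (ν : Measure S) (θ₀ : ℝ) : ℝ :=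
  (stdDev G ν θ₀ ^ 2 / (4 * coeffB G ν θ₀ ^ 2)) ^ (1 / 6 : ℝ)

/-- The weight of the second stage noise, cut off when the perturbation `h` is not of the expected
size. -/
def stageWeight (a r : ℝ) (n : ℕ) (h : ℝ) : ℝ :=
  open Classical in
  if a / 2 ≤ sixthRoot n * h ∧ sixthRoot n * h ≤ 2 * a ∧ h < r then
    sixthRoot n ^ 2 / (n * (2 * h)) else 0

/-- The limiting mean of the normalized error. -/
def limitMean (G : ℝ → S → ℝ) (ν : Measure S) (θ₀ : ℝ) (c : Fin K → ℝ) (ρ : ℝ) : ℝ :=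
  coeffB G ν θ₀ * stepLimit G ν θ₀ ^ 2 + √ρ / stepLimit G ν θ₀ * (coeffD G ν θ₀ * Lam c)

/-- The limiting variance of the normalized error. -/
def limitVar (G : ℝ → S → ℝ) (ν : Measure S) (θ₀ : ℝ) (c : Fin K → ℝ) (ρ : ℝ) : ℝ :=
  (1 + ρ * (qConst c - K)) * (stdDev G ν θ₀ ^ 2 / (2 * stepLimit G ν θ₀ ^ 2))

/-- The part of the leading term that is determined by the pilot runs. -/
def pilotTerm (G : ℝ → S → ℝ) (ν : Measure S) (θ₀ : ℝ) (c : Fin K → ℝ) (U : Run K → Ω → S)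
    (N n : ℕ) (ω : Ω) : ℝ :=
  limitMean G ν θ₀ c ((N : ℝ) / n) + √((N : ℝ) / n) / stepLimit G ν θ₀ *
    ∑ k, noiseWeight c k * pilotNoise G ν θ₀ c U N k ω

/-- The part of the leading term that comes from the noise of the second stage. -/
def stageTerm (G : ℝ → S → ℝ) (ν : Measure S) (θ₀ r : ℝ) (c : Fin K → ℝ) (U : Run K → Ω → S)
    (N n : ℕ) (ω : Ω) : ℝ :=
  stageWeight (stepLimit G ν θ₀) r n (randomStep G θ₀ c U N n ω) * stageNoise G ν θ₀ c U N n ω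

theorem measurable_stageWeight (a r : ℝ) (n : ℕ) : Measurable (stageWeight a r n) := by
  classical
  have h1 : Measurable fun h : ℝ => sixthRoot n * h := measurable_const_mul _
  refine Measurable.ite ?_ (by fun_prop) measurable_const
  exact (measurableSet_le measurable_const h1).inter
    ((measurableSet_le h1 measurable_const).inter (measurableSet_lt measurable_id measurable_const))

theorem stageWeight_ne_zero {a r : ℝ} (ha : 0 < a) {n : ℕ} {h : ℝ} (hh : stageWeight a r n h ≠ 0) :
    0 < n ∧ 0 < h ∧ h < r ∧ a / 2 ≤ sixthRoot n * h := by
  unfold stageWeight at hh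
  split_ifs at hh with hc
  · have hn : 0 < n := by
      rcases Nat.eq_zero_or_pos n with rfl | hn
      · simp at hh
      · exact hn
    have hp := sixthRoot_pos hn
    have : 0 < sixthRoot n * h := by linarith [hc.1]
    exact ⟨hn, (pos_iff_pos_of_mul_pos this).1 hp, hc.2.2, hc.1⟩
  · exact absurd rfl hh

theorem stageWeight_sq_eq {n : ℕ} (hn : 0 < n) {h : ℝ} (hh : 0 < h) :
    (sixthRoot n ^ 2 / (n * (2 * h))) ^ 2 * n = 1 / (4 * (sixthRoot n * h) ^ 2) := by
  have hp := sixthRoot_pos hn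
  rw [← sixthRoot_pow n]
  field_simp
  norm_num

/-- The lower cut-off a/2 gives the bound 1/(4(a/2)²) = 1/a². Without it nothing would control the
moments of the reciprocal of the estimated step. -/
theorem stageWeight_sq_mul_le {a r : ℝ} (ha : 0 < a) (n : ℕ) (h : ℝ) :
    stageWeight a r n h ^ 2 * n ≤ 1 / a ^ 2 := by
  by_cases hh : stageWeight a r n h = 0
  · rw [hh]
    simp
    positivity
  · obtain ⟨hn, h0, -, hl⟩ := stageWeight_ne_zero ha hh
    have e : stageWeight a r n h = sixthRoot n ^ 2 / (n * (2 * h)) := by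
      unfold stageWeight at hh ⊢
      split_ifs at hh ⊢ with hc
      · rfl
      · exact absurd rfl hh
    rw [e, stageWeight_sq_eq hn h0]
    apply one_div_le_one_div_of_le (by positivity)
    nlinarith

end Definitions

section Measurability

variable {S : Type*} [MeasurableSpace S] {G : ℝ → S → ℝ} {K : ℕ}

theorem measurable_hHat {E : Type*} [MeasurableSpace E] {N : ℕ} (n : ℕ) (h : Fin K → ℝ)
    {x : E → Fin K → Fin N → ℝ} (hx : ∀ k j, Measurable fun e => x e k j) :
    Measurable fun e => hHat n h (x e) := by
  have havg : ∀ k, Measurable fun e => sampleAvg (x e k) := fun k =>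
    (Finset.measurable_sum _ fun j _ => hx k j).div_const _
  have hvar : ∀ k, Measurable fun e => bootVar (x e k) := fun k => by
    simp only [bootVar_eq]
    exact (Finset.measurable_sum _ fun j _ => ((hx k j).sub (havg k)).pow_const 2).div_const _
  have hE : Measurable fun e => betaE h (x e) 1 := by
    simp only [betaE, leastSquares, Matrix.mulVec, dotProduct, bootMean_eq]
    exact Finset.measurable_sum _ fun k _ => (havg k).const_mul _
  have hV : Measurable fun e => betaV h (x e) := by
    simp only [betaV, leastSquares, Matrix.mulVec, dotProduct]
    exact Finset.measurable_sum _ fun k _ => (hvar k).const_mul _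
  exact (hV.div ((hE.pow_const 2).const_mul _)).pow_const _

end Measurability

/-! ### Moments of the second stage part. -/

namespace Setting

variable {S Ω : Type*} [MeasurableSpace S] [MeasurableSpace Ω] {G : ℝ → S → ℝ} {ν : Measure S}
  {μ : Measure Ω} {θ₀ r M : ℝ} {K : ℕ} {c : Fin K → ℝ} {U : Run K → Ω → S} {nb n : ℕ → ℕ}

theorem stepLimit_pos (hS : Setting G ν μ θ₀ r M c U nb n) : 0 < stepLimit G ν θ₀ := by
  have := hS.coeffB_ne_zero
  have := hS.stdDev_pos
  unfold stepLimit
  positivity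

theorem ratio_nonneg_le (hS : Setting G ν μ θ₀ r M c U nb n) (m : ℕ) :
    0 ≤ (nb m : ℝ) / n m ∧ (nb m : ℝ) / n m ≤ 1 ∧ K * ((nb m : ℝ) / n m) ≤ 1 := by
  have h1 : (nb m : ℝ) ≤ n m := by exact_mod_cast hS.nb_le m
  have h2 : (K * nb m : ℝ) ≤ n m := by exact_mod_cast hS.mul_le m
  refine ⟨by positivity, div_le_one_of_le₀ h1 (by positivity), ?_⟩
  rw [← mul_div_assoc]
  exact div_le_one_of_le₀ h2 (by positivity)

variable [IsProbabilityMeasure ν] [IsProbabilityMeasure μ]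

/-- The moments of the two parts of the leading term. -/
theorem stageTerm_moments (hS : Setting G ν μ θ₀ r M c U nb n) (m : ℕ) :
    MemLp (stageTerm G ν θ₀ r c U (nb m) (n m)) 4 μ ∧
    ∫ ω, stageTerm G ν θ₀ r c U (nb m) (n m) ω ^ 4 ∂μ ≤
      48 * M * (1 / stepLimit G ν θ₀ ^ 2) ^ 2 ∧
    ∫ ω, stageTerm G ν θ₀ r c U (nb m) (n m) ω ^ 2 ∂μ =
      ∫ ω, stageWeight (stepLimit G ν θ₀) r (n m) (randomStep G θ₀ c U (nb m) (n m) ω) ^ 2 *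
        (n m - K * nb m : ℕ) * noiseVar G ν θ₀ (randomStep G θ₀ c U (nb m) (n m) ω) ∂μ ∧
    Measurable (pilotTerm G ν θ₀ c U (nb m) (n m)) ∧
    Measurable (randomStep G θ₀ c U (nb m) (n m)) ∧
    (MemLp (pilotTerm G ν θ₀ c U (nb m) (n m)) 4 μ →
      ∫ ω, pilotTerm G ν θ₀ c U (nb m) (n m) ω * stageTerm G ν θ₀ r c U (nb m) (n m) ω ∂μ = 0) ∧
    ∫ ω, stageTerm G ν θ₀ r c U (nb m) (n m) ω ∂μ = 0 := by
  have ha := hS.stepLimit_pos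
  set X : Ω → (Fin K × ℕ × Bool → S) := fun ω p => U (Sum.inl p) ω with hX
  have hXm : Measurable X := measurable_pi_lambda _ fun p => hS.measurable_run _
  set V : ℕ × Bool → Ω → S := fun p => U (Sum.inr p) with hV
  set H : (Fin K × ℕ × Bool → S) → ℝ := fun x => hHat (n m) (pilotStep c (nb m))
    (fun k (j : Fin (nb m)) => diffQuot G θ₀ (pilotStep c (nb m) k) (x (k, j, true))
      (x (k, j, false))) with hH
  have hHm : Measurable H := by
    refine measurable_hHat _ _ fun k j => ?_
    have h1 : ∀ θ, Measurable (G θ) := fun θ => hS.measurable_model.comp measurable_prodMk_left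
    exact (((h1 _).comp (measurable_pi_apply _)).sub
      ((h1 _).comp (measurable_pi_apply _))).div_const _
  set g : (Fin K × ℕ × Bool → S) → ℝ := fun x =>
    limitMean G ν θ₀ c ((nb m : ℝ) / n m) + √((nb m : ℝ) / n m) / stepLimit G ν θ₀ *
    ∑ k, noiseWeight c k * ((∑ j ∈ Finset.range (nb m), noise G ν θ₀ (c k * pilotScale (nb m))
      (x (k, j, true)) (x (k, j, false))) / (2 * c k * √(nb m : ℝ))) with hg
  have hgm : Measurable g := by
    refine (Measurable.const_mul (Finset.measurable_sum _ fun k _ => ?_) _).const_add _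
    refine Measurable.const_mul (Measurable.div_const (Finset.measurable_sum _ fun j _ => ?_) _) _
    have h1 : Measurable fun x : Fin K × ℕ × Bool → S => (c k * pilotScale (nb m),
      x (k, j, true), x (k, j, false)) := by fun_prop
    exact (measurable_noise hS.measurable_model).comp h1
  -- The step and the pilot term are functions `H` and `g` of the pilot inputs alone, so the stage
  -- term has the form required for conditioning.
  have hst : stageTerm G ν θ₀ r c U (nb m) (n m) = fun ω =>
      stageWeight (stepLimit G ν θ₀) r (n m) (H (X ω)) * ∑ i ∈ Finset.range (n m - K * nb m),
        noise G ν θ₀ (H (X ω)) (V (i, true) ω) (V (i, false) ω) := rfl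
  have hpt : pilotTerm G ν θ₀ c U (nb m) (n m) = fun ω => g (X ω) := rfl
  have hrs : randomStep G θ₀ c U (nb m) (n m) = fun ω => H (X ω) := rfl
  rw [hst, hpt, hrs]
  clear_value H g
  have h := random_step_moments hS.measurable_model hS.bound_nonneg hS.fourthMomentBound hXm
    (V := V) (hS.iIndepFun_run.precomp Sum.inr_injective) (fun p => hS.measurable_run _)
    (fun p => hS.map_run _) (indepFun_inl_inr hS.iIndepFun_run hS.measurable_run) hHm
    (measurable_stageWeight (stepLimit G ν θ₀) r (n m)) (fun h hh => by
      obtain ⟨-, h0, hr, -⟩ := stageWeight_ne_zero ha hh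
      exact ⟨h0.ne', by rwa [abs_of_pos h0]⟩) (N := n m - K * nb m)
    (C := 1 / stepLimit G ν θ₀ ^ 2) (fun h => by
      refine le_trans ?_ (stageWeight_sq_mul_le (r := r) ha (n m) h)
      gcongr
      exact Nat.sub_le _ _)
  refine ⟨h.1, h.2.1, h.2.2.1, hgm.comp hXm, hHm.comp hXm, fun hL => h.2.2.2 g hgm hL, ?_⟩
  have h1 := h.2.2.2 (fun _ => 1) measurable_const (memLp_const 1)
  simp only [one_mul] at h1
  exact h1

end Setting

/-! ### Comparison of the error with its leading term, and limits of moments. -/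

namespace Setting

variable {S Ω : Type*} [MeasurableSpace S] [MeasurableSpace Ω] {G : ℝ → S → ℝ} {ν : Measure S}
  {μ : Measure Ω} {θ₀ r M : ℝ} {K : ℕ} {c : Fin K → ℝ} {U : Run K → Ω → S} {nb n : ℕ → ℕ}

/-- Boundedness in m replaces convergence, since ρ is only known to be bounded. -/
theorem abs_limitMean_le (hS : Setting G ν μ θ₀ r M c U nb n) (m : ℕ) :
    |limitMean G ν θ₀ c ((nb m : ℝ) / n m)| ≤ |coeffB G ν θ₀ * stepLimit G ν θ₀ ^ 2| +
      |(stepLimit G ν θ₀)⁻¹ * (coeffD G ν θ₀ * Lam c)| := by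
  have h1 := Real.sqrt_le_one.2 (hS.ratio_nonneg_le m).2.1
  rw [limitMean, show √((nb m : ℝ) / n m) / stepLimit G ν θ₀ * (coeffD G ν θ₀ * Lam c) =
    √((nb m : ℝ) / n m) * ((stepLimit G ν θ₀)⁻¹ * (coeffD G ν θ₀ * Lam c)) by ring]
  refine (abs_add_le _ _).trans ?_
  refine add_le_add le_rfl ?_
  rw [abs_mul, abs_of_nonneg (Real.sqrt_nonneg _)]
  exact mul_le_of_le_one_left (abs_nonneg _) h1

variable [IsProbabilityMeasure ν] [IsProbabilityMeasure μ]

theorem tendsto_normalizedStep (hS : Setting G ν μ θ₀ r M c U nb n) :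
    Tendsto (fun p : ℕ × Ω => sixthRoot (n p.1) * randomStep G θ₀ c U (nb p.1) (n p.1) p.2)
      (probFilter μ) (𝓝 (stepLimit G ν θ₀)) := hS.tendsto_sixthRoot_mul_randomStep

theorem tendsto_randomStep (hS : Setting G ν μ θ₀ r M c U nb n) :
    Tendsto (fun p : ℕ × Ω => randomStep G θ₀ c U (nb p.1) (n p.1) p.2)
      (probFilter μ) (𝓝[>] 0) := by
  have h1 : Tendsto (fun m => (sixthRoot (n m))⁻¹) atTop (𝓝 0) :=
    tendsto_inv_atTop_zero.comp (tendsto_sixthRoot.comp hS.tendsto_n)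
  have h2 := (tendsto_probFilter_of_atTop (μ := μ) h1).mul hS.tendsto_normalizedStep
  rw [zero_mul] at h2
  have h3 : ∀ᶠ p in probFilter μ, 0 < n p.1 :=
    tendsto_fst_probFilter.eventually hS.eventually_n_pos
  refine tendsto_nhdsWithin_iff.2 ⟨h2.congr' ?_, ?_⟩
  · filter_upwards [h3] with p hp
    exact inv_mul_cancel_left₀ (sixthRoot_pos hp).ne' _
  · filter_upwards [h3, hS.tendsto_normalizedStep.eventually_const_lt hS.stepLimit_pos]
      with p hp hτ
    exact (pos_iff_pos_of_mul_pos hτ).1 (sixthRoot_pos hp)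

/-- The cut-off is inactive with probability tending to one, so it does not affect limits in
probability. -/
theorem eventually_stageWeight (hS : Setting G ν μ θ₀ r M c U nb n) :
    ∀ᶠ p in probFilter μ, stageWeight (stepLimit G ν θ₀) r (n p.1)
      (randomStep G θ₀ c U (nb p.1) (n p.1) p.2) = sixthRoot (n p.1) ^ 2 /
        (n p.1 * (2 * randomStep G θ₀ c U (nb p.1) (n p.1) p.2)) := by
  have ha := hS.stepLimit_pos
  filter_upwards [hS.tendsto_normalizedStep.eventually_const_lt (half_lt_self ha),
    hS.tendsto_normalizedStep.eventually_lt_const (show _ < 2 * stepLimit G ν θ₀ by linarith),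
    (hS.tendsto_randomStep.mono_right nhdsWithin_le_nhds).eventually_lt_const hS.radius_pos]
    with p h1 h2 h3
  rw [stageWeight, if_pos ⟨h1.le, h2.le, h3⟩]

set_option maxHeartbeats 400000 in
/-- The normalized error agrees with its leading term up to a quantity that tends to zero in
probability. -/
theorem tendsto_error_sub (hS : Setting G ν μ θ₀ r M c U nb n) :
    Tendsto (fun p : ℕ × Ω => (n p.1 : ℝ) ^ (1 / 3 : ℝ) *
      (estimator G θ₀ c U (nb p.1) (n p.1) p.2 - deriv (perf G ν) θ₀) -
      (pilotTerm G ν θ₀ c U (nb p.1) (n p.1) p.2 + stageTerm G ν θ₀ r c U (nb p.1) (n p.1) p.2))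
      (probFilter μ) (𝓝 0) := by
  have ha := hS.stepLimit_pos
  set a := stepLimit G ν θ₀ with hadef
  set B := coeffB G ν θ₀ with hB
  have hτ := hS.tendsto_normalizedStep
  rw [← hadef] at hτ
  have hstep := hS.tendsto_randomStep
  have hstep' : Tendsto (fun p : ℕ × Ω => randomStep G θ₀ c U (nb p.1) (n p.1) p.2)
      (probFilter μ) (𝓝[≠] 0) :=
    hstep.mono_right (nhdsWithin_mono _ fun x hx => (Set.mem_Ioi.1 hx).ne')
  -- Five null sequences: `t1` second stage bias, `t2` step replaced by its limit in the residual
  -- term, `t3` pilot bias replaced by its limit, `t4` intercept error, `t5` fitted bias. The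
  -- factors containing ρ are merely bounded in `t1`, `t2`, `t3`, `t5`.
  have t1 : Tendsto (fun p : ℕ × Ω => (1 - K * ((nb p.1 : ℝ) / n p.1)) *
      ((centralDiff (perf G ν) θ₀ (randomStep G θ₀ c U (nb p.1) (n p.1) p.2) -
        deriv (perf G ν) θ₀) / randomStep G θ₀ c U (nb p.1) (n p.1) p.2 ^ 2 *
        (sixthRoot (n p.1) * randomStep G θ₀ c U (nb p.1) (n p.1) p.2) ^ 2 - B * a ^ 2))
      (probFilter μ) (𝓝 0) := by
    refine bdd_le_mul_tendsto_zero' 1 (Eventually.of_forall fun p => ?_) ?_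
    · have h := hS.ratio_nonneg_le p.1
      have : 0 ≤ K * ((nb p.1 : ℝ) / n p.1) := mul_nonneg (Nat.cast_nonneg _) h.1
      rw [abs_le]
      constructor <;> linarith [h.2.2]
    · have h := (((tendsto_centralDiff_sub_div hS.contDiffAt_perf).comp hstep').mul
        (hτ.pow 2)).sub_const (B * a ^ 2)
      rw [show iteratedDeriv 3 (perf G ν) θ₀ / 6 = B from rfl, sub_self] at h
      exact h
  have t2 : Tendsto (fun p : ℕ × Ω => √((nb p.1 : ℝ) / n p.1) *
      ((sixthRoot (n p.1) * randomStep G θ₀ c U (nb p.1) (n p.1) p.2)⁻¹ - a⁻¹) *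
      ∑ k, noiseWeight c k * pilotError G ν θ₀ c U (nb p.1) p.2 k) (probFilter μ) (𝓝 0) := by
    refine hS.tendsto_mul_weighted_pilotError _ ?_
    refine bdd_le_mul_tendsto_zero' 1 (Eventually.of_forall fun p => ?_) ?_
    · rw [abs_of_nonneg (Real.sqrt_nonneg _)]
      exact Real.sqrt_le_one.2 (hS.ratio_nonneg_le p.1).2.1
    · have h := (hτ.inv₀ ha.ne').sub_const a⁻¹
      rwa [sub_self] at h
  have t3 : Tendsto (fun p : ℕ × Ω => √((nb p.1 : ℝ) / n p.1) * (a⁻¹ *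
      ∑ k, noiseWeight c k * (pilotBias G ν θ₀ c (nb p.1) k - c k ^ 4 * coeffD G ν θ₀)))
      (probFilter μ) (𝓝 0) := by
    refine bdd_le_mul_tendsto_zero' 1 (Eventually.of_forall fun p => ?_) ?_
    · rw [abs_of_nonneg (Real.sqrt_nonneg _)]
      exact Real.sqrt_le_one.2 (hS.ratio_nonneg_le p.1).2.1
    · have h : Tendsto (fun m => a⁻¹ * ∑ k, noiseWeight c k * (pilotBias G ν θ₀ c (nb m) k -
          c k ^ 4 * coeffD G ν θ₀)) atTop (𝓝 (a⁻¹ * ∑ k, noiseWeight c k *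
          (c k ^ 4 * coeffD G ν θ₀ - c k ^ 4 * coeffD G ν θ₀))) :=
        (tendsto_finsetSum _ fun k _ =>
          ((hS.tendsto_pilotBias k).sub_const _).const_mul _).const_mul _
      simp only [sub_self, mul_zero, Finset.sum_const_zero] at h
      exact h.comp tendsto_fst_probFilter
  have t4 : Tendsto (fun p : ℕ × Ω => (K : ℝ) * (((nb p.1 : ℝ) / n p.1 * sixthRoot (n p.1) ^ 2 *
      pilotScale (nb p.1) ^ 4) * leastSquares (designE c)
        (pilotError G ν θ₀ c U (nb p.1) p.2) 0)) (probFilter μ) (𝓝 0) := by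
    rw [← mul_zero (K : ℝ)]
    refine Tendsto.const_mul _ (hS.tendsto_mul_leastSquares_pilotError 0 (X := fun p : ℕ × Ω =>
      (nb p.1 : ℝ) / n p.1 * sixthRoot (n p.1) ^ 2 * pilotScale (nb p.1) ^ 4) ?_)
    exact (tendsto_ratio_mul_scale hS.tendsto_n hS.nb_le).comp tendsto_fst_probFilter
  have t5 : Tendsto (fun p : ℕ × Ω => K * ((nb p.1 : ℝ) / n p.1) *
      ((sixthRoot (n p.1) * randomStep G θ₀ c U (nb p.1) (n p.1) p.2) ^ 2 *
        betaE (pilotStep c (nb p.1)) (pilot G θ₀ c U (nb p.1) p.2) 1 - B * a ^ 2))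
      (probFilter μ) (𝓝 0) := by
    refine bdd_le_mul_tendsto_zero' 1 (Eventually.of_forall fun p => ?_) ?_
    · have h := hS.ratio_nonneg_le p.1
      rw [abs_of_nonneg (mul_nonneg (Nat.cast_nonneg _) h.1)]
      exact h.2.2
    · have h := ((hτ.pow 2).mul hS.tendsto_betaE).sub_const (B * a ^ 2)
      rwa [mul_comm (a ^ 2), sub_self] at h
  -- The limits Ba² in `t1` and `t5` carry weights 1 - Kρ and Kρ, whose sum is one.
  have h := (((t1.add t2).add t3).add t4).add t5
  simp only [add_zero] at h
  refine h.congr' ?_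
  filter_upwards [tendsto_fst_probFilter.eventually hS.eventually_nb_pos,
    tendsto_fst_probFilter.eventually hS.eventually_n_pos, hS.eventually_stageWeight,
    hstep.eventually self_mem_nhdsWithin] with p h1 h2 h3 h4
  rw [normalized_error_eq (ν := ν) hS.const_ne_zero hS.exists_abs_ne h1 h2 (hS.mul_le _) h4,
    stageTerm, h3, pilotTerm, limitMean, Lam_eq, ← hadef, ← hB]
  have e1 : ∑ k, noiseWeight c k * pilotError G ν θ₀ c U (nb p.1) p.2 k =
      ∑ k, noiseWeight c k * (pilotBias G ν θ₀ c (nb p.1) k - c k ^ 4 * coeffD G ν θ₀) +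
      coeffD G ν θ₀ * (∑ k, noiseWeight c k * c k ^ 4) +
      ∑ k, noiseWeight c k * pilotNoise G ν θ₀ c U (nb p.1) k p.2 := by
    rw [Finset.mul_sum, ← Finset.sum_add_distrib, ← Finset.sum_add_distrib]
    refine Finset.sum_congr rfl fun k _ => ?_
    rw [pilotError]
    ring
  rw [e1]
  ring

theorem pilotTerm_moments (hS : Setting G ν μ θ₀ r M c U nb n) {m : ℕ} (hN : 0 < nb m)
    (hr : ∀ k, |c k * pilotScale (nb m)| < r) :
    MemLp (pilotTerm G ν θ₀ c U (nb m) (n m)) 4 μ ∧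
    ∫ ω, pilotTerm G ν θ₀ c U (nb m) (n m) ω ∂μ = limitMean G ν θ₀ c ((nb m : ℝ) / n m) ∧
    ∫ ω, pilotTerm G ν θ₀ c U (nb m) (n m) ω ^ 2 ∂μ =
      limitMean G ν θ₀ c ((nb m : ℝ) / n m) ^ 2 + (nb m : ℝ) / n m / stepLimit G ν θ₀ ^ 2 *
        ∫ ω, (∑ k, noiseWeight c k * pilotNoise G ν θ₀ c U (nb m) k ω) ^ 2 ∂μ ∧
    ∫ ω, pilotTerm G ν θ₀ c U (nb m) (n m) ω ^ 4 ∂μ ≤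
      8 * limitMean G ν θ₀ c ((nb m : ℝ) / n m) ^ 4 + 8 * (1 / stepLimit G ν θ₀ ^ 4 *
        (48 * M * (∑ k, |noiseWeight c k / (2 * c k)|) ^ 4 * K ^ 2)) := by
  obtain ⟨h1, h2, h3, h4⟩ := hS.weighted_pilotNoise_moments (noiseWeight c) hN hr
  have ha := hS.stepLimit_pos
  have hρ := hS.ratio_nonneg_le m
  set L := limitMean G ν θ₀ c ((nb m : ℝ) / n m) with hL
  set a := stepLimit G ν θ₀ with hadef
  set ρ := (nb m : ℝ) / n m with hρdef
  set Q : Ω → ℝ := fun ω => ∑ k, noiseWeight c k * pilotNoise G ν θ₀ c U (nb m) k ω with hQ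
  have hP : pilotTerm G ν θ₀ c U (nb m) (n m) = fun ω => L + √ρ / a * Q ω := rfl
  have hPL : MemLp (pilotTerm G ν θ₀ c U (nb m) (n m)) 4 μ := (memLp_const L).add (h1.const_mul _)
  have iQ := h1.integrable (by norm_num)
  have iQ2 := integrable_pow_of_memLp_four h1 (p := 2) (by norm_num)
  have iQ4 := integrable_pow_of_memLp_four h1 (p := 4) le_rfl
  refine ⟨hPL, ?_, ?_, ?_⟩
  · rw [hP, integral_add (integrable_const _) (iQ.const_mul _), integral_const_mul, h2]
    simp
  · have e : ∀ ω, (L + √ρ / a * Q ω) ^ 2 = L ^ 2 + 2 * L * (√ρ / a) * Q ω +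
        ρ / a ^ 2 * Q ω ^ 2 := fun ω => by
      rw [add_sq, mul_pow, div_pow, Real.sq_sqrt hρ.1]
      ring
    rw [hP]
    simp only [e]
    have i1 : Integrable (fun ω => L ^ 2 + 2 * L * (√ρ / a) * Q ω) μ :=
      (integrable_const _).add (iQ.const_mul _)
    rw [integral_add i1 (iQ2.const_mul _), integral_add (integrable_const _) (iQ.const_mul _),
      integral_const_mul, integral_const_mul, h2, integral_const, probReal_univ, one_smul,
      mul_zero, add_zero]
  · have hs4 : √ρ ^ 4 ≤ 1 := by
      rw [show √ρ ^ 4 = (√ρ ^ 2) ^ 2 by ring, Real.sq_sqrt hρ.1]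
      exact pow_le_one₀ hρ.1 hρ.2.1
    have i4 : Integrable (fun ω => 8 * L ^ 4 + 8 * (1 / a ^ 4 * Q ω ^ 4)) μ :=
      (integrable_const _).add ((iQ4.const_mul _).const_mul _)
    calc _ ≤ ∫ ω, (8 * L ^ 4 + 8 * (1 / a ^ 4 * Q ω ^ 4)) ∂μ := by
          refine integral_mono (integrable_pow_of_memLp_four hPL le_rfl) i4 fun ω => ?_
          simp only [hP]
          have g1 : (L + √ρ / a * Q ω) ^ 2 ≤ 2 * (L ^ 2 + (√ρ / a * Q ω) ^ 2) := by
            nlinarith [sq_nonneg (L - √ρ / a * Q ω)]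
          have g2 : (L ^ 2 + (√ρ / a * Q ω) ^ 2) ^ 2 ≤ 2 * (L ^ 4 + (√ρ / a * Q ω) ^ 4) := by
            nlinarith [sq_nonneg (L ^ 2 - (√ρ / a * Q ω) ^ 2)]
          have g3 : (L + √ρ / a * Q ω) ^ 4 ≤ (2 * (L ^ 2 + (√ρ / a * Q ω) ^ 2)) ^ 2 := by
            rw [show (L + √ρ / a * Q ω) ^ 4 = ((L + √ρ / a * Q ω) ^ 2) ^ 2 by ring]
            exact pow_le_pow_left₀ (sq_nonneg _) g1 2
          have g4 : (√ρ / a * Q ω) ^ 4 ≤ 1 / a ^ 4 * Q ω ^ 4 := by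
            rw [mul_pow, div_pow]
            gcongr
          nlinarith
      _ = 8 * L ^ 4 + 8 * (1 / a ^ 4 * ∫ ω, Q ω ^ 4 ∂μ) := by
          rw [integral_add (integrable_const _) ((iQ4.const_mul _).const_mul _),
            integral_const_mul, integral_const_mul, integral_const_mul, integral_const,
            probReal_univ, one_smul]
      _ ≤ _ := by gcongr

/-- The second moment of the stage term. -/
theorem tendsto_integral_stageTerm_sq (hS : Setting G ν μ θ₀ r M c U nb n) :
    Tendsto (fun m => (∫ ω, stageTerm G ν θ₀ r c U (nb m) (n m) ω ^ 2 ∂μ) -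
      (1 - K * ((nb m : ℝ) / n m)) * (stdDev G ν θ₀ ^ 2 / (2 * stepLimit G ν θ₀ ^ 2))) atTop
      (𝓝 0) := by
  have ha := hS.stepLimit_pos
  set a := stepLimit G ν θ₀ with hadef
  -- The number of pairs n - KN is replaced by n, so that the integral converges; the factor 1 - Kρ
  -- is restored afterwards.
  set X : ℕ → Ω → ℝ := fun m ω => stageWeight a r (n m) (randomStep G θ₀ c U (nb m) (n m) ω) ^ 2 *
    n m * noiseVar G ν θ₀ (randomStep G θ₀ c U (nb m) (n m) ω) with hX
  have hlim : Tendsto (fun m => ∫ ω, X m ω ∂μ) atTop (𝓝 (stdDev G ν θ₀ ^ 2 / (2 * a ^ 2))) := by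
    refine tendsto_integral_of_probFilter (C := 1 / a ^ 2 * (2 * √M)) (fun m => ?_)
      (fun m ω => ?_) ?_
    · have hm := (hS.stageTerm_moments m).2.2.2.2.1
      exact (((((measurable_stageWeight a r (n m)).comp hm).pow_const 2).mul_const _).mul
        ((measurable_noiseVar hS.measurable_model).comp hm)).aestronglyMeasurable
    · rw [abs_of_nonneg (mul_nonneg (by positivity) (noiseVar_nonneg _))]
      by_cases hz : stageWeight a r (n m) (randomStep G θ₀ c U (nb m) (n m) ω) = 0
      · simp only [hz]
        rw [zero_pow two_ne_zero, zero_mul, zero_mul]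
        positivity
      · obtain ⟨-, h0, hr, -⟩ := stageWeight_ne_zero ha hz
        exact mul_le_mul (stageWeight_sq_mul_le ha _ _)
          (noiseVar_le hS.measurable_model hS.fourthMomentBound h0.ne' (by rwa [abs_of_pos h0]))
          (noiseVar_nonneg _) (by positivity)
    -- The weight contributes 1/(4a²) and the noise variance 2σ².
    · have h1 := (tendsto_noiseVar hS.continuousAt_stdDev).comp
        (hS.tendsto_randomStep.mono_right nhdsWithin_le_nhds)
      have h2 := ((hS.tendsto_normalizedStep.pow 2).const_mul 4).inv₀ (by positivity)
      have h3 := h2.mul h1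
      rw [← hadef, show (4 * a ^ 2)⁻¹ * (2 * stdDev G ν θ₀ ^ 2) =
        stdDev G ν θ₀ ^ 2 / (2 * a ^ 2) by field_simp; norm_num] at h3
      refine h3.congr' ?_
      filter_upwards [hS.eventually_stageWeight, tendsto_fst_probFilter.eventually
        hS.eventually_n_pos, hS.tendsto_randomStep.eventually self_mem_nhdsWithin] with p e1 e2 e3
      simp only [hX, hadef, e1]
      rw [stageWeight_sq_eq e2 e3, one_div]
      rfl
  have h0 : Tendsto (fun m => (1 - K * ((nb m : ℝ) / n m)) *
      ((∫ ω, X m ω ∂μ) - stdDev G ν θ₀ ^ 2 / (2 * a ^ 2))) atTop (𝓝 0) := by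
    refine bdd_le_mul_tendsto_zero' 1 (Eventually.of_forall fun m => ?_) ?_
    · have h := hS.ratio_nonneg_le m
      have : 0 ≤ K * ((nb m : ℝ) / n m) := mul_nonneg (Nat.cast_nonneg _) h.1
      rw [abs_le]
      constructor <;> linarith [h.2.2]
    · have h := hlim.sub_const (stdDev G ν θ₀ ^ 2 / (2 * a ^ 2))
      rwa [sub_self] at h
  refine h0.congr' ?_
  filter_upwards [hS.eventually_n_pos] with m hm
  have hm0 : (n m : ℝ) ≠ 0 := by positivity
  rw [(hS.stageTerm_moments m).2.2.1, mul_sub, ← integral_const_mul]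
  congr 1
  refine integral_congr_ae (Eventually.of_forall fun ω => ?_)
  simp only [hX, hadef]
  rw [Nat.cast_sub (hS.mul_le m)]
  push_cast
  field_simp

/-- The limits of the first two moments of the normalized error. -/
theorem tendsto_moments (hS : Setting G ν μ θ₀ r M c U nb n)
    (hUI : UniformIntegrable (fun m ω => (n m : ℝ) ^ (1 / 3 : ℝ) *
      (estimator G θ₀ c U (nb m) (n m) ω - deriv (perf G ν) θ₀)) 2 μ) :
    Tendsto (fun m => (∫ ω, (n m : ℝ) ^ (1 / 3 : ℝ) *
      (estimator G θ₀ c U (nb m) (n m) ω - deriv (perf G ν) θ₀) ∂μ) -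
        limitMean G ν θ₀ c ((nb m : ℝ) / n m)) atTop (𝓝 0) ∧
    Tendsto (fun m => (∫ ω, ((n m : ℝ) ^ (1 / 3 : ℝ) *
      (estimator G θ₀ c U (nb m) (n m) ω - deriv (perf G ν) θ₀)) ^ 2 ∂μ) -
        (limitMean G ν θ₀ c ((nb m : ℝ) / n m) ^ 2 + limitVar G ν θ₀ c ((nb m : ℝ) / n m))) atTop
      (𝓝 0) := by
  have ha := hS.stepLimit_pos
  set Z : ℕ → Ω → ℝ := fun m ω => (n m : ℝ) ^ (1 / 3 : ℝ) *
      (estimator G θ₀ c U (nb m) (n m) ω - deriv (perf G ν) θ₀) with hZ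
  set P : ℕ → Ω → ℝ := fun m => pilotTerm G ν θ₀ c U (nb m) (n m) with hP
  set T : ℕ → Ω → ℝ := fun m => stageTerm G ν θ₀ r c U (nb m) (n m) with hT
  set W : ℕ → Ω → ℝ := fun m => P m + T m with hW
  have hgood := hS.eventually_nb_pos.and hS.eventually_pilotStep_lt
  have hZL : ∀ m, MemLp (Z m) 2 μ := fun m => hUI.memLp m
  have hWm : ∀ m, AEStronglyMeasurable (W m) μ := fun m =>
    (hS.stageTerm_moments m).2.2.2.1.aestronglyMeasurable.add (hS.stageTerm_moments m).1.1
  have hPL : ∀ᶠ m in atTop, MemLp (P m) 4 μ := hgood.mono fun m hm =>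
    (hS.pilotTerm_moments hm.1 hm.2).1
  have hTL : ∀ m, MemLp (T m) 4 μ := fun m => (hS.stageTerm_moments m).1
  have hWL : ∀ᶠ m in atTop, MemLp (W m) 4 μ := hPL.mono fun m hm => hm.add (hTL m)
  set L₀ := |coeffB G ν θ₀ * stepLimit G ν θ₀ ^ 2| +
      |(stepLimit G ν θ₀)⁻¹ * (coeffD G ν θ₀ * Lam c)| with hL₀
  obtain ⟨C1, hC1⟩ : ∃ C1 : ℝ≥0, ∀ᶠ m in atTop, eLpNorm (P m) 4 μ ≤ C1 := by
    refine ⟨_, hgood.mono fun m hm => eLpNorm_four_le (hS.pilotTerm_moments hm.1 hm.2).1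
      (C := 8 * L₀ ^ 4 + 8 * (1 / stepLimit G ν θ₀ ^ 4 *
        (48 * M * (∑ k, |noiseWeight c k / (2 * c k)|) ^ 4 * K ^ 2)))
      ((hS.pilotTerm_moments hm.1 hm.2).2.2.2.trans ?_)⟩
    have h := pow_le_pow_left₀ (abs_nonneg _) (hS.abs_limitMean_le m) 4
    rw [(by decide : Even 4).pow_abs] at h
    linarith
  obtain ⟨C2, hC2⟩ : ∃ C2 : ℝ≥0, ∀ m, eLpNorm (T m) 4 μ ≤ C2 :=
    ⟨_, fun m => eLpNorm_four_le (hTL m) (hS.stageTerm_moments m).2.1⟩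
  have hWC : ∀ᶠ m in atTop, eLpNorm (W m) 4 μ ≤ (C1 + C2 : ℝ≥0) := by
    filter_upwards [hC1, hPL] with m h1 h2
    rw [ENNReal.coe_add]
    exact (eLpNorm_add_le h2.1 (hTL m).1 (by norm_num)).trans (add_le_add h1 (hC2 m))
  have hlim := tendsto_eLpNorm_sub_of_probFilter hUI hWm hWC hS.tendsto_error_sub
  have hW2 : ∀ᶠ m in atTop, ∫ ω, W m ω ^ 2 ∂μ = limitMean G ν θ₀ c ((nb m : ℝ) / n m) ^ 2 +
      (nb m : ℝ) / n m / stepLimit G ν θ₀ ^ 2 *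
        (∫ ω, (∑ k, noiseWeight c k * pilotNoise G ν θ₀ c U (nb m) k ω) ^ 2 ∂μ) +
      ∫ ω, T m ω ^ 2 ∂μ := by
    filter_upwards [hgood] with m hm
    obtain ⟨p1, p2, p3, -⟩ := hS.pilotTerm_moments hm.1 hm.2
    -- Orthogonality of the two parts leaves only their separate second moments.
    have hcross := (hS.stageTerm_moments m).2.2.2.2.2.1 p1
    have iP2 := integrable_pow_of_memLp_four p1 (p := 2) (by norm_num)
    have iT2 := integrable_pow_of_memLp_four (hTL m) (p := 2) (by norm_num)
    have iPT : Integrable (fun ω => P m ω * T m ω) μ :=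
      MemLp.integrable_mul (p := 2) (q := 2) (p1.mono_exponent (by norm_num))
        ((hTL m).mono_exponent (by norm_num))
    have e : ∀ ω, W m ω ^ 2 = P m ω ^ 2 + 2 * (P m ω * T m ω) + T m ω ^ 2 := fun ω => by
      simp only [hW, Pi.add_apply]
      ring
    have i1 : Integrable (fun ω => P m ω ^ 2 + 2 * (P m ω * T m ω)) μ :=
      iP2.add (iPT.const_mul 2)
    simp only [e]
    rw [integral_add i1 iT2, integral_add iP2 (iPT.const_mul 2), integral_const_mul, hcross, p3,
      mul_zero, add_zero]
  have hW1 : ∀ᶠ m in atTop, ∫ ω, W m ω ∂μ = limitMean G ν θ₀ c ((nb m : ℝ) / n m) := by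
    filter_upwards [hgood] with m hm
    obtain ⟨p1, p2, -⟩ := hS.pilotTerm_moments hm.1 hm.2
    have h0 := (hS.stageTerm_moments m).2.2.2.2.2.2
    have : ∀ ω, W m ω = P m ω + T m ω := fun ω => rfl
    simp only [this]
    rw [integral_add (p1.integrable (by norm_num)) ((hTL m).integrable (by norm_num)), h0, p2,
      add_zero]
  have hW2lim : Tendsto (fun m => (∫ ω, W m ω ^ 2 ∂μ) -
      (limitMean G ν θ₀ c ((nb m : ℝ) / n m) ^ 2 + limitVar G ν θ₀ c ((nb m : ℝ) / n m))) atTop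
      (𝓝 0) := by
    have hQ := hS.tendsto_integral_weighted_pilotNoise_sq (noiseWeight c)
    rw [← qConst_eq] at hQ
    have h1 : Tendsto (fun m => (nb m : ℝ) / n m * ((stepLimit G ν θ₀ ^ 2)⁻¹ *
        ((∫ ω, (∑ k, noiseWeight c k * pilotNoise G ν θ₀ c U (nb m) k ω) ^ 2 ∂μ) -
          qConst c * (stdDev G ν θ₀ ^ 2 / 2)))) atTop (𝓝 0) := by
      refine bdd_le_mul_tendsto_zero' 1 (Eventually.of_forall fun m => ?_) ?_
      · have h := hS.ratio_nonneg_le m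
        rw [abs_of_nonneg h.1]
        exact h.2.1
      · have h := (hQ.sub_const (qConst c * (stdDev G ν θ₀ ^ 2 / 2))).const_mul
          (stepLimit G ν θ₀ ^ 2)⁻¹
        rwa [sub_self, mul_zero] at h
    have h2 := h1.add hS.tendsto_integral_stageTerm_sq
    rw [add_zero] at h2
    refine h2.congr' ?_
    filter_upwards [hW2] with m hm
    rw [hm, limitVar]
    field_simp
    ring
  have hWC2 : ∃ C : ℝ, ∀ᶠ m in atTop, ∫ ω, W m ω ^ 2 ∂μ ≤ C := by
    refine ⟨((C1 + C2 : ℝ≥0) : ℝ) ^ 2, ?_⟩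
    filter_upwards [hWL, hWC] with m h1 h2
    have hL2 : MemLp (W m) 2 μ := h1.mono_exponent (by norm_num)
    have h3 : eLpNorm (W m) 2 μ ≤ (C1 + C2 : ℝ≥0) :=
      (eLpNorm_le_eLpNorm_of_exponent_le (by norm_num) (hWm m)).trans h2
    rw [eLpNorm_two_eq hL2, ENNReal.ofReal_le_coe, Real.sqrt_le_left (by positivity)] at h3
    exact h3
  obtain ⟨C, hC⟩ := hWC2
  obtain ⟨r1, r2⟩ := tendsto_moments_sub hZL (hWL.mono fun m hm => hm.mono_exponent (by norm_num))
    hC hlim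
  refine ⟨r1.congr' ?_, ?_⟩
  · filter_upwards [hW1] with m hm
    rw [hm]
  · have h := r2.add hW2lim
    rw [add_zero] at h
    refine h.congr fun m => ?_
    ring

end Setting

/-! ### Roots, signs and powers in the final constants. -/

section Constants

theorem rpow_one_third_eq {x y : ℝ} (hx : 0 ≤ x) (h : x ^ 3 = y) : y ^ (1 / 3 : ℝ) = x := by
  rw [← h, ← Real.rpow_natCast, ← Real.rpow_mul hx]
  norm_num

theorem rpow_one_sixth_eq {x y : ℝ} (hx : 0 ≤ x) (h : x ^ 6 = y) : y ^ (1 / 6 : ℝ) = x := by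
  rw [← h, ← Real.rpow_natCast, ← Real.rpow_mul hx]
  norm_num

theorem cbrt_eq {x y : ℝ} (h : x ^ 3 = y) : cbrt y = x := by
  rw [cbrt, rpow_one_third_eq (abs_nonneg x) (by rw [← abs_pow, h]), ← h]
  rcases lt_trichotomy x 0 with hx | rfl | hx
  · rw [Real.sign_of_neg (Odd.pow_neg (by decide) hx), abs_of_neg hx]
    ring
  · simp
  · rw [Real.sign_of_pos (by positivity), abs_of_pos hx, one_mul]

/-- The hypothesis says s = 2|B|a³, and the sign of B removes the absolute value. -/
theorem sign_mul_eq {a B s : ℝ} (ha : 0 < a) (hs : 0 < s) (h : 4 * B ^ 2 * a ^ 6 = s ^ 2) :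
    Real.sign B * s = 2 * B * a ^ 3 := by
  have hs' : s = 2 * |B| * a ^ 3 := by
    refine (sq_eq_sq₀ hs.le (by positivity)).1 ?_
    rw [← h, mul_pow, mul_pow, sq_abs]
    ring
  rcases lt_trichotomy B 0 with hB | rfl | hB
  · rw [hs', Real.sign_of_neg hB, abs_of_neg hB]
    ring
  · simp
  · rw [hs', Real.sign_of_pos hB, abs_of_pos hB]
    ring

theorem rpow_neg_one_third (n : ℕ) :
    (n : ℝ) ^ (-(1 / 3) : ℝ) = (sixthRoot n ^ 2)⁻¹ := by
  rw [Real.rpow_neg (Nat.cast_nonneg n), sixthRoot_sq]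

theorem rpow_neg_two_thirds {n : ℕ} (hn : 0 < n) :
    (n : ℝ) ^ (-(2 / 3) : ℝ) = (sixthRoot n ^ 4)⁻¹ := by
  rw [show (-(2 / 3) : ℝ) = -(1 / 3) + -(1 / 3) by norm_num,
    Real.rpow_add (by exact_mod_cast hn), rpow_neg_one_third, ← mul_inv]
  ring

end Constants

/-! ### Passage to runs that are measurable only up to null sets. -/

section Transfer

variable {S Ω : Type*} [MeasurableSpace Ω] {μ : Measure Ω} {K : ℕ}

/-- There are countably many runs, so one null set serves for all of them. -/
theorem ae_estimator_congr (G : ℝ → S → ℝ) (θ₀ : ℝ) (c : Fin K → ℝ) {U V : Run K → Ω → S}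
    (h : ∀ p, U p =ᵐ[μ] V p) (N n : ℕ) :
    estimator G θ₀ c U N n =ᵐ[μ] estimator G θ₀ c V N n := by
  filter_upwards [ae_all_iff.2 h] with ω hω
  have hp : pilot G θ₀ c U N ω = pilot G θ₀ c V N ω := by
    funext k j
    simp only [pilot, hω]
  simp only [estimator, randomStep, hp, hω]

variable [MeasurableSpace S] {ν : Measure S} [IsProbabilityMeasure ν]
  [IsProbabilityMeasure μ] {G : ℝ → S → ℝ}
  {θ₀ : ℝ} {c : Fin K → ℝ} {U : Run K → Ω → S} {nb n : ℕ → ℕ}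

/-- The limits of the first two moments of the normalized error, for runs that are measurable up
to null sets. -/
theorem tendsto_moments_of_hasLaw (hG : Measurable (Function.uncurry G)) (hK : 0 < K)
    (hc0 : ∀ k, c k ≠ 0) (hc2 : ∃ j k, |c j| ≠ |c k|)
    (hUlaw : ∀ p, HasLaw (U p) ν μ) (hUind : iIndepFun U μ)
    (hα : ContDiffAt ℝ 5 (perf G ν) θ₀) (hB : coeffB G ν θ₀ ≠ 0)
    (hσ : ContinuousAt (stdDev G ν) θ₀) (hσ0 : 0 < stdDev G ν θ₀)
    (hfour : ∃ M : ℝ≥0, ∀ᶠ θ in 𝓝[≠] θ₀, ∫⁻ u, ‖G θ u - perf G ν θ‖ₑ ^ 4 ∂ν ≤ M)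
    (hnb : Tendsto nb atTop atTop) (hn : Tendsto n atTop atTop) (hle : ∀ m, K * nb m ≤ n m)
    (hUI : UniformIntegrable (fun m ω => (n m : ℝ) ^ (1 / 3 : ℝ) *
      (estimator G θ₀ c U (nb m) (n m) ω - deriv (perf G ν) θ₀)) 2 μ) :
    Tendsto (fun m => (∫ ω, (n m : ℝ) ^ (1 / 3 : ℝ) *
      (estimator G θ₀ c U (nb m) (n m) ω - deriv (perf G ν) θ₀) ∂μ) -
        limitMean G ν θ₀ c ((nb m : ℝ) / n m)) atTop (𝓝 0) ∧
    Tendsto (fun m => (∫ ω, ((n m : ℝ) ^ (1 / 3 : ℝ) *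
      (estimator G θ₀ c U (nb m) (n m) ω - deriv (perf G ν) θ₀)) ^ 2 ∂μ) -
        (limitMean G ν θ₀ c ((nb m : ℝ) / n m) ^ 2 + limitVar G ν θ₀ c ((nb m : ℝ) / n m))) atTop
      (𝓝 0) ∧
    ∃ C, ∀ m, |limitMean G ν θ₀ c ((nb m : ℝ) / n m)| ≤ C := by
  obtain ⟨r, hr, M, hM, hbound⟩ := exists_fourthMomentBound hG hfour
  have hUV : ∀ p, U p =ᵐ[μ] (hUlaw p).aemeasurable.mk (U p) := fun p =>
    (hUlaw p).aemeasurable.ae_eq_mk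
  set V : Run K → Ω → S := fun p => (hUlaw p).aemeasurable.mk (U p) with hV
  have hS : Setting G ν μ θ₀ r M c V nb n :=
    { measurable_model := hG
      radius_pos := hr
      bound_nonneg := hM
      fourthMomentBound := hbound
      measurable_run := fun p => (hUlaw p).aemeasurable.measurable_mk
      map_run := fun p => by rw [← Measure.map_congr (hUV p), (hUlaw p).map_eq]
      iIndepFun_run := hUind.congr hUV
      card_pos := hK
      const_ne_zero := hc0
      exists_abs_ne := hc2
      contDiffAt_perf := hα
      coeffB_ne_zero := hB
      continuousAt_stdDev := hσ
      stdDev_pos := hσ0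
      tendsto_nb := hnb
      tendsto_n := hn
      mul_le := hle }
  have hest := fun m => ae_estimator_congr G θ₀ c hUV (nb m) (n m)
  obtain ⟨h1, h2⟩ := hS.tendsto_moments (hUI.ae_eq fun m => by
    filter_upwards [hest m] with ω hω
    rw [hω])
  refine ⟨h1.congr fun m => ?_, h2.congr fun m => ?_, _, hS.abs_limitMean_le⟩
  · congr 1
    refine integral_congr_ae ?_
    filter_upwards [hest m] with ω hω
    rw [hω]
  · congr 1
    refine integral_congr_ae ?_
    filter_upwards [hest m] with ω hω
    rw [hω]

end Transfer

section Rescaling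

variable {Ω : Type*} [MeasurableSpace Ω] {μ : Measure Ω} [IsProbabilityMeasure μ]

/-- The moments of `X` in terms of those of `s * (X - x₀)`. -/
theorem moments_of_rescaled {X : Ω → ℝ} {x₀ s : ℝ} (hs : s ≠ 0)
    (h : MemLp (fun ω => s * (X ω - x₀)) 2 μ) :
    ∫ ω, X ω ∂μ = x₀ + s⁻¹ * ∫ ω, s * (X ω - x₀) ∂μ ∧
    ∫ ω, (X ω - x₀) ^ 2 ∂μ = (s ^ 2)⁻¹ * ∫ ω, (s * (X ω - x₀)) ^ 2 ∂μ ∧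
    variance X μ = (s ^ 2)⁻¹ *
      ((∫ ω, (s * (X ω - x₀)) ^ 2 ∂μ) - (∫ ω, s * (X ω - x₀) ∂μ) ^ 2) := by
  set Z : Ω → ℝ := fun ω => s * (X ω - x₀) with hZ
  have hX : X = fun ω => s⁻¹ * Z ω + x₀ := by
    funext ω
    simp only [hZ]
    rw [inv_mul_cancel_left₀ hs, sub_add_cancel]
  have hZi := h.integrable (by norm_num)
  refine ⟨?_, ?_, ?_⟩
  · have h1 : ∫ ω, X ω ∂μ = ∫ ω, (s⁻¹ * Z ω + x₀) ∂μ := by rw [hX]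
    rw [h1, integral_add (hZi.const_mul _) (integrable_const _), integral_const_mul, integral_const,
      probReal_univ, one_smul, add_comm]
  · rw [← integral_const_mul]
    refine integral_congr_ae (Eventually.of_forall fun ω => ?_)
    field_simp
  · have h1 : variance X μ = variance (fun ω => s⁻¹ * Z ω + x₀) μ := by rw [← hX]
    rw [h1, variance_add_const (h.1.const_mul _), variance_const_mul, variance_eq_sub h, inv_pow]
    rfl

end Rescaling

theorem isLittleO_of_eventually_eq_mul {f g e : ℕ → ℝ} (he : Tendsto e atTop (𝓝 0))
    (h : ∀ᶠ m in atTop, f m = e m * g m) : f =o[atTop] g :=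
  isLittleO_iff_exists_eq_mul.2 ⟨e, he, h⟩

end CorCFD

end

/-! ### Assembly of the three expansions. -/

theorem theorem4
    {S Ω : Type*} [MeasurableSpace S] [MeasurableSpace Ω]
    -- the simulation model and the point of interest
    (G : ℝ → S → ℝ) (hG : Measurable (Function.uncurry G))
    (ν : Measure S) [IsProbabilityMeasure ν]
    (μ : Measure Ω) [IsProbabilityMeasure μ] (θ₀ : ℝ)
    -- pilot constants: nonzero, distinct, and the regression on `(1, h_k ^ 2)` is well posed
    (K : ℕ) (hK : 2 ≤ K) (c : Fin K → ℝ) (hc0 : ∀ k, c k ≠ 0) (hc : Function.Injective c)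
    (hc2 : ∃ j k, |c j| ≠ |c k|)
    -- independent runs with random inputs of law `ν`
    (U : CorCFD.Run K → Ω → S) (hUlaw : ∀ r, HasLaw (U r) ν μ) (hUind : iIndepFun U μ)
    -- smoothness of the mean, nonvanishing derivatives
    (hα3 : ContDiffAt ℝ 3 (CorCFD.perf G ν) θ₀)
    (hα3' : iteratedDeriv 3 (CorCFD.perf G ν) θ₀ ≠ 0)
    (hα5 : ContDiffAt ℝ 5 (CorCFD.perf G ν) θ₀)
    (hα5' : iteratedDeriv 5 (CorCFD.perf G ν) θ₀ ≠ 0)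
    -- the standard deviation is continuous at `θ₀` and positive
    (hσ : ContinuousAt (CorCFD.stdDev G ν) θ₀) (hσ0 : 0 < CorCFD.stdDev G ν θ₀)
    -- fourth central moments are bounded near `θ₀`
    (hfour : ∃ M : ℝ≥0, ∀ᶠ θ in 𝓝[≠] θ₀,
      ∫⁻ u, ‖G θ u - CorCFD.perf G ν θ‖ₑ ^ 4 ∂ν ≤ M)
    -- sample sizes
    (nb n : ℕ → ℕ) (hnb : Tendsto nb atTop atTop) (hn : Tendsto n atTop atTop)
    (hle : ∀ m, K * nb m ≤ n m)
    -- uniform square integrability of the normalized error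
    (hUI : UniformIntegrable (fun m ω => (n m : ℝ) ^ (1 / 3 : ℝ) *
      (CorCFD.estimator G θ₀ c U (nb m) (n m) ω - deriv (CorCFD.perf G ν) θ₀)) 2 μ) :
    let α' : ℝ := deriv (CorCFD.perf G ν) θ₀
    let σ : ℝ := CorCFD.stdDev G ν θ₀
    let B : ℝ := CorCFD.coeffB G ν θ₀
    let D : ℝ := CorCFD.coeffD G ν θ₀
    let Λ : ℝ := CorCFD.Lam c
    let q : ℝ := CorCFD.qConst c
    let est : ℕ → Ω → ℝ := fun m => CorCFD.estimator G θ₀ c U (nb m) (n m)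
    -- expectation
    ((fun m => (∫ ω, est m ω ∂μ) -
        (α' + CorCFD.cbrt (B * σ ^ 2 / (4 * n m)) +
          (4 * B ^ 2 / σ ^ 2) ^ (1 / 6 : ℝ) * √((nb m : ℝ) / n m) * (D * Λ) *
            (n m : ℝ) ^ (-(1 / 3) : ℝ)))
      =o[atTop] fun m => (n m : ℝ) ^ (-(1 / 3) : ℝ)) ∧
    -- variance
    ((fun m => variance (est m) μ -
        ((B ^ 2 * σ ^ 4 / (2 * (n m : ℝ) ^ 2)) ^ (1 / 3 : ℝ) +
          (B ^ 2 * σ ^ 4 / 2) ^ (1 / 3 : ℝ) * ((nb m : ℝ) / n m) * (q - K) *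
            (n m : ℝ) ^ (-(2 / 3) : ℝ)))
      =o[atTop] fun m => (n m : ℝ) ^ (-(2 / 3) : ℝ)) ∧
    -- mean squared error
    ((fun m => (∫ ω, (est m ω - α') ^ 2 ∂μ) -
        (3 * (B ^ 2 * σ ^ 4 / (16 * (n m : ℝ) ^ 2)) ^ (1 / 3 : ℝ) +
          ((4 * B ^ 2 / σ ^ 2) ^ (1 / 3 : ℝ) * √((nb m : ℝ) / n m) * (D * Λ) *
              (√((nb m : ℝ) / n m) * (D * Λ) + Real.sign B * σ) +
            (B ^ 2 * σ ^ 4 / 2) ^ (1 / 3 : ℝ) * ((nb m : ℝ) / n m) * (q - K)) *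
            (n m : ℝ) ^ (-(2 / 3) : ℝ)))
      =o[atTop] fun m => (n m : ℝ) ^ (-(2 / 3) : ℝ)) := by
  intro α' σ B D Λ q est
  have hB : B ≠ 0 := div_ne_zero hα3' (by norm_num)
  obtain ⟨h1, h2, C, hC⟩ := CorCFD.tendsto_moments_of_hasLaw hG (by omega) hc0 hc2 hUlaw hUind hα5
    hB hσ hσ0 hfour hnb hn hle hUI
  have hpos : 0 < σ ^ 2 / (4 * B ^ 2) := by positivity
  have ha : 0 < CorCFD.stepLimit G ν θ₀ := Real.rpow_pos_of_pos hpos _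
  have ha6 : 4 * B ^ 2 * CorCFD.stepLimit G ν θ₀ ^ 6 = σ ^ 2 := by
    have h : CorCFD.stepLimit G ν θ₀ ^ 6 = σ ^ 2 / (4 * B ^ 2) := by
      change ((σ ^ 2 / (4 * B ^ 2)) ^ (1 / 6 : ℝ)) ^ 6 = _
      rw [← Real.rpow_natCast, ← Real.rpow_mul hpos.le]
      norm_num
    rw [h]
    field_simp
  have hσ0' : 0 < σ := hσ0
  have hmean : ∀ ρ, CorCFD.limitMean G ν θ₀ c ρ =
      B * CorCFD.stepLimit G ν θ₀ ^ 2 + √ρ / CorCFD.stepLimit G ν θ₀ * (D * Λ) := fun ρ => rfl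
  have hvar : ∀ ρ, CorCFD.limitVar G ν θ₀ c ρ =
      (1 + ρ * (q - K)) * (2 * B ^ 2 * CorCFD.stepLimit G ν θ₀ ^ 4) := fun ρ => by
    change (1 + ρ * (q - K)) * (σ ^ 2 / (2 * CorCFD.stepLimit G ν θ₀ ^ 2)) = _
    rw [← ha6]
    field_simp
    ring
  generalize CorCFD.stepLimit G ν θ₀ = a at ha ha6 hmean hvar
  -- By 4B²a⁶ = σ² every root in the conclusion becomes a monomial in B, a and n^(1/6).
  have k1 : (4 * B ^ 2 / σ ^ 2) ^ (1 / 6 : ℝ) = a⁻¹ :=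
    CorCFD.rpow_one_sixth_eq (by positivity) (by rw [← ha6]; field_simp)
  have k2 : (4 * B ^ 2 / σ ^ 2) ^ (1 / 3 : ℝ) = (a ^ 2)⁻¹ :=
    CorCFD.rpow_one_third_eq (by positivity) (by rw [← ha6]; field_simp)
  have hσ4 : σ ^ 4 = 16 * B ^ 4 * a ^ 12 := by
    rw [show σ ^ 4 = (σ ^ 2) ^ 2 by ring, ← ha6]
    ring
  have k3 : (B ^ 2 * σ ^ 4 / 2) ^ (1 / 3 : ℝ) = 2 * B ^ 2 * a ^ 4 :=
    CorCFD.rpow_one_third_eq (by positivity) (by rw [hσ4]; ring)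
  have k4 : Real.sign B * σ = 2 * B * a ^ 3 := CorCFD.sign_mul_eq ha hσ0' ha6
  have hp := fun m (hm : 0 < n m) => CorCFD.sixthRoot_pos hm
  have hp6 := fun m => CorCFD.sixthRoot_pow (n m)
  have k5 : ∀ m, 0 < n m → CorCFD.cbrt (B * σ ^ 2 / (4 * n m)) =
      B * a ^ 2 * (CorCFD.sixthRoot (n m) ^ 2)⁻¹ := fun m hm => by
    have := hp m hm
    refine CorCFD.cbrt_eq ?_
    rw [← hp6 m, ← ha6]
    field_simp
  have k6 : ∀ m, 0 < n m → (B ^ 2 * σ ^ 4 / (2 * (n m : ℝ) ^ 2)) ^ (1 / 3 : ℝ) =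
      2 * B ^ 2 * a ^ 4 * (CorCFD.sixthRoot (n m) ^ 4)⁻¹ := fun m hm => by
    have := hp m hm
    refine CorCFD.rpow_one_third_eq (by positivity) ?_
    rw [← hp6 m, hσ4]
    field_simp
    ring
  have k7 : ∀ m, 0 < n m → (B ^ 2 * σ ^ 4 / (16 * (n m : ℝ) ^ 2)) ^ (1 / 3 : ℝ) =
      B ^ 2 * a ^ 4 * (CorCFD.sixthRoot (n m) ^ 4)⁻¹ := fun m hm => by
    have := hp m hm
    refine CorCFD.rpow_one_third_eq (by positivity) ?_
    rw [← hp6 m, hσ4]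
    field_simp
  have hpos_n : ∀ᶠ m in atTop, 0 < n m := hn.eventually_gt_atTop 0
  set E₁ : ℕ → ℝ := fun m => ∫ ω, (n m : ℝ) ^ (1 / 3 : ℝ) * (est m ω - α') ∂μ
  set E₂ : ℕ → ℝ := fun m => ∫ ω, ((n m : ℝ) ^ (1 / 3 : ℝ) * (est m ω - α')) ^ 2 ∂μ
  set L : ℕ → ℝ := fun m => CorCFD.limitMean G ν θ₀ c ((nb m : ℝ) / n m) with hL
  set V : ℕ → ℝ := fun m => CorCFD.limitVar G ν θ₀ c ((nb m : ℝ) / n m) with hV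
  have hmom : ∀ m, 0 < n m → (∫ ω, est m ω ∂μ = α' + ((n m : ℝ) ^ (1 / 3 : ℝ))⁻¹ * E₁ m) ∧
      (∫ ω, (est m ω - α') ^ 2 ∂μ = (((n m : ℝ) ^ (1 / 3 : ℝ)) ^ 2)⁻¹ * E₂ m) ∧
      variance (est m) μ = (((n m : ℝ) ^ (1 / 3 : ℝ)) ^ 2)⁻¹ * (E₂ m - E₁ m ^ 2) := fun m hm =>
    CorCFD.moments_of_rescaled (Real.rpow_pos_of_pos (by exact_mod_cast hm) _).ne' (hUI.memLp m)
  replace h1 : Tendsto (fun m => E₁ m - L m) atTop (𝓝 0) := h1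
  replace h2 : Tendsto (fun m => E₂ m - (L m ^ 2 + V m)) atTop (𝓝 0) := h2
  -- E₂ - E₁² - V = (E₂ - L² - V) - 2L(E₁ - L) - (E₁ - L)², where L is bounded.
  have h3 : Tendsto (fun m => E₂ m - E₁ m ^ 2 - V m) atTop (𝓝 0) := by
    have e1 : Tendsto (fun m => L m * (E₁ m - L m)) atTop (𝓝 0) :=
      bdd_le_mul_tendsto_zero' C (Eventually.of_forall hC) h1
    have e2 := (h2.sub (e1.const_mul 2)).sub (h1.pow 2)
    simp only [mul_zero, sub_zero, zero_pow two_ne_zero] at e2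
    refine e2.congr fun m => ?_
    ring
  refine ⟨CorCFD.isLittleO_of_eventually_eq_mul h1 ?_, CorCFD.isLittleO_of_eventually_eq_mul h3 ?_,
    CorCFD.isLittleO_of_eventually_eq_mul h2 ?_⟩
  · filter_upwards [hpos_n] with m hm
    have hpm := hp m hm
    rw [(hmom m hm).1, k1, k5 m hm, CorCFD.rpow_neg_one_third]
    simp only [hL, hmean, CorCFD.sixthRoot_sq]
    field_simp
    ring
  · filter_upwards [hpos_n] with m hm
    have hpm := hp m hm
    rw [(hmom m hm).2.2, k3, k6 m hm, CorCFD.rpow_neg_two_thirds hm, CorCFD.sixthRoot_sq]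
    simp only [hV, hvar]
    field_simp
  · filter_upwards [hpos_n] with m hm
    have hpm := hp m hm
    have hρ : √((nb m : ℝ) / n m) ^ 2 = (nb m : ℝ) / n m := Real.sq_sqrt (by positivity)
    -- Squaring the mean gives B²a⁴, which joins 2B²a⁴ from the variance to produce the factor 3;
    -- its cross term is matched through sign(B)σ = 2Ba³.
    rw [(hmom m hm).2.1, k2, k3, k4, k7 m hm, CorCFD.rpow_neg_two_thirds hm, CorCFD.sixthRoot_sq]
    simp only [hL, hV, hmean, hvar]
    generalize √((nb m : ℝ) / n m) = w at hρ ⊢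
    rw [← hρ]
    field_simp
    ring
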